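/- Let $k$ be a field. A *quantum groupoid* $H$ over $k$ is a $k$-algebra and $k$-coalgebra $(H,\Delta,\varepsilon)$, with Sweedler notation $\Delta(h)=h_1\otimes h_2$, such that $\Delta(hl)=\Delta(h)\Delta(l)$, $$(\mathrm{id}\otimes\Delta)\Delta(1)=(\Delta(1)\otimes 1)(1\otimes\Delta(1))=(1\otimes\Delta(1))(\Delta(1)\otimes 1),$$ $$\varepsilon(hgl)=\varepsilon(hg_1)\varepsilon(g_2l)=\varepsilon(hg_2)\varepsilon(g_1l)\qquad(h,g,l\in H),$$ together with a bijective linear map $S:H\to H$ (the antipode) such that $S(h_1)h_2=\varepsilon_s(h)$, $h_1S(h_2)=\varepsilon_t(h)$ and $S(h_1)h_2S(h_3)=S(h)$, where $\varepsilon_t(h)=\varepsilon(1_1h)1_2$ and $\varepsilon_s(h)=1_1\varepsilon(h1_2)$. Put $H_t=\varepsilon_t(H)$, $H_s=\varepsilon_s(H)$ and $C_H(H_s)=\{g\in H: gx=xg\ \text{for all}\ x\in H_s\}$. A *quasitriangular structure* on $H$ is an element $\mathcal R=R^{(1)}\otimes R^{(2)}\in\Delta^{cop}(1)(H\otimes H)\Delta(1)$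 such that $(\mathrm{id}\otimes\Delta)\mathcal R=\mathcal R_{13}\mathcal R_{12}$, $(\Delta\otimes\mathrm{id})\mathcal R=\mathcal R_{13}\mathcal R_{23}$, $\Delta^{cop}(h)\mathcal R=\mathcal R\Delta(h)$ for all $h\in H$, and there is $\mathcal R^{-1}\in\Delta(1)(H\otimes H)\Delta^{cop}(1)$ with $\mathcal R\mathcal R^{-1}=\Delta^{cop}(1)$ and $\mathcal R^{-1}\mathcal R=\Delta(1)$. For such $(H,\mathcal R)$ the category ${}_H\mathcal M$ of left $H$-modules is braided monoidal: $V\otimes_tW=\Delta(1)(V\otimes W)\subseteq V\otimes W$ with $H$ acting through $\Delta$, and $v\otimes_tw:=1_1v\otimes 1_2w$; the unit object is $H_t$ with $h\cdot z=\varepsilon_t(hz)$; the unit constraints are $z\otimes_tv\mapsto zv$ and $v\otimes_tz\mapsto S^{-1}(z)v$; the associator is the restriction of the usual one; and the braiding is $v\otimes_tw\mapsto R^{(2)}w\otimes_tR^{(1)}v$. A Hopf algebra in ${}_H\mathcal M$ is a Hopf monoid in this braided monoidal category, with all structure maps $H$-linear. **Corollary 2.5.** Let $(H,\mathcal R)$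 be a quasitriangular quantum groupoid. Then $$h\cdot g=Ad_h(g)=h_1gS(h_2)\qquad(h\in H,\ g\in C_H(H_s))$$ makes $C_H(H_s)$ a left $H$-module, and $C_H(H_s)$ is a Hopf algebra in ${}_H\mathcal M$ with multiplication, unit, comultiplication, counit and antipode given, for $g,l\in C_H(H_s)$ and $x\in H_t$, by $$\widehat\mu(g\otimes_tl)=gl,\qquad \widehat\eta(x)=x,\qquad \widehat\Delta(g)=g_1S(R^{(2)})\otimes Ad_{R^{(1)}}(g_2),$$ $$\widehat\varepsilon(g)=\varepsilon_t(g),\qquad \widehat S(g)=R^{(2)}S\big(Ad_{R^{(1)}}(g)\big),$$ where $Ad_h(a)=h_1aS(h_2)$ for all $h,a\in H$, and the formula for $\widehat\Delta(g)$ is an equality in $H\otimes H$, whose right-hand side lies in $C_H(H_s)\otimes_tC_H(H_s)\subseteq C_H(H_s)\otimes C_H(H_s)\subseteq H\otimes H$. -/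

import Mathlib

set_option linter.unusedSectionVars false
set_option linter.unusedSimpArgs false

universe u v

section Defs
open scoped TensorProduct
open TensorProduct Coalgebra

/-- Induction on tensors without the redundant case of zero. -/
@[elab_as_elim]
theorem tensor_induction {R M N : Type*} [CommSemiring R] [AddCommMonoid M] [AddCommMonoid N]
    [Module R M] [Module R N] {P : M ⊗[R] N → Prop} (tmul : ∀ x y, P (x ⊗ₜ y))
    (add : ∀ x y, P x → P y → P (x + y)) (X : M ⊗[R] N) : P X :=
  TensorProduct.induction_on X (by simpa using tmul 0 0) tmul add

/-- A weak bialgebra over `k`: an algebra and a coalgebra with multiplicative comultiplication such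
that `Δ²(1) = 1₁ ⊗ 1₁' 1₂ ⊗ 1₂' = 1₁ ⊗ 1₂ 1₁' ⊗ 1₂'` and
`ε(h g l) = ε(h g₁) ε(g₂ l) = ε(h g₂) ε(g₁ l)`. Neither `Δ(1) = 1 ⊗ 1` nor the multiplicativity of
`ε` is required. -/
class WeakBialgebra (k H : Type*) [Field k] [Ring H] [Algebra k H] extends Coalgebra k H where
  comul_mul : ∀ g h : H, comul (g * h) = comul g * comul h
  comul_comul_one : comul.lTensor H (comul 1) =
    ((1 : H) ⊗ₜ[k] comul (1 : H)) * TensorProduct.assoc k H H H (comul (1 : H) ⊗ₜ[k] (1 : H))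
  comul_comul_one' : comul.lTensor H (comul 1) =
    TensorProduct.assoc k H H H (comul (1 : H) ⊗ₜ[k] (1 : H)) * ((1 : H) ⊗ₜ[k] comul (1 : H))
  counit_mul_mul : ∀ h g l : H, counit (h * g * l) =
    LinearMap.mul' k k (TensorProduct.map counit counit ((h ⊗ₜ[k] 1) * comul g * (1 ⊗ₜ[k] l)))
  counit_mul_mul' : ∀ h g l : H, counit (h * g * l) =
    LinearMap.mul' k k (TensorProduct.map counit counit ((1 ⊗ₜ[k] h) * comul g * (l ⊗ₜ[k] 1)))

section QG
variable (k : Type*) {H : Type*} [Field k] [Ring H] [Algebra k H]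

/-- The target map `ε_t(h) = ε(1₁ h) 1₂`. -/
noncomputable def targetMap [WeakBialgebra k H] : H →ₗ[k] H :=
  TensorProduct.lid k H ∘ₗ (counit (R := k) (A := H)).rTensor H ∘ₗ
    LinearMap.mulLeft k (comul (R := k) (1 : H)) ∘ₗ (TensorProduct.mk k H H).flip 1

/-- The source map `ε_s(h) = 1₁ ε(h 1₂)`. -/
noncomputable def sourceMap [WeakBialgebra k H] : H →ₗ[k] H :=
  TensorProduct.rid k H ∘ₗ (counit (R := k) (A := H)).lTensor H ∘ₗ
    LinearMap.mulRight k (comul (R := k) (1 : H)) ∘ₗ TensorProduct.mk k H H 1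

/-- The convolution product `(f * g)(h) = f(h₁) g(h₂)`. -/
noncomputable def convolution [Coalgebra k H] (f g : H →ₗ[k] H) : H →ₗ[k] H :=
  LinearMap.mul' k H ∘ₗ TensorProduct.map f g ∘ₗ comul
end QG

/-- A quantum groupoid (weak Hopf algebra) with bijective antipode `S`:
`S * id = ε_s`, `id * S = ε_t`, `S * id * S = S` for the convolution product. -/
class QuantumGroupoid (k H : Type*) [Field k] [Ring H] [Algebra k H] extends
    WeakBialgebra k H where
  antipode : H →ₗ[k] H
  antipode_conv_id : convolution k antipode LinearMap.id = sourceMap k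
  id_conv_antipode : convolution k LinearMap.id antipode = targetMap k
  antipode_conv_id_conv_antipode :
    convolution k (convolution k antipode LinearMap.id) antipode = antipode
  antipode_bijective : Function.Bijective antipode

namespace WeakBialgebra
variable {k H : Type*} [Field k] [Ring H] [Algebra k H] [WeakBialgebra k H]

theorem comul_one_mul_comul (h : H) :
    comul (R := k) (1 : H) * comul (R := k) h = comul (R := k) h := by
  rw [← comul_mul, one_mul]

theorem comul_mul_comul_one (h : H) :
    comul (R := k) h * comul (R := k) (1 : H) = comul (R := k) h := by
  rw [← comul_mul, mul_one]

theorem counit_mul_targetMap (h g : H) :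
    counit (R := k) (h * targetMap k g) = counit (R := k) (h * g) := by
  have key : ∀ X : H ⊗[k] H, counit (R := k)
      (h * TensorProduct.lid k H ((counit (R := k) (A := H)).rTensor H X)) =
      LinearMap.mul' k k (TensorProduct.map counit counit ((1 ⊗ₜ[k] h) * X)) := by
    intro X
    induction X using tensor_induction with
    | tmul x y => simp
    | add x y hx hy => simp only [LinearMap.map_add, LinearEquiv.map_add, mul_add, hx, hy]
  have := counit_mul_mul' (k := k) h 1 g
  rw [mul_one, mul_assoc, ← key] at this
  exact this.symm

theorem counit_sourceMap_mul (h g : H) :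
    counit (R := k) (sourceMap k h * g) = counit (R := k) (h * g) := by
  have key : ∀ X : H ⊗[k] H, counit (R := k)
      (TensorProduct.rid k H ((counit (R := k) (A := H)).lTensor H X) * g) =
      LinearMap.mul' k k (TensorProduct.map counit counit (X * (g ⊗ₜ[k] 1))) := by
    intro X
    induction X using tensor_induction with
    | tmul x y => simp [mul_comm]
    | add x y hx hy => simp only [LinearMap.map_add, LinearEquiv.map_add, add_mul, hx, hy]
  have := counit_mul_mul' (k := k) h 1 g
  rw [mul_one, ← key] at this
  exact this.symm

/-- `ε_t (h ε_t (g)) = ε_t (h g)`. -/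
theorem targetMap_mul_targetMap (h g : H) :
    targetMap k (h * targetMap k g) = targetMap k (h * g) := by
  have key : ∀ X : H ⊗[k] H,
      TensorProduct.lid k H ((counit (R := k) (A := H)).rTensor H (X * ((h * targetMap k g) ⊗ₜ 1)))
      = TensorProduct.lid k H ((counit (R := k) (A := H)).rTensor H (X * ((h * g) ⊗ₜ 1))) := by
    intro X
    induction X using tensor_induction with
    | tmul x y => simp [← mul_assoc, counit_mul_targetMap]
    | add x y hx hy => simp only [LinearMap.map_add, LinearEquiv.map_add, add_mul, hx, hy]
  exact key _

theorem sourceMap_sourceMap_mul (h g : H) :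
    sourceMap k (sourceMap k h * g) = sourceMap k (h * g) := by
  have key : ∀ X : H ⊗[k] H,
      TensorProduct.rid k H ((counit (R := k) (A := H)).lTensor H ((1 ⊗ₜ (sourceMap k h * g)) * X))
      = TensorProduct.rid k H ((counit (R := k) (A := H)).lTensor H ((1 ⊗ₜ (h * g)) * X)) := by
    intro X
    induction X using tensor_induction with
    | tmul x y => simp [mul_assoc, counit_sourceMap_mul]
    | add x y hx hy => simp only [LinearMap.map_add, LinearEquiv.map_add, mul_add, hx, hy]
  exact key _

@[simp] theorem targetMap_targetMap (h : H) : targetMap k (targetMap k h) = targetMap k h := by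
  simpa using targetMap_mul_targetMap (k := k) 1 h

@[simp] theorem sourceMap_sourceMap (h : H) : sourceMap k (sourceMap k h) = sourceMap k h := by
  simpa using sourceMap_sourceMap_mul (k := k) h 1

theorem comul_lid_counit (h : H) (X : H ⊗[k] H) : comul (R := k)
      (TensorProduct.lid k H ((counit (R := k) (A := H)).rTensor H (X * (h ⊗ₜ 1)))) =
      TensorProduct.lid k _ ((counit (R := k) (A := H)).rTensor (H ⊗[k] H)
      (comul.lTensor H X * (h ⊗ₜ (1 : H ⊗[k] H)))) := by
  induction X using tensor_induction with
  | tmul x y => simp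
  | add x y hx hy => simp only [LinearMap.map_add, LinearEquiv.map_add, add_mul, hx, hy]

/-- `Δ(z) = z 1₁ ⊗ 1₂` for `z` in the target space. -/
theorem comul_targetMap (h : H) :
    comul (R := k) (targetMap k h) = (targetMap k h ⊗ₜ 1) * comul (R := k) (1 : H) := by
  have e2 : ∀ X Y : H ⊗[k] H,
      TensorProduct.lid k _ ((counit (R := k) (A := H)).rTensor (H ⊗[k] H)
        (TensorProduct.assoc k H H H (X ⊗ₜ[k] (1 : H)) * ((1 : H) ⊗ₜ[k] Y) *
          (h ⊗ₜ (1 : H ⊗[k] H)))) =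
      (TensorProduct.lid k H ((counit (R := k) (A := H)).rTensor H (X * (h ⊗ₜ 1))) ⊗ₜ 1) * Y := by
    intro X Y
    induction X using tensor_induction with
    | tmul x y => simp [← TensorProduct.smul_tmul']
    | add x y hx hy => simp only [LinearMap.map_add, LinearEquiv.map_add, add_mul, hx, hy, add_tmul]
  refine (comul_lid_counit h _).trans ?_
  rw [comul_comul_one', e2]
  rfl

theorem comul_targetMap' (h : H) :
    comul (R := k) (targetMap k h) = comul (R := k) (1 : H) * (targetMap k h ⊗ₜ 1) := by
  have e2 : ∀ X Y : H ⊗[k] H,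
      TensorProduct.lid k _ ((counit (R := k) (A := H)).rTensor (H ⊗[k] H)
        (((1 : H) ⊗ₜ[k] Y) * TensorProduct.assoc k H H H (X ⊗ₜ[k] (1 : H)) *
          (h ⊗ₜ (1 : H ⊗[k] H)))) =
      Y * (TensorProduct.lid k H ((counit (R := k) (A := H)).rTensor H (X * (h ⊗ₜ 1))) ⊗ₜ 1) := by
    intro X Y
    induction X using tensor_induction with
    | tmul x y => simp [← TensorProduct.smul_tmul']
    | add x y hx hy => simp only [LinearMap.map_add, LinearEquiv.map_add, add_mul, mul_add, hx, hy, add_tmul]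
  refine (comul_lid_counit h _).trans ?_
  rw [comul_comul_one, e2]
  rfl

theorem assoc_rTensor_comul_counit (h : H) (X : H ⊗[k] H) : TensorProduct.assoc k H H k ((comul (R := k)).rTensor k
      ((counit (R := k) (A := H)).lTensor H ((1 ⊗ₜ h) * X))) =
      ((counit (R := k) (A := H)).lTensor H).lTensor H ((1 ⊗ₜ (1 ⊗ₜ h)) *
        TensorProduct.assoc k H H H (comul.rTensor H X)) := by
  induction X using tensor_induction with
  | tmul x y =>
    simp only [Algebra.TensorProduct.tmul_mul_tmul, one_mul, LinearMap.lTensor_tmul,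
      LinearMap.rTensor_tmul]
    generalize comul (R := k) x = Z
    induction Z using tensor_induction with
    | tmul x y => simp
    | add x y hx hy => simp only [LinearMap.map_add, LinearEquiv.map_add, mul_add, hx, hy, add_tmul]
  | add x y hx hy => simp only [LinearMap.map_add, LinearEquiv.map_add, mul_add, hx, hy]

theorem comul_rid (X : H ⊗[k] k) : comul (R := k) (TensorProduct.rid k H X) =
      (TensorProduct.rid k H).toLinearMap.lTensor H (TensorProduct.assoc k H H k
       ((comul (R := k)).rTensor k X)) := by
  induction X using tensor_induction with
  | tmul x y =>
    simp only [TensorProduct.rid_tmul, map_smul, LinearMap.rTensor_tmul]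
    generalize comul (R := k) x = Z
    induction Z using tensor_induction with
    | tmul x y => simp
    | add x y hx hy => simp only [LinearMap.map_add, LinearEquiv.map_add, smul_add, hx, hy, add_tmul]
  | add x y hx hy => simp only [LinearMap.map_add, LinearEquiv.map_add, hx, hy]

theorem comul_sourceMap (h : H) :
    comul (R := k) (sourceMap k h) = comul (R := k) (1 : H) * (1 ⊗ₜ sourceMap k h) := by
  have e2 : ∀ X Y : H ⊗[k] H,
      (TensorProduct.rid k H).toLinearMap.lTensor H (
      ((counit (R := k) (A := H)).lTensor H).lTensor H ((1 ⊗ₜ (1 ⊗ₜ h)) *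
        (TensorProduct.assoc k H H H (X ⊗ₜ[k] (1 : H)) * ((1 : H) ⊗ₜ[k] Y)))) =
      X * (1 ⊗ₜ TensorProduct.rid k H ((counit (R := k) (A := H)).lTensor H ((1 ⊗ₜ h) * Y))) := by
    intro X Y
    induction X using tensor_induction with
    | tmul x y =>
      induction Y using tensor_induction with
      | tmul x y => simp
      | add x y hx hy => simp only [LinearMap.map_add, LinearEquiv.map_add, mul_add, hx, hy, tmul_add]
    | add x y hx hy => simp only [LinearMap.map_add, LinearEquiv.map_add, add_mul, mul_add, hx, hy, add_tmul]
  refine (comul_rid _).trans ?_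
  rw [LinearMap.comp_apply, LinearMap.comp_apply, TensorProduct.mk_apply, LinearMap.mulRight_apply,
    assoc_rTensor_comul_counit, coassoc_apply, comul_comul_one', e2]
  rfl

theorem comul_sourceMap' (h : H) :
    comul (R := k) (sourceMap k h) = (1 ⊗ₜ sourceMap k h) * comul (R := k) (1 : H) := by
  have e2 : ∀ X Y : H ⊗[k] H,
      (TensorProduct.rid k H).toLinearMap.lTensor H (
      ((counit (R := k) (A := H)).lTensor H).lTensor H ((1 ⊗ₜ (1 ⊗ₜ h)) *
        (((1 : H) ⊗ₜ[k] Y) * TensorProduct.assoc k H H H (X ⊗ₜ[k] (1 : H))))) =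
      (1 ⊗ₜ TensorProduct.rid k H ((counit (R := k) (A := H)).lTensor H ((1 ⊗ₜ h) * Y))) * X := by
    intro X Y
    induction X using tensor_induction with
    | tmul x y =>
      induction Y using tensor_induction with
      | tmul x y => simp
      | add x y hx hy => simp only [LinearMap.map_add, LinearEquiv.map_add, mul_add, add_mul, hx, hy, tmul_add]
    | add x y hx hy => simp only [LinearMap.map_add, LinearEquiv.map_add, mul_add, hx, hy, add_tmul]
  refine (comul_rid _).trans ?_
  rw [LinearMap.comp_apply, LinearMap.comp_apply, TensorProduct.mk_apply, LinearMap.mulRight_apply,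
    assoc_rTensor_comul_counit, coassoc_apply, comul_comul_one, e2]
  rfl

/-- Elements of the source space commute with elements of the target space. -/
theorem sourceMap_mul_targetMap (g h : H) :
    sourceMap k g * targetMap k h = targetMap k h * sourceMap k g := by
  have hh := (comul_comul_one (k := k) (H := H)).symm.trans comul_comul_one'
  let P : H ⊗[k] (H ⊗[k] H) →ₗ[k] H :=
    (TensorProduct.lid k H).toLinearMap ∘ₗ TensorProduct.map (counit (R := k) ∘ₗ LinearMap.mulRight k h)
      ((TensorProduct.rid k H).toLinearMap ∘ₗ
        TensorProduct.map LinearMap.id (counit (R := k) ∘ₗ LinearMap.mulLeft k g))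
  have e1 : ∀ X Y : H ⊗[k] H,
      P (((1 : H) ⊗ₜ[k] Y) * TensorProduct.assoc k H H H (X ⊗ₜ[k] (1 : H))) =
      TensorProduct.rid k H ((counit (R := k) (A := H)).lTensor H ((1 ⊗ₜ g) * Y)) *
      TensorProduct.lid k H ((counit (R := k) (A := H)).rTensor H (X * (h ⊗ₜ 1))) := by
    intro X Y
    induction X using tensor_induction with
    | tmul x y =>
      induction Y using tensor_induction with
      | tmul x y => simp [P, smul_smul, mul_comm]
      | add x y hx hy => simp only [LinearMap.map_add, LinearEquiv.map_add, add_mul, mul_add, hx, hy, tmul_add]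
    | add x y hx hy => simp only [LinearMap.map_add, LinearEquiv.map_add, add_mul, mul_add, hx, hy, add_tmul]
  have e2 : ∀ X Y : H ⊗[k] H,
      P (TensorProduct.assoc k H H H (X ⊗ₜ[k] (1 : H)) * ((1 : H) ⊗ₜ[k] Y)) =
      TensorProduct.lid k H ((counit (R := k) (A := H)).rTensor H (X * (h ⊗ₜ 1))) *
      TensorProduct.rid k H ((counit (R := k) (A := H)).lTensor H ((1 ⊗ₜ g) * Y)) := by
    intro X Y
    induction X using tensor_induction with
    | tmul x y =>
      induction Y using tensor_induction with
      | tmul x y => simp [P, smul_smul, mul_comm]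
      | add x y hx hy => simp only [LinearMap.map_add, LinearEquiv.map_add, add_mul, mul_add, hx, hy, tmul_add]
    | add x y hx hy => simp only [LinearMap.map_add, LinearEquiv.map_add, add_mul, mul_add, hx, hy, add_tmul]
  have := congrArg P hh
  rw [e1, e2] at this
  exact this

/-- `ε_s (h₁) ⊗ h₂ = 1₁ ⊗ h 1₂`. -/
theorem sourceMap_rTensor_comul (h : H) :
    (sourceMap k).rTensor H (comul (R := k) h) = (1 ⊗ₜ h) * comul (R := k) (1 : H) := by
  have e1 : ∀ X : H ⊗[k] H, X = ((TensorProduct.lid k H).toLinearMap ∘ₗ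
      (counit (R := k) (A := H)).rTensor H).lTensor H (comul.lTensor H X) := by
    intro X
    induction X using tensor_induction with
    | tmul x y => simp
    | add x y hx hy => simp only [LinearMap.map_add, LinearEquiv.map_add, ← hx, ← hy]
  have e2 : ∀ X : H ⊗[k] H, comul.lTensor H ((1 ⊗ₜ h) * X) =
      (1 ⊗ₜ comul (R := k) h) * comul.lTensor H X := by
    intro X
    induction X using tensor_induction with
    | tmul x y => simp [comul_mul]
    | add x y hx hy => simp only [LinearMap.map_add, LinearEquiv.map_add, mul_add, hx, hy]
  have e3 : ∀ X Z : H ⊗[k] H, ((TensorProduct.lid k H).toLinearMap ∘ₗ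
      (counit (R := k) (A := H)).rTensor H).lTensor H
      ((1 ⊗ₜ Z) * TensorProduct.assoc k H H H (X ⊗ₜ[k] (1 : H))) =
      ((TensorProduct.rid k H).toLinearMap ∘ₗ (counit (R := k) (A := H)).lTensor H ∘ₗ
        LinearMap.mulRight k X ∘ₗ TensorProduct.mk k H H 1).rTensor H Z := by
    intro X Z
    induction Z using tensor_induction with
    | tmul a b =>
      induction X using tensor_induction with
      | tmul x y => simp [TensorProduct.smul_tmul]
      | add x y hx hy =>
        simp only [map_add, mul_add, add_mul, hx, hy, add_tmul]
        simp [mul_add, add_tmul]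
    | add x y hx hy => simp only [LinearMap.map_add, LinearEquiv.map_add, add_mul, mul_add, hx, hy, tmul_add]
  rw [e1 ((1 ⊗ₜ h) * comul (R := k) (1 : H)), e2, comul_comul_one, ← mul_assoc,
    Algebra.TensorProduct.tmul_mul_tmul, one_mul, comul_mul_comul_one, e3]
  rfl

end WeakBialgebra

namespace QuantumGroupoid
open WeakBialgebra WithConv
variable {k H : Type*} [Field k] [Ring H] [Algebra k H] [QuantumGroupoid k H]

theorem targetMap_apply (h : H) : targetMap k h =
    LinearMap.mul' k H (TensorProduct.map LinearMap.id (antipode (k := k)) (comul (R := k) h)) := by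
  rw [← id_conv_antipode]; rfl

theorem sourceMap_apply (h : H) : sourceMap k h =
    LinearMap.mul' k H (TensorProduct.map (antipode (k := k)) LinearMap.id (comul (R := k) h)) := by
  rw [← antipode_conv_id]; rfl

theorem convolution_assoc (f g h : H →ₗ[k] H) :
    convolution k (convolution k f g) h = convolution k f (convolution k g h) :=
  congrArg ofConv (mul_assoc (toConv f) (toConv g) (toConv h))

theorem convolution_source_antipode :
    convolution k (sourceMap k) (antipode (k := k) (H := H)) = antipode := by
  rw [← antipode_conv_id]; exact antipode_conv_id_conv_antipode

theorem convolution_antipode_target :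
    convolution k (antipode (k := k) (H := H)) (targetMap k) = antipode := by
  rw [← id_conv_antipode, ← convolution_assoc]; exact antipode_conv_id_conv_antipode

/-- `ε_t (g z) = g₁ z S(g₂)` for `z` in the target space. -/
theorem targetMap_mul_target (g h : H) : targetMap k (g * targetMap k h) =
    LinearMap.mul' k H (TensorProduct.map (LinearMap.mulRight k (targetMap k h))
      (antipode (k := k)) (comul (R := k) g)) := by
  rw [targetMap_apply (g * _), comul_mul, comul_targetMap', ← mul_assoc, comul_mul_comul_one]
  generalize comul (R := k) g = X
  induction X using tensor_induction with
  | tmul x y => simp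
  | add x y hx hy => simp only [LinearMap.map_add, LinearEquiv.map_add, add_mul, hx, hy]

theorem sourceMap_source_mul (g h : H) : sourceMap k (sourceMap k g * h) =
    LinearMap.mul' k H (TensorProduct.map (antipode (k := k))
      (LinearMap.mulLeft k (sourceMap k g)) (comul (R := k) h)) := by
  rw [sourceMap_apply (_ * h), comul_mul, comul_sourceMap', mul_assoc, comul_one_mul_comul]
  generalize comul (R := k) h = X
  induction X using tensor_induction with
  | tmul x y => simp
  | add x y hx hy => simp only [LinearMap.map_add, LinearEquiv.map_add, mul_add, hx, hy]

/-- `ε_t (z g) = z ε_t (g)` for `z` in the target space. -/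
theorem targetMap_target_mul (h g : H) :
    targetMap k (targetMap k h * g) = targetMap k h * targetMap k g := by
  rw [targetMap_apply (_ * g), comul_mul, comul_targetMap, mul_assoc, comul_one_mul_comul,
    targetMap_apply g]
  generalize comul (R := k) g = X
  induction X using tensor_induction with
  | tmul x y => simp [mul_assoc]
  | add x y hx hy => simp only [LinearMap.map_add, LinearEquiv.map_add, mul_add, hx, hy]

/-- `ε_s (g y) = ε_s (g) y` for `y` in the source space. -/
theorem sourceMap_mul_source (g h : H) :
    sourceMap k (g * sourceMap k h) = sourceMap k g * sourceMap k h := by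
  rw [sourceMap_apply (g * _), comul_mul, comul_sourceMap, ← mul_assoc, comul_mul_comul_one,
    sourceMap_apply g]
  generalize comul (R := k) g = X
  induction X using tensor_induction with
  | tmul x y => simp [mul_assoc]
  | add x y hx hy => simp only [LinearMap.map_add, LinearEquiv.map_add, add_mul, hx, hy]

end QuantumGroupoid

namespace QuantumGroupoid
open WeakBialgebra WithConv
variable {k H : Type*} [Field k] [Ring H] [Algebra k H] [QuantumGroupoid k H]

theorem source_conv_antipode_aux (g h : H) :
    LinearMap.mul' k H (TensorProduct.map (sourceMap k ∘ₗ LinearMap.mulLeft k g)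
      (antipode (k := k)) (comul (R := k) h)) = antipode (k := k) h * sourceMap k g := by
  have e1 : sourceMap k ∘ₗ LinearMap.mulLeft k g =
      convolution k (antipode (k := k)) (LinearMap.mulLeft k (sourceMap k g)) := by
    ext x
    exact (sourceMap_sourceMap_mul g x).symm.trans (sourceMap_source_mul g x)
  have e2 : convolution k (LinearMap.mulLeft k (sourceMap k g)) (antipode (k := k)) =
      LinearMap.mulLeft k (sourceMap k g) ∘ₗ targetMap k := by
    ext x
    simp only [convolution, LinearMap.comp_apply, targetMap_apply x]
    generalize comul (R := k) x = X
    induction X using tensor_induction with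
    | tmul x y => simp [mul_assoc]
    | add x y hx hy => simp only [LinearMap.map_add, LinearEquiv.map_add, hx, hy]
  rw [e1]
  change convolution k (convolution k _ _) _ h = _
  rw [convolution_assoc, e2]
  conv_rhs => rw [← convolution_antipode_target]
  simp only [convolution, LinearMap.comp_apply]
  generalize comul (R := k) h = X
  induction X using tensor_induction with
  | tmul x y => simp [mul_assoc, sourceMap_mul_targetMap]
  | add x y hx hy => simp only [LinearMap.map_add, LinearEquiv.map_add, add_mul, hx, hy]

theorem antipode_mul (g h : H) :
    antipode (k := k) (g * h) = antipode (k := k) h * antipode (k := k) g := by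
  let S : H →ₗ[k] H := antipode
  let M : H ⊗[k] H →ₗ[k] H := LinearMap.mul' k H
  let G : H ⊗[k] H →ₗ[k] H :=
    LinearMap.mul' k H ∘ₗ TensorProduct.map S S ∘ₗ (TensorProduct.comm k H H).toLinearMap
  have hM : ∀ f g : H →ₗ[k] H, toConv (f ∘ₗ M) * toConv (g ∘ₗ M) =
      toConv (convolution k f g ∘ₗ M) := by
    intro f g
    have key : ∀ X Y : H ⊗[k] H, TensorProduct.map (f ∘ₗ M) (g ∘ₗ M)
        (TensorProduct.AlgebraTensorModule.tensorTensorTensorComm k k k k H H H H (X ⊗ₜ[k] Y)) =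
        TensorProduct.map f g (X * Y) := by
      intro X Y
      induction X using tensor_induction with
      | tmul x y =>
        induction Y using tensor_induction with
        | tmul x y => simp [M]
        | add x y hx hy => simp only [LinearMap.map_add, LinearEquiv.map_add, mul_add, hx, hy, tmul_add]
      | add x y hx hy => simp only [LinearMap.map_add, LinearEquiv.map_add, add_mul, hx, hy, add_tmul]
    apply WithConv.ofConv_injective
    ext a b
    have := congrArg (LinearMap.mul' k H) (key (comul (R := k) a) (comul (R := k) b))
    simpa [LinearMap.convMul_def, convolution, M, comul_mul, TensorProduct.comul_def] using this
  have hMG : toConv M * toConv G = toConv (targetMap k ∘ₗ M) := by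
    have key : ∀ X Y : H ⊗[k] H, LinearMap.mul' k H (TensorProduct.map M G
        (TensorProduct.AlgebraTensorModule.tensorTensorTensorComm k k k k H H H H (X ⊗ₜ[k] Y))) =
        LinearMap.mul' k H (TensorProduct.map (LinearMap.mulRight k
          (LinearMap.mul' k H (TensorProduct.map LinearMap.id S Y))) S X) := by
      intro X Y
      induction X using tensor_induction with
      | tmul x y =>
        induction Y using tensor_induction with
        | tmul x y => simp [M, G, mul_assoc]
        | add x y hx hy =>
          simp only [map_add, mul_add, add_mul, hx, hy, tmul_add]
          simp [mul_add, add_mul]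
      | add x y hx hy => simp only [LinearMap.map_add, LinearEquiv.map_add, hx, hy, add_tmul]
    apply WithConv.ofConv_injective
    ext a b
    have := key (comul (R := k) a) (comul (R := k) b)
    rw [← targetMap_apply b, ← targetMap_mul_target, targetMap_mul_targetMap] at this
    simpa [LinearMap.convMul_def, M, TensorProduct.comul_def] using this
  have hG : toConv (sourceMap k ∘ₗ M) * toConv G = toConv G := by
    have key0 : ∀ (x y : H) (Y : H ⊗[k] H), LinearMap.mul' k H
        (TensorProduct.map (sourceMap k ∘ₗ M) G
        (TensorProduct.AlgebraTensorModule.tensorTensorTensorComm k k k k H H H H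
          ((x ⊗ₜ[k] y) ⊗ₜ[k] Y))) =
        LinearMap.mul' k H (TensorProduct.map (sourceMap k ∘ₗ LinearMap.mulLeft k x) S Y) *
          S y := by
      intro x y Y
      induction Y using tensor_induction with
      | tmul x y => simp [M, G, mul_assoc]
      | add x y hx hy => simp only [LinearMap.map_add, LinearEquiv.map_add, add_mul, hx, hy, tmul_add]
    have key : ∀ (X : H ⊗[k] H) (b : H), LinearMap.mul' k H (TensorProduct.map (sourceMap k ∘ₗ M) G
        (TensorProduct.AlgebraTensorModule.tensorTensorTensorComm k k k k H H H H
          (X ⊗ₜ[k] comul (R := k) b))) =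
        S b * LinearMap.mul' k H (TensorProduct.map (sourceMap k) S X) := by
      intro X b
      induction X using tensor_induction with
      | tmul x y =>
        rw [key0, source_conv_antipode_aux]
        simp [S, mul_assoc]
      | add x y hx hy => simp only [LinearMap.map_add, LinearEquiv.map_add, mul_add, hx, hy, add_tmul]
    apply WithConv.ofConv_injective
    ext a b
    have e := DFunLike.congr_fun (convolution_source_antipode (k := k) (H := H)) a
    simp only [convolution, LinearMap.comp_apply] at e
    have := key (comul (R := k) a) b
    rw [show S = antipode from rfl, e] at this
    simpa [LinearMap.convMul_def, G, S, TensorProduct.comul_def] using this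
  have h1 : toConv (S ∘ₗ M) = toConv G := by
    have a1 := hM S (convolution k LinearMap.id S)
    have a2 := hM LinearMap.id S
    have a3 := hM S LinearMap.id
    rw [← convolution_assoc, antipode_conv_id_conv_antipode, ← a2] at a1
    have a4 : toConv (LinearMap.id ∘ₗ M) * toConv (S ∘ₗ M) = toConv M * toConv G := by
      rw [a2, id_conv_antipode, hMG]
    rw [a4, ← mul_assoc] at a1
    have a5 : toConv (S ∘ₗ M) * toConv M = toConv (sourceMap k ∘ₗ M) := by
      rw [← antipode_conv_id]; exact a3
    rw [a5, hG] at a1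
    exact a1.symm
  have := DFunLike.congr_fun (WithConv.toConv_injective h1) (g ⊗ₜ[k] h)
  simpa [M, G] using this

theorem sourceMap_antipode (h : H) :
    sourceMap k (antipode (k := k) h) = sourceMap k (targetMap k h) := by
  have e := DFunLike.congr_fun (convolution_source_antipode (k := k) (H := H)) h
  rw [← e, targetMap_apply]
  simp only [convolution, LinearMap.comp_apply]
  generalize comul (R := k) h = X
  induction X using tensor_induction with
  | tmul x y => simp [sourceMap_sourceMap_mul]
  | add x y hx hy => simp only [LinearMap.map_add, LinearEquiv.map_add, hx, hy]

theorem sourceMap_one : sourceMap k (1 : H) = 1 := by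
  have : sourceMap k (1 : H) = TensorProduct.rid k H ((counit (R := k) (A := H)).lTensor H
      ((1 ⊗ₜ 1) * comul (R := k) (1 : H))) := rfl
  rw [this, ← Algebra.TensorProduct.one_def, one_mul]
  simp

theorem targetMap_one : targetMap k (1 : H) = 1 := by
  have : targetMap k (1 : H) = TensorProduct.lid k H ((counit (R := k) (A := H)).rTensor H
      (comul (R := k) (1 : H) * (1 ⊗ₜ 1))) := rfl
  rw [this, ← Algebra.TensorProduct.one_def, mul_one]
  simp

theorem comul_one_source : (sourceMap k).rTensor H (comul (R := k) (1 : H)) = comul (1 : H) := by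
  rw [sourceMap_rTensor_comul, ← Algebra.TensorProduct.one_def, one_mul]

/-- On the target space the antipode agrees with `ε_s`. -/
theorem antipode_targetMap (h : H) :
    antipode (k := k) (targetMap k h) = sourceMap k (targetMap k h) := by
  have e := DFunLike.congr_fun (convolution_source_antipode (k := k) (H := H)) (targetMap k h)
  rw [← e]
  have t := targetMap_apply (k := k) (1 : H)
  rw [targetMap_one, ← comul_one_source] at t
  conv_rhs => rw [← mul_one (sourceMap k _), t]
  simp only [convolution, LinearMap.comp_apply]
  rw [comul_targetMap, ← comul_one_source]
  generalize comul (R := k) (1 : H) = X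
  induction X using tensor_induction with
  | tmul x y => simp [sourceMap_mul_source, mul_assoc]
  | add x y hx hy => simp only [LinearMap.map_add, LinearEquiv.map_add, mul_add, hx, hy]

/-- `S(z) h₁ ⊗ h₂ = h₁ ⊗ z h₂` for `z` in the target space. -/
theorem antipode_target_mul_comul (z h : H) :
    (antipode (k := k) (targetMap k z) ⊗ₜ 1) * comul (R := k) h =
      (1 ⊗ₜ targetMap k z) * comul (R := k) h := by
  rw [← comul_one_mul_comul h, ← mul_assoc, ← mul_assoc, ← sourceMap_rTensor_comul,
    comul_targetMap]
  congr 1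
  rw [antipode_targetMap, ← comul_one_source]
  generalize comul (R := k) (1 : H) = X
  induction X using tensor_induction with
  | tmul x y => simp [sourceMap_mul_source]
  | add x y hx hy => simp only [LinearMap.map_add, LinearEquiv.map_add, mul_add, hx, hy]

theorem exists_target_of_source (y : H) :
    ∃ w : H, sourceMap k y = antipode (k := k) (targetMap k w) := by
  obtain ⟨w, hw⟩ := (antipode_bijective (k := k) (H := H)).2 y
  exact ⟨w, by rw [antipode_targetMap, ← sourceMap_antipode, hw]⟩

end QuantumGroupoid

namespace WeakBialgebra
variable {k H : Type*} [Field k] [Ring H] [Algebra k H] [WeakBialgebra k H]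
/-- `h₁ ⊗ ε_t (h₂) = 1₁ h ⊗ 1₂`. -/
theorem targetMap_lTensor_comul (h : H) :
    (targetMap k).lTensor H (comul (R := k) h) = comul (R := k) (1 : H) * (h ⊗ₜ 1) := by
  have e1 : ∀ X : H ⊗[k] H, X = ((TensorProduct.lid k H).toLinearMap ∘ₗ
      (counit (R := k) (A := H)).rTensor H).lTensor H
        (TensorProduct.assoc k H H H (comul.rTensor H X)) := by
    intro X
    induction X using tensor_induction with
    | tmul x y =>
      have e : ∀ Z : H ⊗[k] H, ((TensorProduct.lid k H).toLinearMap ∘ₗ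
          (counit (R := k) (A := H)).rTensor H).lTensor H
            (TensorProduct.assoc k H H H (Z ⊗ₜ[k] y)) =
          TensorProduct.rid k H ((counit (R := k) (A := H)).lTensor H Z) ⊗ₜ[k] y := by
        intro Z
        induction Z using tensor_induction with
        | tmul x y => simp [TensorProduct.smul_tmul]
        | add x y hx hy => simp only [LinearMap.map_add, LinearEquiv.map_add, add_tmul, hx, hy]
      rw [LinearMap.rTensor_tmul, e, lTensor_counit_comul]
      simp
    | add x y hx hy => simp only [LinearMap.map_add, LinearEquiv.map_add, ← hx, ← hy]
  have e2 : ∀ X : H ⊗[k] H, comul.rTensor H (X * (h ⊗ₜ 1)) =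
      comul.rTensor H X * (comul (R := k) h ⊗ₜ 1) := by
    intro X
    induction X using tensor_induction with
    | tmul x y => simp [comul_mul]
    | add x y hx hy => simp only [LinearMap.map_add, LinearEquiv.map_add, add_mul, hx, hy]
  have e3 : ∀ X Z : H ⊗[k] H, ((TensorProduct.lid k H).toLinearMap ∘ₗ
      (counit (R := k) (A := H)).rTensor H).lTensor H
      ((1 ⊗ₜ X) * TensorProduct.assoc k H H H (Z ⊗ₜ[k] (1 : H))) =
      ((TensorProduct.lid k H).toLinearMap ∘ₗ (counit (R := k) (A := H)).rTensor H ∘ₗ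
        LinearMap.mulLeft k X ∘ₗ (TensorProduct.mk k H H).flip 1).lTensor H Z := by
    intro X Z
    induction Z using tensor_induction with
    | tmul a b =>
      induction X using tensor_induction with
      | tmul x y => simp
      | add x y hx hy =>
        simp only [map_add, add_mul, hx, hy, tmul_add]
        simp [add_mul, tmul_add]
    | add x y hx hy => simp only [LinearMap.map_add, LinearEquiv.map_add, mul_add, hx, hy, add_tmul]
  have e4 : ∀ X Y : (H ⊗[k] H) ⊗[k] H, TensorProduct.assoc k H H H (X * Y) =
      TensorProduct.assoc k H H H X * TensorProduct.assoc k H H H Y :=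
    map_mul (Algebra.TensorProduct.assoc k k k H H H)
  rw [e1 (comul (R := k) (1 : H) * (h ⊗ₜ 1)), e2, e4, coassoc_apply, comul_comul_one, mul_assoc,
    ← e4, Algebra.TensorProduct.tmul_mul_tmul, one_mul, comul_one_mul_comul, e3]
  rfl
end WeakBialgebra

namespace QuantumGroupoid
open WeakBialgebra WithConv
variable {k H : Type*} [Field k] [Ring H] [Algebra k H] [QuantumGroupoid k H]

theorem antipode_conv_target_aux (z h : H) :
    LinearMap.mul' k H (TensorProduct.map (antipode (k := k))
      (targetMap k ∘ₗ LinearMap.mulRight k (targetMap k z)) (comul (R := k) h)) =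
      targetMap k z * antipode (k := k) h := by
  have e1 : targetMap k ∘ₗ LinearMap.mulRight k (targetMap k z) =
      convolution k (LinearMap.mulRight k (targetMap k z)) (antipode (k := k)) := by
    ext x
    exact targetMap_mul_target x z
  have e2 : convolution k (antipode (k := k)) (LinearMap.mulRight k (targetMap k z)) =
      LinearMap.mulRight k (targetMap k z) ∘ₗ sourceMap k := by
    ext x
    simp only [convolution, LinearMap.comp_apply, sourceMap_apply x]
    generalize comul (R := k) x = X
    induction X using tensor_induction with
    | tmul x y => simp [mul_assoc]
    | add x y hx hy => simp only [LinearMap.map_add, LinearEquiv.map_add, hx, hy]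
  rw [e1]
  change convolution k _ (convolution k _ _) h = _
  rw [← convolution_assoc, e2]
  conv_rhs => rw [← convolution_source_antipode]
  simp only [convolution, LinearMap.comp_apply]
  generalize comul (R := k) h = X
  induction X using tensor_induction with
  | tmul x y => simp [← mul_assoc, sourceMap_mul_targetMap]
  | add x y hx hy => simp only [LinearMap.map_add, LinearEquiv.map_add, mul_add, hx, hy]

theorem targetMap_antipode (h : H) :
    targetMap k (antipode (k := k) h) = targetMap k (sourceMap k h) := by
  have e := DFunLike.congr_fun (convolution_antipode_target (k := k) (H := H)) h
  rw [← e, sourceMap_apply]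
  simp only [convolution, LinearMap.comp_apply]
  generalize comul (R := k) h = X
  induction X using tensor_induction with
  | tmul x y => simp [targetMap_mul_targetMap]
  | add x y hx hy => simp only [LinearMap.map_add, LinearEquiv.map_add, hx, hy]

theorem comul_one_target : (targetMap k).lTensor H (comul (R := k) (1 : H)) = comul (1 : H) := by
  rw [targetMap_lTensor_comul, ← Algebra.TensorProduct.one_def, mul_one]

/-- On the source space the antipode agrees with `ε_t`. -/
theorem antipode_sourceMap (h : H) :
    antipode (k := k) (sourceMap k h) = targetMap k (sourceMap k h) := by
  have e := DFunLike.congr_fun (convolution_antipode_target (k := k) (H := H)) (sourceMap k h)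
  rw [← e]
  have t := sourceMap_apply (k := k) (1 : H)
  rw [sourceMap_one, ← comul_one_target] at t
  conv_rhs => rw [← one_mul (targetMap k _), t]
  simp only [convolution, LinearMap.comp_apply]
  rw [comul_sourceMap, ← comul_one_target]
  generalize comul (R := k) (1 : H) = X
  induction X using tensor_induction with
  | tmul x y => simp [targetMap_target_mul, mul_assoc]
  | add x y hx hy => simp only [LinearMap.map_add, LinearEquiv.map_add, add_mul, hx, hy]

/-- `1₁ y ⊗ 1₂ = 1₁ ⊗ 1₂ S(y)` for `y` in the source space. -/
theorem comul_one_mul_source (y : H) :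
    comul (R := k) (1 : H) * (sourceMap k y ⊗ₜ 1) =
      comul (R := k) (1 : H) * (1 ⊗ₜ antipode (k := k) (sourceMap k y)) := by
  rw [← targetMap_lTensor_comul, comul_sourceMap, antipode_sourceMap]
  conv_rhs => rw [← comul_one_target]
  conv_lhs => rw [← comul_one_target]
  generalize comul (R := k) (1 : H) = X
  induction X using tensor_induction with
  | tmul x y => simp [targetMap_target_mul]
  | add x y hx hy => simp only [LinearMap.map_add, LinearEquiv.map_add, add_mul, hx, hy]

theorem exists_source_of_target (z : H) :
    ∃ w : H, targetMap k z = antipode (k := k) (sourceMap k w) := by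
  obtain ⟨w, hw⟩ := (antipode_bijective (k := k) (H := H)).2 z
  exact ⟨w, by rw [antipode_sourceMap, ← targetMap_antipode, hw]⟩

theorem antipode_one : antipode (k := k) (1 : H) = 1 := by
  have := antipode_targetMap (k := k) (1 : H)
  rwa [targetMap_one, sourceMap_one] at this

/-- The antipode as a linear equivalence, so that `S⁻¹` is available. -/
noncomputable def antipodeEquiv : H ≃ₗ[k] H :=
  LinearEquiv.ofBijective antipode antipode_bijective

theorem antipodeEquiv_apply (h : H) : antipodeEquiv (k := k) h = antipode (k := k) h := rfl

end QuantumGroupoid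

/-- A quasitriangular quantum groupoid `(H, R)`: `R ∈ Δᵒᵖ(1) (H ⊗ H) Δ(1)` satisfies
`(id ⊗ Δ) R = R₁₃ R₁₂`, `(Δ ⊗ id) R = R₁₃ R₂₃`, `Δᵒᵖ(h) R = R Δ(h)`, and there is
`R⁻¹ ∈ Δ(1) (H ⊗ H) Δᵒᵖ(1)` with `R R⁻¹ = Δᵒᵖ(1)` and `R⁻¹ R = Δ(1)`. These conditions determine
`R⁻¹` uniquely. Here `R₁₃ = R⁽¹⁾ ⊗ (1 ⊗ R⁽²⁾)`, `R₁₂ = R⁽¹⁾ ⊗ (R⁽²⁾ ⊗ 1)`, `R₂₃ = 1 ⊗ R` in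
`H ⊗ (H ⊗ H)`. -/
class QuasitriangularQuantumGroupoid (k H : Type*) [Field k] [Ring H] [Algebra k H] extends
    QuantumGroupoid k H where
  R : H ⊗[k] H
  Rinv : H ⊗[k] H
  R_mem : ∃ X : H ⊗[k] H, R = TensorProduct.comm k H H (comul 1) * X * comul 1
  Rinv_mem : ∃ X : H ⊗[k] H, Rinv = comul 1 * X * TensorProduct.comm k H H (comul 1)
  comul_lTensor_R : comul.lTensor H R =
    (TensorProduct.mk k H H 1).lTensor H R * ((TensorProduct.mk k H H).flip 1).lTensor H R
  comul_rTensor_R : TensorProduct.assoc k H H H (comul.rTensor H R) =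
    (TensorProduct.mk k H H 1).lTensor H R * ((1 : H) ⊗ₜ[k] R)
  comulOp_mul_R : ∀ h : H, TensorProduct.comm k H H (comul h) * R = R * comul h
  R_mul_Rinv : R * Rinv = TensorProduct.comm k H H (comul 1)
  Rinv_mul_R : Rinv * R = comul 1

section Tens
variable (k H : Type*) [Field k] [Ring H] [Algebra k H]

section
variable (V W : Type*)
  [AddCommGroup V] [Module k V] [Module H V] [IsScalarTower k H V]
  [AddCommGroup W] [Module k W] [Module H W] [IsScalarTower k H W]

/-- The componentwise action of `H ⊗ H` on `V ⊗ W`. -/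
noncomputable def tensorAct : H ⊗[k] H →ₐ[k] Module.End k (V ⊗[k] W) :=
  (Module.endTensorEndAlgHom (R := k) (S := k) (A := k) (M := V) (N := W)).comp
    (Algebra.TensorProduct.map (Algebra.lsmul k k V) (Algebra.lsmul k k W))

variable {H V W} in
@[simp] theorem tensorAct_tmul (a b : H) (v : V) (w : W) :
    tensorAct k H V W (a ⊗ₜ b) (v ⊗ₜ w) = (a • v) ⊗ₜ (b • w) := rfl

variable {H V W} in
theorem tensorAct_add (X Y : H ⊗[k] H) :
    tensorAct k H V W (X + Y) = tensorAct k H V W X + tensorAct k H V W Y := map_add _ X Y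

variable {H V W} in
theorem tensorAct_zero : tensorAct k H V W 0 = 0 := map_zero _

variable {H V W} in
theorem tensorAct_mul_apply (X Y : H ⊗[k] H) (x : V ⊗[k] W) :
    tensorAct k H V W (X * Y) x = tensorAct k H V W X (tensorAct k H V W Y x) := by
  rw [map_mul, Module.End.mul_apply]

variable [WeakBialgebra k H]

/-- The truncated tensor product `V ⊗_t W = Δ(1) (V ⊗ W) ⊆ V ⊗ W`. -/
def TensorT : Type _ := ↥(LinearMap.range (tensorAct k H V W (comul 1)))

end

namespace TensorT
variable {k H} {V W V' W' Z : Type*} [WeakBialgebra k H]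
  [AddCommGroup V] [Module k V] [Module H V] [IsScalarTower k H V]
  [AddCommGroup W] [Module k W] [Module H W] [IsScalarTower k H W]
  [AddCommGroup V'] [Module k V'] [Module H V'] [IsScalarTower k H V']
  [AddCommGroup W'] [Module k W'] [Module H W'] [IsScalarTower k H W']
  [AddCommGroup Z] [Module k Z] [Module H Z] [IsScalarTower k H Z]

noncomputable instance : AddCommGroup (TensorT k H V W) :=
  inferInstanceAs (AddCommGroup ↥(LinearMap.range (tensorAct k H V W (comul 1))))
noncomputable instance : Module k (TensorT k H V W) :=
  inferInstanceAs (Module k ↥(LinearMap.range (tensorAct k H V W (comul 1))))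

variable (k H V W) in
/-- The inclusion `V ⊗_t W → V ⊗ W`. -/
noncomputable def incl : TensorT k H V W →ₗ[k] V ⊗[k] W := Submodule.subtype _

variable (k H V W) in
/-- The projection `V ⊗ W → V ⊗_t W`, `x ↦ Δ(1) x`. -/
noncomputable def proj : V ⊗[k] W →ₗ[k] TensorT k H V W := LinearMap.rangeRestrict _

theorem incl_injective : Function.Injective (incl k H V W) := Subtype.val_injective

theorem incl_proj (x : V ⊗[k] W) :
    incl k H V W (proj k H V W x) = tensorAct k H V W (comul 1) x := rfl

theorem tensorAct_incl (x : TensorT k H V W) :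
    tensorAct k H V W (comul 1) (incl k H V W x) = incl k H V W x := by
  obtain ⟨_, y, rfl⟩ := x
  change tensorAct k H V W (comul 1) (tensorAct k H V W (comul 1) y) =
    tensorAct k H V W (comul 1) y
  rw [← Module.End.mul_apply, ← map_mul, WeakBialgebra.comul_mul_comul_one]

@[simp] theorem proj_incl (x : TensorT k H V W) : proj k H V W (incl k H V W x) = x :=
  incl_injective (by rw [incl_proj, tensorAct_incl])

/-- The `H`-action `h · x = Δ(h) x` on `V ⊗_t W`; the projection only records that this lies in
`V ⊗_t W`, see `incl_smul`. -/
noncomputable instance : SMul H (TensorT k H V W) where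
  smul h x := proj k H V W (tensorAct k H V W (comul h) (incl k H V W x))

theorem smul_def (h : H) (x : TensorT k H V W) :
    h • x = proj k H V W (tensorAct k H V W (comul h) (incl k H V W x)) := rfl

theorem incl_smul (h : H) (x : TensorT k H V W) :
    incl k H V W (h • x) = tensorAct k H V W (comul h) (incl k H V W x) := by
  rw [smul_def, incl_proj, ← Module.End.mul_apply, ← map_mul, WeakBialgebra.comul_one_mul_comul]

theorem smul_proj (h : H) (x : V ⊗[k] W) :
    h • proj k H V W x = proj k H V W (tensorAct k H V W (comul h) x) := by
  apply incl_injective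
  rw [incl_smul, incl_proj, incl_proj, ← tensorAct_mul_apply, ← tensorAct_mul_apply,
    WeakBialgebra.comul_one_mul_comul, WeakBialgebra.comul_mul_comul_one]

noncomputable instance : Module H (TensorT k H V W) where
  one_smul x := incl_injective (by rw [incl_smul, tensorAct_incl])
  mul_smul g h x := incl_injective (by
    simp only [incl_smul, WeakBialgebra.comul_mul, map_mul, Module.End.mul_apply])
  smul_zero h := by simp [smul_def]
  smul_add h x y := by simp [smul_def]
  add_smul g h x := by simp [smul_def]
  zero_smul x := by simp [smul_def]

instance : IsScalarTower k H (TensorT k H V W) where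
  smul_assoc a h x := by simp [smul_def]

/-- The element `v ⊗_t w = 1₁ v ⊗ 1₂ w`. -/
noncomputable def tmk (v : V) (w : W) : TensorT k H V W := proj k H V W (v ⊗ₜ w)

@[simp] theorem proj_tensorAct (x : V ⊗[k] W) :
    proj k H V W (tensorAct k H V W (comul 1) x) = proj k H V W x := by
  rw [← smul_proj, one_smul]

theorem hom_ext {f g : TensorT k H V W →ₗ[H] Z}
    (h : ∀ v w, f (tmk v w) = g (tmk v w)) : f = g := by
  have key : ∀ x, f (proj k H V W x) = g (proj k H V W x) := by
    intro x
    induction x using tensor_induction with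
    | tmul v w => exact h v w
    | add x y hx hy => simp only [LinearMap.map_add, LinearEquiv.map_add, tensorAct_add, hx, hy]
  ext x
  simpa using key (incl k H V W x)

/-- A linear map on `V ⊗ W` compatible with the coproduct restricts to `V ⊗_t W`. -/
noncomputable def lift (φ : V ⊗[k] W →ₗ[k] Z)
    (hφ : ∀ (h : H) (x : V ⊗[k] W), φ (tensorAct k H V W (comul h) x) = h • φ x) :
    TensorT k H V W →ₗ[H] Z where
  toFun x := φ (incl k H V W x)
  map_add' x y := by simp
  map_smul' h x := by simp [incl_smul, hφ]

theorem lift_proj (φ : V ⊗[k] W →ₗ[k] Z)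
    (hφ : ∀ (h : H) (x : V ⊗[k] W), φ (tensorAct k H V W (comul h) x) = h • φ x)
    (x : V ⊗[k] W) : lift φ hφ (proj k H V W x) = φ x := by
  simp [lift, incl_proj, hφ]

theorem lift_tmk (φ : V ⊗[k] W →ₗ[k] Z)
    (hφ : ∀ (h : H) (x : V ⊗[k] W), φ (tensorAct k H V W (comul h) x) = h • φ x)
    (v : V) (w : W) : lift φ hφ (tmk v w) = φ (v ⊗ₜ w) := lift_proj φ hφ _

theorem tensorAct_map (f : V →ₗ[H] V') (g : W →ₗ[H] W') (X : H ⊗[k] H) (x : V ⊗[k] W) :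
    TensorProduct.map (f.restrictScalars k) (g.restrictScalars k) (tensorAct k H V W X x) =
    tensorAct k H V' W' X
      (TensorProduct.map (f.restrictScalars k) (g.restrictScalars k) x) := by
  induction X using tensor_induction with
  | tmul a b =>
    induction x using tensor_induction with
    | tmul v w => simp
    | add x y hx hy => simp only [LinearMap.map_add, LinearEquiv.map_add, tensorAct_add, hx, hy]
  | add X Y hX hY => simp only [LinearMap.map_add, LinearEquiv.map_add, tensorAct_add, LinearMap.add_apply, hX, hY]

/-- The tensor product of two morphisms. -/
noncomputable def map (f : V →ₗ[H] V') (g : W →ₗ[H] W') :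
    TensorT k H V W →ₗ[H] TensorT k H V' W' :=
  lift (proj k H V' W' ∘ₗ TensorProduct.map (f.restrictScalars k) (g.restrictScalars k))
    (fun h x => by simp only [LinearMap.comp_apply, tensorAct_map, smul_proj])

@[simp] theorem map_tmk (f : V →ₗ[H] V') (g : W →ₗ[H] W') (v : V) (w : W) :
    map f g (tmk (k := k) v w) = tmk (f v) (g w) := lift_tmk _ _ _ _

end TensorT

/-- The target space `H_t`, the image of `ε_t`. -/
def TargetSpace [WeakBialgebra k H] : Type _ := ↥(LinearMap.range (targetMap k (H := H)))

namespace TargetSpace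
variable [WeakBialgebra k H]
noncomputable instance : AddCommGroup (TargetSpace k H) :=
  inferInstanceAs (AddCommGroup ↥(LinearMap.range (targetMap k (H := H))))
noncomputable instance : Module k (TargetSpace k H) :=
  inferInstanceAs (Module k ↥(LinearMap.range (targetMap k (H := H))))

/-- The inclusion `H_t → H`. -/
noncomputable def incl : TargetSpace k H →ₗ[k] H := Submodule.subtype _

/-- The map `ε_t : H → H_t`. -/
noncomputable def ofTarget : H →ₗ[k] TargetSpace k H := (targetMap k).rangeRestrict

variable {k H}

theorem incl_injective : Function.Injective (incl k H) := Subtype.val_injective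

theorem incl_ofTarget (h : H) : incl k H (ofTarget k H h) = targetMap k h := rfl

theorem targetMap_incl (z : TargetSpace k H) : targetMap k (incl k H z) = incl k H z := by
  obtain ⟨_, y, rfl⟩ := z
  exact WeakBialgebra.targetMap_targetMap y

theorem ofTarget_incl (z : TargetSpace k H) : ofTarget k H (incl k H z) = z :=
  incl_injective (targetMap_incl z)

/-- The left `H`-module structure `h · z = ε_t(h z)` of `H_t`. -/
noncomputable instance : SMul H (TargetSpace k H) where
  smul h z := ofTarget k H (h * incl k H z)

theorem incl_smul (h : H) (z : TargetSpace k H) :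
    incl k H (h • z) = targetMap k (h * incl k H z) := rfl

noncomputable instance : Module H (TargetSpace k H) where
  one_smul z := incl_injective (by rw [incl_smul, one_mul, targetMap_incl])
  mul_smul g h z := incl_injective (by
    simp only [incl_smul, mul_assoc, WeakBialgebra.targetMap_mul_targetMap])
  smul_zero h := incl_injective (by simp [incl_smul])
  smul_add h x y := incl_injective (by simp [incl_smul, mul_add])
  add_smul g h x := incl_injective (by simp [incl_smul, add_mul])
  zero_smul x := incl_injective (by simp [incl_smul])

instance : IsScalarTower k H (TargetSpace k H) where
  smul_assoc a h z := incl_injective (by simp [incl_smul])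

end TargetSpace

namespace TensorT
variable {k H} {U V W V' W' Z : Type*}
  [AddCommGroup U] [Module k U] [Module H U] [IsScalarTower k H U]
  [AddCommGroup V] [Module k V] [Module H V] [IsScalarTower k H V]
  [AddCommGroup W] [Module k W] [Module H W] [IsScalarTower k H W]

section weak
variable [WeakBialgebra k H]

/-- The left unit constraint `z ⊗_t v ↦ z v`. -/
noncomputable def leftUnit : TensorT k H (TargetSpace k H) V →ₗ[H] V :=
  lift (TensorProduct.lift ((Algebra.lsmul k k V).toLinearMap ∘ₗ TargetSpace.incl k H))
  (fun h x => by
    induction x using tensor_induction with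
    | tmul z v =>
      have e : ∀ X : H ⊗[k] H,
          TensorProduct.lift ((Algebra.lsmul k k V).toLinearMap ∘ₗ TargetSpace.incl k H)
            (tensorAct k H _ _ X (z ⊗ₜ v)) =
          LinearMap.mul' k H ((targetMap k).rTensor H (X * (TargetSpace.incl k H z ⊗ₜ 1))) • v := by
        intro X
        induction X using tensor_induction with
        | tmul a b => simp [TargetSpace.incl_smul, mul_smul]
        | add x y hx hy => simp only [map_add, LinearMap.add_apply, add_mul, add_smul, hx, hy]
      have e2 : ∀ X Z : H ⊗[k] H,
          LinearMap.mul' k H ((TensorProduct.lid k H ∘ₗ (counit (R := k) (A := H)).rTensor H ∘ₗ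
            LinearMap.mulLeft k Z ∘ₗ (TensorProduct.mk k H H).flip 1).rTensor H X) =
          TensorProduct.lid k H ((counit (R := k) (A := H)).rTensor H (Z * X)) := by
        intro X Z
        induction X using tensor_induction with
        | tmul a b =>
          induction Z using tensor_induction with
          | tmul x y => simp
          | add x y hx hy =>
            simp only [map_add, add_mul, ← hx, ← hy]
            simp [add_mul]
        | add x y hx hy => simp only [LinearMap.map_add, LinearEquiv.map_add, tensorAct_add, mul_add, hx, hy]
      have e3 : comul (R := k) h * (TargetSpace.incl k H z ⊗ₜ 1) =
          comul (R := k) (h * TargetSpace.incl k H z) := by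
        rw [← TargetSpace.targetMap_incl z, WeakBialgebra.comul_mul,
          WeakBialgebra.comul_targetMap', ← mul_assoc, WeakBialgebra.comul_mul_comul_one]
      rw [e, e3]
      erw [e2]
      rw [WeakBialgebra.comul_one_mul_comul]
      simp [mul_smul]
    | add x y hx hy => simp only [LinearMap.map_add, LinearEquiv.map_add, tensorAct_add, smul_add, hx, hy])

theorem leftUnit_tmk (z : TargetSpace k H) (v : V) :
    leftUnit (tmk (k := k) z v) = TargetSpace.incl k H z • v := lift_tmk _ _ _ _

end weak
end TensorT

end Tens

section Tens
variable (k H : Type*) [Field k] [Ring H] [Algebra k H]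

section triple
variable (U V W : Type*)
  [AddCommGroup U] [Module k U] [Module H U] [IsScalarTower k H U]
  [AddCommGroup V] [Module k V] [Module H V] [IsScalarTower k H V]
  [AddCommGroup W] [Module k W] [Module H W] [IsScalarTower k H W]

/-- The componentwise action of `H ⊗ (H ⊗ H)` on `U ⊗ (V ⊗ W)`. -/
noncomputable def tensorActR : H ⊗[k] (H ⊗[k] H) →ₐ[k] Module.End k (U ⊗[k] (V ⊗[k] W)) :=
  (Module.endTensorEndAlgHom (R := k) (S := k) (A := k) (M := U) (N := V ⊗[k] W)).comp
    (Algebra.TensorProduct.map (Algebra.lsmul k k U) (tensorAct k H V W))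

/-- The componentwise action of `(H ⊗ H) ⊗ H` on `(U ⊗ V) ⊗ W`. -/
noncomputable def tensorActL : (H ⊗[k] H) ⊗[k] H →ₐ[k] Module.End k ((U ⊗[k] V) ⊗[k] W) :=
  (Module.endTensorEndAlgHom (R := k) (S := k) (A := k) (M := U ⊗[k] V) (N := W)).comp
    (Algebra.TensorProduct.map (tensorAct k H U V) (Algebra.lsmul k k W))

variable {H U V W}

@[simp] theorem tensorActR_tmul (a : H) (X : H ⊗[k] H) (u : U) (x : V ⊗[k] W) :
    tensorActR k H U V W (a ⊗ₜ X) (u ⊗ₜ x) = (a • u) ⊗ₜ tensorAct k H V W X x := rfl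

@[simp] theorem tensorActL_tmul (a : H) (X : H ⊗[k] H) (w : W) (x : U ⊗[k] V) :
    tensorActL k H U V W (X ⊗ₜ a) (x ⊗ₜ w) = tensorAct k H U V X x ⊗ₜ (a • w) := rfl

theorem tensorActR_add (X Y : H ⊗[k] (H ⊗[k] H)) :
    tensorActR k H U V W (X + Y) = tensorActR k H U V W X + tensorActR k H U V W Y :=
  map_add _ X Y

theorem tensorActL_add (X Y : (H ⊗[k] H) ⊗[k] H) :
    tensorActL k H U V W (X + Y) = tensorActL k H U V W X + tensorActL k H U V W Y :=
  map_add _ X Y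

theorem tensorActR_zero : tensorActR k H U V W 0 = 0 := map_zero _

theorem tensorActL_zero : tensorActL k H U V W 0 = 0 := map_zero _

theorem assoc_tensorActL (X : (H ⊗[k] H) ⊗[k] H) (x : (U ⊗[k] V) ⊗[k] W) :
    TensorProduct.assoc k U V W (tensorActL k H U V W X x) =
      tensorActR k H U V W (TensorProduct.assoc k H H H X) (TensorProduct.assoc k U V W x) := by
  induction X using tensor_induction with
  | add X Y hX hY => simp only [LinearMap.map_add, LinearEquiv.map_add, tensorAct_add, tensorActR_add, tensorActL_add, LinearMap.add_apply, hX, hY]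
  | tmul X c =>
    induction X using tensor_induction with
    | add X Y hX hY => simp only [LinearMap.map_add, LinearEquiv.map_add, tensorAct_add, tensorActR_add, tensorActL_add, add_tmul, LinearMap.add_apply, hX, hY]
    | tmul a b =>
      induction x using tensor_induction with
      | add x y hx hy => simp only [LinearMap.map_add, LinearEquiv.map_add, tensorAct_add, tensorActR_add, tensorActL_add, hx, hy]
      | tmul x w =>
        induction x using tensor_induction with
        | add x y hx hy => simp only [LinearMap.map_add, LinearEquiv.map_add, tensorAct_add, tensorActR_add, tensorActL_add, add_tmul, hx, hy]
        | tmul u v => simp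

theorem assoc_symm_tensorActR (X : H ⊗[k] (H ⊗[k] H)) (x : U ⊗[k] (V ⊗[k] W)) :
    (TensorProduct.assoc k U V W).symm (tensorActR k H U V W X x) =
      tensorActL k H U V W ((TensorProduct.assoc k H H H).symm X)
        ((TensorProduct.assoc k U V W).symm x) := by
  apply (TensorProduct.assoc k U V W).injective
  rw [assoc_tensorActL]
  simp

variable [WeakBialgebra k H]

theorem lTensor_proj_tensorActR (X : H ⊗[k] H) (x : U ⊗[k] (V ⊗[k] W)) :
    (TensorT.proj k H V W).lTensor U (tensorActR k H U V W (comul.lTensor H X) x) =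
      tensorAct k H U (TensorT k H V W) X ((TensorT.proj k H V W).lTensor U x) := by
  induction X using tensor_induction with
  | add X Y hX hY => simp only [LinearMap.map_add, LinearEquiv.map_add, tensorAct_add, tensorActR_add, tensorActL_add, LinearMap.add_apply, hX, hY]
  | tmul a b =>
    induction x using tensor_induction with
    | add x y hx hy => simp only [LinearMap.map_add, LinearEquiv.map_add, tensorAct_add, tensorActR_add, tensorActL_add, hx, hy]
    | tmul u x => simp [TensorT.smul_proj]

theorem rTensor_proj_tensorActL (X : H ⊗[k] H) (x : (U ⊗[k] V) ⊗[k] W) :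
    (TensorT.proj k H U V).rTensor W (tensorActL k H U V W (comul.rTensor H X) x) =
      tensorAct k H (TensorT k H U V) W X ((TensorT.proj k H U V).rTensor W x) := by
  induction X using tensor_induction with
  | add X Y hX hY => simp only [LinearMap.map_add, LinearEquiv.map_add, tensorAct_add, tensorActR_add, tensorActL_add, LinearMap.add_apply, hX, hY]
  | tmul a b =>
    induction x using tensor_induction with
    | add x y hx hy => simp only [LinearMap.map_add, LinearEquiv.map_add, tensorAct_add, tensorActR_add, tensorActL_add, hx, hy]
    | tmul x u => simp [TensorT.smul_proj]

theorem lTensor_incl_tensorAct (X : H ⊗[k] H) (x : U ⊗[k] TensorT k H V W) :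
    (TensorT.incl k H V W).lTensor U (tensorAct k H U (TensorT k H V W) X x) =
      tensorActR k H U V W (comul.lTensor H X) ((TensorT.incl k H V W).lTensor U x) := by
  induction X using tensor_induction with
  | add X Y hX hY => simp only [LinearMap.map_add, LinearEquiv.map_add, tensorAct_add, tensorActR_add, tensorActL_add, LinearMap.add_apply, hX, hY]
  | tmul a b =>
    induction x using tensor_induction with
    | add x y hx hy => simp only [LinearMap.map_add, LinearEquiv.map_add, tensorAct_add, tensorActR_add, tensorActL_add, hx, hy]
    | tmul u x => simp [TensorT.incl_smul]

theorem rTensor_incl_tensorAct (X : H ⊗[k] H) (x : TensorT k H U V ⊗[k] W) :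
    (TensorT.incl k H U V).rTensor W (tensorAct k H (TensorT k H U V) W X x) =
      tensorActL k H U V W (comul.rTensor H X) ((TensorT.incl k H U V).rTensor W x) := by
  induction X using tensor_induction with
  | add X Y hX hY => simp only [LinearMap.map_add, LinearEquiv.map_add, tensorAct_add, tensorActR_add, tensorActL_add, LinearMap.add_apply, hX, hY]
  | tmul a b =>
    induction x using tensor_induction with
    | add x y hx hy => simp only [LinearMap.map_add, LinearEquiv.map_add, tensorAct_add, tensorActR_add, tensorActL_add, hx, hy]
    | tmul x u => simp [TensorT.incl_smul]

end triple

namespace TensorT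
variable {k H} {U V W V' W' Z : Type*}
  [AddCommGroup U] [Module k U] [Module H U] [IsScalarTower k H U]
  [AddCommGroup V] [Module k V] [Module H V] [IsScalarTower k H V]
  [AddCommGroup W] [Module k W] [Module H W] [IsScalarTower k H W]

section weak
variable [WeakBialgebra k H]

/-- The associator, induced by `(u ⊗ v) ⊗ w ↦ u ⊗ (v ⊗ w)`, see `assocHom_tmk`. -/
noncomputable def assocHom :
    TensorT k H (TensorT k H U V) W →ₗ[H] TensorT k H U (TensorT k H V W) :=
  lift (proj k H U (TensorT k H V W) ∘ₗ (proj k H V W).lTensor U ∘ₗ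
    (TensorProduct.assoc k U V W).toLinearMap ∘ₗ (incl k H U V).rTensor W) (fun h x => by
      simp only [LinearMap.comp_apply, LinearEquiv.coe_coe]
      rw [rTensor_incl_tensorAct, assoc_tensorActL, coassoc_apply, lTensor_proj_tensorActR,
        smul_proj])

/-- The inverse associator. -/
noncomputable def assocInv :
    TensorT k H U (TensorT k H V W) →ₗ[H] TensorT k H (TensorT k H U V) W :=
  lift (proj k H (TensorT k H U V) W ∘ₗ (proj k H U V).rTensor W ∘ₗ
    (TensorProduct.assoc k U V W).symm.toLinearMap ∘ₗ (incl k H V W).lTensor U) (fun h x => by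
      simp only [LinearMap.comp_apply, LinearEquiv.coe_coe]
      rw [lTensor_incl_tensorAct, assoc_symm_tensorActR, coassoc_symm_apply,
        rTensor_proj_tensorActL, smul_proj])

@[simp] theorem assocHom_tmk (u : U) (v : V) (w : W) :
    assocHom (tmk (k := k) (H := H) (tmk u v) w) = tmk u (tmk v w) := by
  have e : ∀ x, proj k H U (TensorT k H V W) ((proj k H V W).lTensor U
      (tensorActR k H U V W (comul.lTensor H (comul 1)) x)) =
      proj k H U (TensorT k H V W) ((proj k H V W).lTensor U x) := by
    intro x
    rw [lTensor_proj_tensorActR, proj_tensorAct]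
  have e1 : Algebra.TensorProduct.assoc k k k H H H (comul (R := k) (1 : H) ⊗ₜ[k] (1 : H)) *
      Algebra.TensorProduct.assoc k k k H H H (comul (R := k) (1 : H) ⊗ₜ[k] (1 : H)) =
      Algebra.TensorProduct.assoc k k k H H H (comul (R := k) (1 : H) ⊗ₜ[k] (1 : H)) := by
    rw [← map_mul,
      Algebra.TensorProduct.tmul_mul_tmul, WeakBialgebra.comul_mul_comul_one, one_mul]
  have e2 : comul.lTensor H (comul (R := k) (1 : H)) *
      TensorProduct.assoc k H H H (comul (R := k) (1 : H) ⊗ₜ[k] (1 : H)) =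
      comul.lTensor H (comul (R := k) (1 : H)) := by
    rw [WeakBialgebra.comul_comul_one, mul_assoc]
    exact congrArg _ e1
  have e3 : (incl k H U V).rTensor W (tmk u v ⊗ₜ[k] w) =
      tensorActL k H U V W (comul 1 ⊗ₜ 1) ((u ⊗ₜ v) ⊗ₜ w) := by
    simp [tmk, incl_proj]
  rw [assocHom, lift_tmk]
  simp only [LinearMap.comp_apply, LinearEquiv.coe_coe]
  rw [e3, assoc_tensorActL, ← e, ← Module.End.mul_apply, ← map_mul, e2, e]
  rfl

@[simp] theorem assocInv_tmk (u : U) (v : V) (w : W) :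
    assocInv (tmk (k := k) (H := H) u (tmk v w)) = tmk (tmk u v) w := by
  have e : ∀ x, proj k H (TensorT k H U V) W ((proj k H U V).rTensor W
      (tensorActL k H U V W (comul.rTensor H (comul 1)) x)) =
      proj k H (TensorT k H U V) W ((proj k H U V).rTensor W x) := by
    intro x
    rw [rTensor_proj_tensorActL, proj_tensorAct]
  have e1 : ((1 : H) ⊗ₜ[k] comul (R := k) (1 : H)) * ((1 : H) ⊗ₜ[k] comul (R := k) (1 : H)) =
      (1 : H) ⊗ₜ[k] comul (R := k) (1 : H) := by
    rw [Algebra.TensorProduct.tmul_mul_tmul, WeakBialgebra.comul_mul_comul_one, one_mul]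
  have e2 : comul.rTensor H (comul (R := k) (1 : H)) *
      (TensorProduct.assoc k H H H).symm ((1 : H) ⊗ₜ[k] comul (R := k) (1 : H)) =
      comul.rTensor H (comul (R := k) (1 : H)) := by
    rw [← coassoc_symm_apply, WeakBialgebra.comul_comul_one']
    erw [← map_mul (Algebra.TensorProduct.assoc k k k H H H).symm _ _]
    rw [mul_assoc, e1]
    rfl
  have e3 : (incl k H V W).lTensor U (u ⊗ₜ[k] tmk v w) =
      tensorActR k H U V W (1 ⊗ₜ comul 1) (u ⊗ₜ (v ⊗ₜ w)) := by
    simp [tmk, incl_proj]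
  rw [assocInv, lift_tmk]
  simp only [LinearMap.comp_apply, LinearEquiv.coe_coe]
  rw [e3, assoc_symm_tensorActR, ← e, ← Module.End.mul_apply, ← map_mul, e2, e]
  rfl

theorem hom_ext₃ {Z : Type*} [AddCommGroup Z] [Module k Z] [Module H Z] [IsScalarTower k H Z]
    {f g : TensorT k H (TensorT k H U V) W →ₗ[H] Z}
    (h : ∀ u v w, f (tmk (tmk u v) w) = g (tmk (tmk u v) w)) : f = g := by
  have key : ∀ x w, f (tmk (proj k H U V x) w) = g (tmk (proj k H U V x) w) := by
    intro x w
    induction x using tensor_induction with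
    | tmul u v => exact h u v w
    | add x y hx hy =>
      simp only [tmk] at hx hy ⊢
      simp only [LinearMap.map_add, LinearEquiv.map_add, tensorAct_add, tensorActR_add, tensorActL_add, add_tmul, hx, hy]
  apply hom_ext
  intro x w
  simpa using key (incl k H U V x) w

theorem hom_ext₃' {Z : Type*} [AddCommGroup Z] [Module k Z] [Module H Z] [IsScalarTower k H Z]
    {f g : TensorT k H U (TensorT k H V W) →ₗ[H] Z}
    (h : ∀ u v w, f (tmk u (tmk v w)) = g (tmk u (tmk v w))) : f = g := by
  have key : ∀ u x, f (tmk u (proj k H V W x)) = g (tmk u (proj k H V W x)) := by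
    intro u x
    induction x using tensor_induction with
    | tmul v w => exact h u v w
    | add x y hx hy =>
      simp only [tmk] at hx hy ⊢
      simp only [LinearMap.map_add, LinearEquiv.map_add, tensorAct_add, tensorActR_add, tensorActL_add, tmul_add, hx, hy]
  apply hom_ext
  intro u x
  simpa using key u (incl k H V W x)

theorem hom_ext₄ {T Z : Type*} [AddCommGroup T] [Module k T] [Module H T] [IsScalarTower k H T]
    [AddCommGroup Z] [Module k Z] [Module H Z] [IsScalarTower k H Z]
    {f g : TensorT k H (TensorT k H (TensorT k H T U) V) W →ₗ[H] Z}
    (h : ∀ t u v w, f (tmk (tmk (tmk t u) v) w) = g (tmk (tmk (tmk t u) v) w)) : f = g := by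
  have key : ∀ x v w, f (tmk (tmk (proj k H T U x) v) w) =
      g (tmk (tmk (proj k H T U x) v) w) := by
    intro x v w
    induction x using tensor_induction with
    | tmul t u => exact h t u v w
    | add x y hx hy =>
      simp only [tmk] at hx hy ⊢
      simp only [LinearMap.map_add, LinearEquiv.map_add, tensorAct_add, tensorActR_add, tensorActL_add, add_tmul, hx, hy]
  apply hom_ext₃
  intro x v w
  simpa using key (incl k H T U x) v w

theorem assocInv_assocHom (x : TensorT k H (TensorT k H U V) W) : assocInv (assocHom x) = x :=
  DFunLike.congr_fun (f := assocInv ∘ₗ assocHom) (g := LinearMap.id)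
      (hom_ext₃ (fun u v w => by simp)) x

theorem assocHom_assocInv (x : TensorT k H U (TensorT k H V W)) : assocHom (assocInv x) = x :=
  DFunLike.congr_fun (f := assocHom ∘ₗ assocInv) (g := LinearMap.id)
      (hom_ext₃' (fun u v w => by simp)) x

end weak

section quantumGroupoid
variable [QuantumGroupoid k H]
open QuantumGroupoid

/-- The right unit constraint `v ⊗_t z ↦ S⁻¹(z) v`. -/
noncomputable def rightUnit : TensorT k H V (TargetSpace k H) →ₗ[H] V :=
  lift (TensorProduct.lift ((Algebra.lsmul k k V).toLinearMap ∘ₗ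
    antipodeEquiv.symm.toLinearMap ∘ₗ TargetSpace.incl k H) ∘ₗ
      (TensorProduct.comm k V (TargetSpace k H)).toLinearMap)
  (fun h x => by
    induction x using tensor_induction with
    | tmul v z =>
      have e : ∀ X : H ⊗[k] H,
          (TensorProduct.lift ((Algebra.lsmul k k V).toLinearMap ∘ₗ
          (antipodeEquiv (k := k) (H := H)).symm.toLinearMap ∘ₗ TargetSpace.incl k H) ∘ₗ
            (TensorProduct.comm k V (TargetSpace k H)).toLinearMap)
            (tensorAct k H V (TargetSpace k H) X (v ⊗ₜ z)) =
          antipodeEquiv (k := k).symm (LinearMap.mul' k H (TensorProduct.map (antipode (k := k))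
            (targetMap k ∘ₗ LinearMap.mulRight k (TargetSpace.incl k H z)) X)) • v := by
        intro X
        induction X using tensor_induction with
        | tmul a b =>
          have : antipodeEquiv (k := k).symm (antipode (k := k) a *
              targetMap k (b * TargetSpace.incl k H z)) =
              antipodeEquiv (k := k).symm (targetMap k (b * TargetSpace.incl k H z)) * a := by
            rw [LinearEquiv.symm_apply_eq, antipodeEquiv_apply, antipode_mul,
              ← antipodeEquiv_apply (antipodeEquiv.symm _), LinearEquiv.apply_symm_apply]
          simp [TargetSpace.incl_smul, this, mul_smul]
        | add x y hx hy => simp only [LinearMap.map_add, LinearEquiv.map_add, tensorAct_add, tensorActR_add, tensorActL_add, LinearMap.add_apply, add_smul, hx, hy]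
      rw [e, ← TargetSpace.targetMap_incl z, antipode_conv_target_aux]
      have : antipodeEquiv (k := k).symm (targetMap k (TargetSpace.incl k H z) *
          antipode (k := k) h) = h *
          antipodeEquiv (k := k).symm (targetMap k (TargetSpace.incl k H z)) := by
        rw [LinearEquiv.symm_apply_eq, antipodeEquiv_apply, antipode_mul,
              ← antipodeEquiv_apply (antipodeEquiv.symm _), LinearEquiv.apply_symm_apply]
      rw [this, TargetSpace.targetMap_incl, mul_smul]
      rfl
    | add x y hx hy => simp only [LinearMap.map_add, LinearEquiv.map_add, tensorAct_add, tensorActR_add, tensorActL_add, smul_add, hx, hy])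

theorem rightUnit_tmk (v : V) (z : TargetSpace k H) :
    rightUnit (tmk (k := k) v z) = antipodeEquiv (k := k).symm (TargetSpace.incl k H z) • v :=
  lift_tmk _ _ _ _

theorem tmk_source_smul (y : H) (v : V) (w : W) :
    tmk (k := k) (H := H) (sourceMap k y • v) w =
      tmk v (antipode (k := k) (sourceMap k y) • w) := by
  have := congrArg (fun X => proj k H V W (tensorAct k H V W X (v ⊗ₜ w)))
    (comul_one_mul_source (k := k) y)
  simp only [tensorAct_mul_apply, proj_tensorAct, tensorAct_tmul, one_smul] at this
  exact this

theorem tmk_target_smul (z : TargetSpace k H) (v : V) (w : W) :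
    tmk (k := k) (H := H) (antipodeEquiv (k := k).symm (TargetSpace.incl k H z) • v) w =
      tmk v (TargetSpace.incl k H z • w) := by
  obtain ⟨y, hy⟩ := exists_source_of_target (k := k) (TargetSpace.incl k H z)
  rw [TargetSpace.targetMap_incl] at hy
  have : antipodeEquiv (k := k).symm (TargetSpace.incl k H z) = sourceMap k y := by
    rw [LinearEquiv.symm_apply_eq, antipodeEquiv_apply, hy]
  rw [this, tmk_source_smul, hy]

theorem target_smul_one (z : TargetSpace k H) :
    TargetSpace.incl k H z • TargetSpace.ofTarget k H 1 = z := by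
  apply TargetSpace.incl_injective
  rw [TargetSpace.incl_smul, TargetSpace.incl_ofTarget, targetMap_one, mul_one,
    TargetSpace.targetMap_incl]

theorem source_smul_one (z : TargetSpace k H) :
    antipodeEquiv (k := k).symm (TargetSpace.incl k H z) • TargetSpace.ofTarget k H 1 = z := by
  obtain ⟨y, hy⟩ := exists_source_of_target (k := k) (TargetSpace.incl k H z)
  rw [TargetSpace.targetMap_incl] at hy
  have : antipodeEquiv (k := k).symm (TargetSpace.incl k H z) = sourceMap k y := by
    rw [LinearEquiv.symm_apply_eq, antipodeEquiv_apply, hy]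
  apply TargetSpace.incl_injective
  rw [TargetSpace.incl_smul, TargetSpace.incl_ofTarget, targetMap_one, mul_one, this,
    ← antipode_sourceMap, hy]

variable (k H V) in
/-- The left unit constraint as an isomorphism, with inverse `v ↦ 1 ⊗_t v`. -/
noncomputable def leftUnitEquiv : TensorT k H (TargetSpace k H) V ≃ₗ[H] V where
  __ := leftUnit
  invFun v := tmk (TargetSpace.ofTarget k H 1) v
  left_inv x := by
    have key : ∀ x, tmk (TargetSpace.ofTarget k H 1) (leftUnit (proj k H (TargetSpace k H) V x)) =
        proj k H _ _ x := by
      intro x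
      induction x using tensor_induction with
      | tmul z v =>
        change tmk _ (leftUnit (tmk z v)) = tmk z v
        rw [leftUnit_tmk, ← tmk_target_smul, source_smul_one]
      | add x y hx hy =>
        simp only [tmk] at hx hy ⊢
        simp only [LinearMap.map_add, LinearEquiv.map_add, tensorAct_add, tensorActR_add, tensorActL_add, tmul_add, hx, hy]
    simpa using key (incl k H _ _ x)
  right_inv v := by
    change leftUnit (tmk _ v) = v
    rw [leftUnit_tmk, TargetSpace.incl_ofTarget, targetMap_one, one_smul]

variable (k H V) in
/-- The right unit constraint as an isomorphism, with inverse `v ↦ v ⊗_t 1`. -/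
noncomputable def rightUnitEquiv : TensorT k H V (TargetSpace k H) ≃ₗ[H] V where
  __ := rightUnit
  invFun v := tmk v (TargetSpace.ofTarget k H 1)
  left_inv x := by
    have key : ∀ x, tmk (rightUnit (proj k H V (TargetSpace k H) x)) (TargetSpace.ofTarget k H 1) =
        proj k H _ _ x := by
      intro x
      induction x using tensor_induction with
      | tmul v z =>
        change tmk (rightUnit (tmk v z)) _ = tmk v z
        rw [rightUnit_tmk, tmk_target_smul, target_smul_one]
      | add x y hx hy =>
        simp only [tmk] at hx hy ⊢
        simp only [LinearMap.map_add, LinearEquiv.map_add, tensorAct_add, tensorActR_add, tensorActL_add, add_tmul, hx, hy]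
    simpa using key (incl k H _ _ x)
  right_inv v := by
    change rightUnit (tmk v _) = v
    rw [rightUnit_tmk, TargetSpace.incl_ofTarget, targetMap_one, ← antipode_one (k := k),
      ← antipodeEquiv_apply, LinearEquiv.symm_apply_apply, one_smul]

end quantumGroupoid

section quasitriangular
variable [QuasitriangularQuantumGroupoid k H]
open QuasitriangularQuantumGroupoid

theorem comm_tensorAct (X : H ⊗[k] H) (x : V ⊗[k] W) :
    TensorProduct.comm k V W (tensorAct k H V W X x) =
      tensorAct k H W V (TensorProduct.comm k H H X) (TensorProduct.comm k V W x) := by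
  induction X using tensor_induction with
  | tmul a b =>
    induction x using tensor_induction with
    | tmul v w => simp
    | add x y hx hy => simp only [LinearMap.map_add, LinearEquiv.map_add, tensorAct_add, tensorActR_add, tensorActL_add, hx, hy]
  | add X Y hX hY => simp only [LinearMap.map_add, LinearEquiv.map_add, tensorAct_add, tensorActR_add, tensorActL_add, LinearMap.add_apply, hX, hY]

theorem comm_mul (X Y : H ⊗[k] H) : TensorProduct.comm k H H (X * Y) =
    TensorProduct.comm k H H X * TensorProduct.comm k H H Y :=
  map_mul (Algebra.TensorProduct.comm k H H) X Y

theorem comm_comm' (X : H ⊗[k] H) :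
    TensorProduct.comm k H H (TensorProduct.comm k H H X) = X :=
  (TensorProduct.comm k H H).symm_apply_apply X

/-- The braiding `v ⊗_t w ↦ R⁽²⁾ w ⊗_t R⁽¹⁾ v`. -/
noncomputable def braid : TensorT k H V W →ₗ[H] TensorT k H W V :=
  lift (proj k H W V ∘ₗ (TensorProduct.comm k V W).toLinearMap ∘ₗ tensorAct k H V W R)
    (fun h x => by
      simp only [LinearMap.comp_apply, LinearEquiv.coe_coe]
      rw [smul_proj, ← tensorAct_mul_apply, ← comulOp_mul_R, tensorAct_mul_apply, comm_tensorAct,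
        comm_comm'])

theorem Rinv_mul_comulOp (h : H) :
    Rinv * TensorProduct.comm k H H (comul h) = comul (R := k) h * Rinv := by
  have e : TensorProduct.comm k H H (comul h) * TensorProduct.comm k H H (comul 1) =
      TensorProduct.comm k H H (comul h) := by
    rw [← comm_mul, WeakBialgebra.comul_mul_comul_one]
  rw [← e, ← R_mul_Rinv, ← mul_assoc _ R, comulOp_mul_R, ← mul_assoc, ← mul_assoc, Rinv_mul_R,
    WeakBialgebra.comul_one_mul_comul]

/-- The inverse braiding. -/
noncomputable def braidInv : TensorT k H W V →ₗ[H] TensorT k H V W :=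
  lift (proj k H V W ∘ₗ tensorAct k H V W Rinv ∘ₗ (TensorProduct.comm k W V).toLinearMap)
    (fun h x => by
      simp only [LinearMap.comp_apply, LinearEquiv.coe_coe]
      rw [smul_proj, comm_tensorAct, ← tensorAct_mul_apply, Rinv_mul_comulOp, tensorAct_mul_apply])

theorem braid_proj (x : V ⊗[k] W) : braid (proj k H V W x) =
    proj k H W V (TensorProduct.comm k V W (tensorAct k H V W R x)) := lift_proj _ _ _

theorem braidInv_proj (x : W ⊗[k] V) : braidInv (proj k H W V x) =
    proj k H V W (tensorAct k H V W Rinv (TensorProduct.comm k W V x)) := lift_proj _ _ _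

theorem braidInv_braid (x : TensorT k H V W) : braidInv (braid x) = x := by
  rw [← proj_incl x, braid_proj, braidInv_proj]
  have : ∀ y, TensorProduct.comm k W V (TensorProduct.comm k V W y) = y :=
    (TensorProduct.comm k V W).symm_apply_apply
  rw [this, ← tensorAct_mul_apply, Rinv_mul_R, proj_tensorAct]

theorem braid_braidInv (x : TensorT k H V W) : braid (braidInv x) = x := by
  rw [← proj_incl x, braidInv_proj, braid_proj]
  have : ∀ y, TensorProduct.comm k W V (TensorProduct.comm k V W y) = y :=
    (TensorProduct.comm k V W).symm_apply_apply
  rw [← tensorAct_mul_apply, R_mul_Rinv, comm_tensorAct, this, comm_comm', proj_tensorAct]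

theorem braid_tmk (v : V) (w : W) : braid (tmk (k := k) (H := H) v w) =
    proj k H W V (TensorProduct.comm k V W (tensorAct k H V W R (v ⊗ₜ w))) := braid_proj _

theorem braid_naturality {V' W' : Type*}
    [AddCommGroup V'] [Module k V'] [Module H V'] [IsScalarTower k H V']
    [AddCommGroup W'] [Module k W'] [Module H W'] [IsScalarTower k H W']
    (f : V →ₗ[H] V') (g : W →ₗ[H] W') :
    braid ∘ₗ map (k := k) f g = map g f ∘ₗ braid := by
  apply hom_ext
  intro v w
  simp only [LinearMap.comp_apply, map_tmk, braid_tmk]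
  generalize R (k := k) (H := H) = X
  induction X using tensor_induction with
  | tmul a b =>
    change tmk _ _ = map g f (tmk _ _)
    simp
  | add x y hx hy => simp only [LinearMap.map_add, LinearEquiv.map_add, tensorAct_add, tensorActR_add, tensorActL_add, LinearMap.add_apply, hx, hy]

/-- First hexagon. -/
theorem hexagon_forward : assocHom (k := k) (H := H) (U := V) (V := W) (W := U) ∘ₗ
    braid ∘ₗ assocHom = map LinearMap.id braid ∘ₗ assocHom ∘ₗ map braid LinearMap.id := by
  apply hom_ext₃
  intro u v w
  let Q : H ⊗[k] (H ⊗[k] H) →ₗ[k] TensorT k H V (TensorT k H W U) :=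
    proj k H V (TensorT k H W U) ∘ₗ (proj k H W U).lTensor V ∘ₗ
      (TensorProduct.assoc k V W U).toLinearMap ∘ₗ
      (TensorProduct.comm k U (V ⊗[k] W)).toLinearMap ∘ₗ
      (tensorActR k H U V W).toLinearMap.flip (u ⊗ₜ (v ⊗ₜ w))
  have hQ : ∀ a b c : H, Q (a ⊗ₜ (b ⊗ₜ c)) = tmk (b • v) (tmk (c • w) (a • u)) := fun a b c => rfl
  have e1 : ∀ X : H ⊗[k] H, assocHom (proj k H (TensorT k H V W) U
      (TensorProduct.comm k U (TensorT k H V W) (tensorAct k H U (TensorT k H V W) X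
        (u ⊗ₜ tmk v w)))) = Q (comul.lTensor H X) := by
    intro X
    induction X using tensor_induction with
    | tmul a b =>
      simp only [tensorAct_tmul, TensorProduct.comm_tmul, LinearMap.lTensor_tmul, tmk, smul_proj]
      generalize comul (R := k) b = Y
      induction Y using tensor_induction with
      | tmul b c =>
        rw [hQ]
        exact assocHom_tmk _ _ _
      | add x y hx hy => simp only [LinearMap.map_add, LinearEquiv.map_add, tensorAct_add, tensorActR_add, tensorActL_add, LinearMap.add_apply, add_tmul, tmul_add, hx, hy]
    | add x y hx hy => simp only [LinearMap.map_add, LinearEquiv.map_add, tensorAct_add, tensorActR_add, tensorActL_add, LinearMap.add_apply, hx, hy]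
  have e3 : ∀ (a b : H) (Y : H ⊗[k] H), tmk (b • v) (proj k H W U
      (TensorProduct.comm k U W (tensorAct k H U W Y ((a • u) ⊗ₜ w)))) =
      Q ((TensorProduct.mk k H H 1).lTensor H Y * (a ⊗ₜ (b ⊗ₜ 1))) := by
    intro a b Y
    induction Y using tensor_induction with
    | tmul c d =>
      simp only [LinearMap.lTensor_tmul, TensorProduct.mk_apply, Algebra.TensorProduct.tmul_mul_tmul,
        one_mul, mul_one, hQ, mul_smul]
      rfl
    | add x y hx hy =>
      simp only [tmk] at hx hy ⊢
      simp only [LinearMap.map_add, LinearEquiv.map_add, tensorAct_add, tensorActR_add, tensorActL_add, LinearMap.add_apply, tmul_add, add_mul, hx, hy]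
  have e2 : ∀ X : H ⊗[k] H, map LinearMap.id (braid (k := k) (H := H)) (assocHom (tmk
      (proj k H V U (TensorProduct.comm k U V (tensorAct k H U V X (u ⊗ₜ v)))) w)) =
      Q ((TensorProduct.mk k H H 1).lTensor H R *
        ((TensorProduct.mk k H H).flip 1).lTensor H X) := by
    intro X
    induction X using tensor_induction with
    | tmul a b =>
      change map LinearMap.id braid (assocHom (tmk (tmk _ _) _)) = _
      rw [assocHom_tmk, map_tmk, braid_tmk]
      exact e3 _ _ _
    | add x y hx hy =>
      simp only [tmk] at hx hy ⊢
      simp only [LinearMap.map_add, LinearEquiv.map_add, tensorAct_add, tensorActR_add, tensorActL_add, LinearMap.add_apply, add_tmul, mul_add, hx, hy]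
  simp only [LinearMap.comp_apply, map_tmk, assocHom_tmk, braid_tmk, LinearMap.id_apply]
  rw [e1, comul_lTensor_R, e2]

/-- Second hexagon. -/
theorem hexagon_reverse : assocInv (k := k) (H := H) (U := W) (V := U) (W := V) ∘ₗ
    braid ∘ₗ assocInv = map braid LinearMap.id ∘ₗ assocInv ∘ₗ map LinearMap.id braid := by
  apply hom_ext₃'
  intro u v w
  let Q : H ⊗[k] (H ⊗[k] H) →ₗ[k] TensorT k H (TensorT k H W U) V :=
    proj k H (TensorT k H W U) V ∘ₗ (proj k H W U).rTensor V ∘ₗ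
      (TensorProduct.assoc k W U V).symm.toLinearMap ∘ₗ
      (TensorProduct.comm k (U ⊗[k] V) W).toLinearMap ∘ₗ
      (TensorProduct.assoc k U V W).symm.toLinearMap ∘ₗ
      (tensorActR k H U V W).toLinearMap.flip (u ⊗ₜ (v ⊗ₜ w))
  have hQ : ∀ a b c : H, Q (a ⊗ₜ (b ⊗ₜ c)) = tmk (tmk (c • w) (a • u)) (b • v) := fun a b c => rfl
  have e1 : ∀ X : H ⊗[k] H, assocInv (proj k H W (TensorT k H U V)
      (TensorProduct.comm k (TensorT k H U V) W (tensorAct k H (TensorT k H U V) W X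
        (tmk u v ⊗ₜ w)))) = Q (TensorProduct.assoc k H H H (comul.rTensor H X)) := by
    intro X
    induction X using tensor_induction with
    | tmul a b =>
      simp only [tensorAct_tmul, TensorProduct.comm_tmul, LinearMap.rTensor_tmul, tmk, smul_proj]
      generalize comul (R := k) a = Y
      induction Y using tensor_induction with
      | tmul a c =>
        rw [TensorProduct.assoc_tmul, hQ]
        exact assocInv_tmk _ _ _
      | add x y hx hy => simp only [LinearMap.map_add, LinearEquiv.map_add, tensorAct_add, tensorActR_add, tensorActL_add, LinearMap.add_apply, add_tmul, tmul_add, hx, hy]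
    | add x y hx hy => simp only [LinearMap.map_add, LinearEquiv.map_add, tensorAct_add, tensorActR_add, tensorActL_add, LinearMap.add_apply, hx, hy]
  have e3 : ∀ (b c : H) (Y : H ⊗[k] H), tmk (proj k H W U
      (TensorProduct.comm k U W (tensorAct k H U W Y (u ⊗ₜ (c • w))))) (b • v) =
      Q ((TensorProduct.mk k H H 1).lTensor H Y * (1 ⊗ₜ (b ⊗ₜ c))) := by
    intro a b Y
    induction Y using tensor_induction with
    | tmul c d =>
      simp only [LinearMap.lTensor_tmul, TensorProduct.mk_apply, Algebra.TensorProduct.tmul_mul_tmul,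
        one_mul, mul_one, hQ, mul_smul]
      rfl
    | add x y hx hy =>
      simp only [tmk] at hx hy ⊢
      simp only [LinearMap.map_add, LinearEquiv.map_add, tensorAct_add, tensorActR_add, tensorActL_add, LinearMap.add_apply, add_tmul, add_mul, hx, hy]
  have e2 : ∀ X : H ⊗[k] H, map (braid (k := k) (H := H)) LinearMap.id (assocInv (tmk u
      (proj k H W V (TensorProduct.comm k V W (tensorAct k H V W X (v ⊗ₜ w)))))) =
      Q ((TensorProduct.mk k H H 1).lTensor H R * (1 ⊗ₜ X)) := by
    intro X
    induction X using tensor_induction with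
    | tmul a b =>
      change map braid LinearMap.id (assocInv (tmk _ (tmk _ _))) = _
      rw [assocInv_tmk, map_tmk, braid_tmk]
      exact e3 _ _ _
    | add x y hx hy =>
      simp only [tmk] at hx hy ⊢
      simp only [LinearMap.map_add, LinearEquiv.map_add, tensorAct_add, tensorActR_add, tensorActL_add, LinearMap.add_apply, tmul_add, mul_add, hx, hy]
  simp only [LinearMap.comp_apply, map_tmk, assocInv_tmk, braid_tmk, LinearMap.id_apply]
  rw [e1, comul_rTensor_R, e2]

end quasitriangular
end TensorT

end Tens

namespace TensorT
variable {k : Type v} {H : Type u} {T U V W U' V' W' U'' V'' : Type*} [Field k] [Ring H] [Algebra k H]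
  [QuantumGroupoid k H]
  [AddCommGroup T] [Module k T] [Module H T] [IsScalarTower k H T]
  [AddCommGroup U] [Module k U] [Module H U] [IsScalarTower k H U]
  [AddCommGroup V] [Module k V] [Module H V] [IsScalarTower k H V]
  [AddCommGroup W] [Module k W] [Module H W] [IsScalarTower k H W]
  [AddCommGroup U'] [Module k U'] [Module H U'] [IsScalarTower k H U']
  [AddCommGroup V'] [Module k V'] [Module H V'] [IsScalarTower k H V']
  [AddCommGroup W'] [Module k W'] [Module H W'] [IsScalarTower k H W']
  [AddCommGroup U''] [Module k U''] [Module H U''] [IsScalarTower k H U'']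
  [AddCommGroup V''] [Module k V''] [Module H V''] [IsScalarTower k H V'']

theorem map_id_id :
    map (k := k) (LinearMap.id (R := H) (M := U)) (LinearMap.id (R := H) (M := V)) =
      LinearMap.id :=
  hom_ext fun v w => by simp

theorem map_comp (f : U →ₗ[H] U') (g : V →ₗ[H] V') (f' : U' →ₗ[H] U'') (g' : V' →ₗ[H] V'') :
    map (k := k) (f' ∘ₗ f) (g' ∘ₗ g) = map f' g' ∘ₗ map f g :=
  hom_ext fun v w => by simp

theorem map_eq_comp (f : U →ₗ[H] U') (g : V →ₗ[H] V') :
    map (k := k) f g = map LinearMap.id g ∘ₗ map f LinearMap.id :=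
  hom_ext fun v w => by simp

theorem assoc_naturality (f : U →ₗ[H] U') (g : V →ₗ[H] V') (h : W →ₗ[H] W') :
    assocHom ∘ₗ map (k := k) (map (k := k) f g) h = map f (map g h) ∘ₗ assocHom :=
  hom_ext₃ fun u v w => by simp

theorem leftUnit_naturality (f : U →ₗ[H] V) :
    leftUnit ∘ₗ map (k := k) LinearMap.id f = f ∘ₗ leftUnit :=
  hom_ext fun v w => by simp [leftUnit_tmk]

theorem rightUnit_naturality (f : U →ₗ[H] V) :
    rightUnit ∘ₗ map (k := k) f LinearMap.id = f ∘ₗ rightUnit :=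
  hom_ext fun v w => by simp [rightUnit_tmk]

theorem pentagon_eq : (map LinearMap.id assocHom ∘ₗ assocHom) ∘ₗ
    map (assocHom (k := k) (H := H) (U := T) (V := U) (W := V)) (LinearMap.id (M := W)) =
      assocHom ∘ₗ assocHom :=
  hom_ext₄ fun t u v w => by simp

theorem triangle_eq : map LinearMap.id leftUnit ∘ₗ
    assocHom (k := k) (H := H) (U := U) (V := TargetSpace k H) (W := V) =
      map rightUnit LinearMap.id :=
  hom_ext₃ fun v z w => by simp [leftUnit_tmk, rightUnit_tmk, tmk_target_smul]

end TensorT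

/-- An object of the category of left `H`-modules. The `k`-vector space structure is the one
induced from the `H`-module structure (`isScalarTower`). -/
structure LeftMod (k : Type v) (H : Type u) [Field k] [Ring H] [Algebra k H] where
  carrier : Type u
  [addCommGroup : AddCommGroup carrier]
  [moduleBase : Module k carrier]
  [module : Module H carrier]
  [isScalarTower : IsScalarTower k H carrier]

attribute [instance] LeftMod.addCommGroup LeftMod.moduleBase LeftMod.module LeftMod.isScalarTower

namespace LeftMod
open CategoryTheory

section
variable {k : Type v} {H : Type u} [Field k] [Ring H] [Algebra k H]

/-- A morphism of left `H`-modules. -/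
@[ext] structure Hom (V W : LeftMod k H) where
  lin : V.carrier →ₗ[H] W.carrier

instance : Category (LeftMod k H) where
  Hom V W := Hom V W
  id _ := ⟨LinearMap.id⟩
  comp f g := ⟨g.lin ∘ₗ f.lin⟩

@[ext] theorem hom_ext {V W : LeftMod k H} {f g : V ⟶ W} (h : f.lin = g.lin) : f = g := Hom.ext h
@[simp] theorem id_lin (V : LeftMod k H) : Hom.lin (𝟙 V) = LinearMap.id := rfl
@[simp] theorem comp_lin {U V W : LeftMod k H} (f : U ⟶ V) (g : V ⟶ W) :
    (f ≫ g).lin = g.lin ∘ₗ f.lin := rfl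

/-- Linear bijections are isomorphisms. -/
def mkIso {V W : LeftMod k H} (f : V.carrier →ₗ[H] W.carrier) (g : W.carrier →ₗ[H] V.carrier)
    (hfg : ∀ x, g (f x) = x) (hgf : ∀ x, f (g x) = x) : V ≅ W where
  hom := ⟨f⟩
  inv := ⟨g⟩
  hom_inv_id := by ext x; exact hfg x
  inv_hom_id := by ext x; exact hgf x

end

section monoidal
variable {k : Type v} {H : Type u} [Field k] [Ring H] [Algebra k H] [QuantumGroupoid k H]
open TensorT MonoidalCategory

/-- The tensor product `⊗_t` with unit object `H_t`. -/
noncomputable instance : MonoidalCategoryStruct (LeftMod k H) where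
  tensorObj V W := ⟨TensorT k H V.carrier W.carrier⟩
  whiskerLeft _ _ _ f := ⟨TensorT.map LinearMap.id f.lin⟩
  whiskerRight f _ := ⟨TensorT.map f.lin LinearMap.id⟩
  tensorHom f g := ⟨TensorT.map f.lin g.lin⟩
  tensorUnit := ⟨TargetSpace k H⟩
  associator _ _ _ := mkIso assocHom assocInv
    assocInv_assocHom assocHom_assocInv
  leftUnitor V := mkIso (leftUnitEquiv k H V.carrier).toLinearMap
    (leftUnitEquiv k H V.carrier).symm.toLinearMap
    (leftUnitEquiv k H V.carrier).symm_apply_apply (leftUnitEquiv k H V.carrier).apply_symm_apply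
  rightUnitor V := mkIso (rightUnitEquiv k H V.carrier).toLinearMap
    (rightUnitEquiv k H V.carrier).symm.toLinearMap
    (rightUnitEquiv k H V.carrier).symm_apply_apply
    (rightUnitEquiv k H V.carrier).apply_symm_apply

theorem tensorHom_lin {V V' W W' : LeftMod k H} (f : V ⟶ V') (g : W ⟶ W') :
    (f ⊗ₘ g).lin = TensorT.map f.lin g.lin := rfl
theorem whiskerLeft_lin {V W W' : LeftMod k H} (g : W ⟶ W') :
    (V ◁ g).lin = TensorT.map LinearMap.id g.lin := rfl
theorem whiskerRight_lin {V V' W : LeftMod k H} (f : V ⟶ V') :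
    (f ▷ W).lin = TensorT.map f.lin LinearMap.id := rfl
theorem associator_lin (U V W : LeftMod k H) : (α_ U V W).hom.lin = assocHom := rfl
theorem associator_inv_lin (U V W : LeftMod k H) : (α_ U V W).inv.lin = assocInv := rfl
theorem leftUnitor_lin (V : LeftMod k H) : (λ_ V).hom.lin = leftUnit := rfl
theorem rightUnitor_lin (V : LeftMod k H) : (ρ_ V).hom.lin = rightUnit := rfl

noncomputable instance : MonoidalCategory (LeftMod k H) where
  tensorHom_def f g := hom_ext (map_eq_comp f.lin g.lin)
  id_tensorHom_id _ _ := hom_ext map_id_id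
  tensorHom_comp_tensorHom f g f' g' := hom_ext (TensorT.map_comp f.lin g.lin f'.lin g'.lin).symm
  whiskerLeft_id _ _ := hom_ext map_id_id
  id_whiskerRight _ _ := hom_ext map_id_id
  associator_naturality f g h := hom_ext (assoc_naturality f.lin g.lin h.lin)
  leftUnitor_naturality f := hom_ext (leftUnit_naturality f.lin)
  rightUnitor_naturality f := hom_ext (rightUnit_naturality f.lin)
  pentagon _ _ _ _ := hom_ext pentagon_eq
  triangle _ _ := hom_ext triangle_eq

end monoidal

section braided
variable {k : Type v} {H : Type u} [Field k] [Ring H] [Algebra k H]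
  [QuasitriangularQuantumGroupoid k H]
open TensorT MonoidalCategory

/-- The braiding `Ψ(v ⊗_t w) = R⁽²⁾ w ⊗_t R⁽¹⁾ v`. -/
noncomputable instance : BraidedCategory (LeftMod k H) where
  braiding _ _ := mkIso braid braidInv braidInv_braid braid_braidInv
  braiding_naturality_right _ _ _ f := hom_ext (braid_naturality LinearMap.id f.lin)
  braiding_naturality_left f _ := hom_ext (braid_naturality f.lin LinearMap.id)
  hexagon_forward _ _ _ := hom_ext hexagon_forward
  hexagon_reverse _ _ _ := hom_ext hexagon_reverse

theorem braiding_lin (V W : LeftMod k H) : (β_ V W).hom.lin = braid := rfl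

end braided
end LeftMod

section Adjoint
variable (k : Type v) (H : Type u) [Field k] [Ring H] [Algebra k H] [QuantumGroupoid k H]
open QuantumGroupoid

/-- The linear map `x ⊗ y ↦ (g ↦ x g S(y))`. -/
noncomputable def sandwich : H ⊗[k] H →ₗ[k] H →ₗ[k] H :=
  TensorProduct.lift ((LinearMap.mul k (Module.End k H)).compl₁₂ (LinearMap.mul k H)
    ((LinearMap.mul k H).flip ∘ₗ antipode))

variable {k H} in
theorem sandwich_tmul (x y g : H) :
    sandwich k H (x ⊗ₜ y) g = x * (g * antipode (k := k) y) := rfl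

/-- The adjoint action `Ad_h (g) = h₁ g S(h₂)`. -/
noncomputable def adjoint : H →ₗ[k] H →ₗ[k] H := sandwich k H ∘ₗ comul

variable {k H} in
theorem adjoint_apply (h g : H) : adjoint k H h g = sandwich k H (comul (R := k) h) g := rfl

variable {k H} in
theorem sandwich_mul (X Y : H ⊗[k] H) (g : H) :
    sandwich k H (X * Y) g = sandwich k H X (sandwich k H Y g) := by
  induction X using tensor_induction with
  | tmul a b =>
    induction Y using tensor_induction with
    | tmul c d => simp [sandwich_tmul, antipode_mul, mul_assoc]
    | add x y hx hy => simp only [map_add, mul_add, LinearMap.add_apply, hx, hy]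
  | add x y hx hy => simp only [map_add, add_mul, LinearMap.add_apply, hx, hy]

variable {k H} in
theorem adjoint_mul (g h a : H) : adjoint k H (g * h) a = adjoint k H g (adjoint k H h a) := by
  simp only [adjoint_apply, WeakBialgebra.comul_mul, sandwich_mul]

/-- The centralizer `C_H(H_s)` of the source space. -/
def SourceCentralizer : Type u :=
  ↥(Subalgebra.centralizer k (Set.range (sourceMap k (H := H))))

namespace SourceCentralizer

noncomputable instance : AddCommGroup (SourceCentralizer k H) :=
  inferInstanceAs
    (AddCommGroup ↥(Subalgebra.centralizer k (Set.range (sourceMap k (H := H)))))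
noncomputable instance : Module k (SourceCentralizer k H) :=
  inferInstanceAs
    (Module k ↥(Subalgebra.centralizer k (Set.range (sourceMap k (H := H)))))

/-- The inclusion `C_H(H_s) → H`. -/
noncomputable def incl : SourceCentralizer k H →ₗ[k] H :=
  (Subalgebra.centralizer k (Set.range (sourceMap k (H := H)))).val.toLinearMap

variable {k H}

theorem incl_injective : Function.Injective (incl k H) := Subtype.val_injective

theorem incl_mem (c : SourceCentralizer k H) (y : H) :
    sourceMap k y * incl k H c = incl k H c * sourceMap k y :=
  (Subalgebra.mem_centralizer_iff k).1 c.2 _ ⟨y, rfl⟩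

theorem adjoint_mem (h g : H) :
    adjoint k H h g ∈ Subalgebra.centralizer k (Set.range (sourceMap k (H := H))) := by
  rw [Subalgebra.mem_centralizer_iff]
  rintro _ ⟨y, rfl⟩
  obtain ⟨z, hz⟩ := exists_target_of_source (k := k) y
  have e1 : ∀ (a : H) (X : H ⊗[k] H), sandwich k H ((a ⊗ₜ 1) * X) g = a * sandwich k H X g := by
    intro a X
    induction X using tensor_induction with
    | tmul c d => simp [sandwich_tmul, mul_assoc]
    | add x y hx hy => simp only [map_add, mul_add, LinearMap.add_apply, hx, hy]
  have e2 : ∀ (a : H) (X : H ⊗[k] H), sandwich k H ((1 ⊗ₜ a) * X) g =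
      sandwich k H X g * antipode (k := k) a := by
    intro a X
    induction X using tensor_induction with
    | tmul c d => simp [sandwich_tmul, antipode_mul, mul_assoc]
    | add x y hx hy => simp only [map_add, mul_add, add_mul, LinearMap.add_apply, hx, hy]
  rw [adjoint_apply, hz, ← e1, ← e2, antipode_target_mul_comul]

theorem adjoint_one (c : SourceCentralizer k H) :
    adjoint k H 1 (incl k H c) = incl k H c := by
  have e : ∀ X : H ⊗[k] H, sandwich k H ((sourceMap k).rTensor H X) (incl k H c) =
      incl k H c * LinearMap.mul' k H (TensorProduct.map LinearMap.id (antipode (k := k))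
        ((sourceMap k).rTensor H X)) := by
    intro X
    induction X using tensor_induction with
    | tmul a b =>
      simp only [LinearMap.rTensor_tmul, sandwich_tmul, ← mul_assoc, incl_mem]
      simp [mul_assoc]
    | add x y hx hy => simp only [map_add, mul_add, LinearMap.add_apply, hx, hy]
  have := e (comul 1)
  rw [comul_one_source, ← targetMap_apply, targetMap_one, mul_one] at this
  exact this

/-- The action of `H` on `C_H(H_s)` is the adjoint action. -/
noncomputable instance : SMul H (SourceCentralizer k H) where
  smul h c := ⟨adjoint k H h (incl k H c), adjoint_mem h _⟩

theorem incl_smul (h : H) (c : SourceCentralizer k H) :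
    incl k H (h • c) = adjoint k H h (incl k H c) := rfl

noncomputable instance : Module H (SourceCentralizer k H) where
  one_smul c := incl_injective (by rw [incl_smul, adjoint_one])
  mul_smul g h c := incl_injective (by simp only [incl_smul, adjoint_mul])
  smul_zero h := incl_injective (by simp [incl_smul])
  smul_add h x y := incl_injective (by simp [incl_smul])
  add_smul g h x := incl_injective (by simp [incl_smul])
  zero_smul x := incl_injective (by simp [incl_smul])

instance : IsScalarTower k H (SourceCentralizer k H) where
  smul_assoc a h x := incl_injective (by simp [incl_smul])

variable (k H) in
/-- `C_H(H_s)` as an object of the category of left `H`-modules. -/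
noncomputable def obj : LeftMod k H := ⟨SourceCentralizer k H⟩

end SourceCentralizer
end Adjoint

section Formulas
variable (k : Type v) (H : Type u) [Field k] [Ring H] [Algebra k H]
  [QuasitriangularQuantumGroupoid k H]
open QuantumGroupoid QuasitriangularQuantumGroupoid

/-- `g ↦ g₁ S(R⁽²⁾) ⊗ Ad_{R⁽¹⁾}(g₂)`, as an element of `H ⊗ H`. -/
noncomputable def braidedComul (g : H) : H ⊗[k] H :=
  TensorProduct.map₂ ((LinearMap.mul k H).compl₂ antipode) (adjoint k H).flip
    (comul g) (TensorProduct.comm k H H R)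

/-- `g ↦ R⁽²⁾ S(Ad_{R⁽¹⁾}(g))`. -/
noncomputable def braidedAntipode (g : H) : H :=
  LinearMap.mul' k H (TensorProduct.map LinearMap.id (antipode ∘ₗ (adjoint k H).flip g)
    (TensorProduct.comm k H H R))

theorem map₂_tmul_comm (a b c d : H) :
    TensorProduct.map₂ ((LinearMap.mul k H).compl₂ antipode) (adjoint k H).flip
      (a ⊗ₜ b) (TensorProduct.comm k H H (c ⊗ₜ d)) =
      (a * antipode (k := k) d) ⊗ₜ adjoint k H c b := rfl

theorem mul_map_comm (g a b : H) :
    LinearMap.mul' k H (TensorProduct.map LinearMap.id (antipode ∘ₗ (adjoint k H).flip g)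
      (TensorProduct.comm k H H (a ⊗ₜ b))) = b * antipode (k := k) (adjoint k H a g) := rfl

end Formulas

end Defs

section QuasitriangularQuantumGroupoid
open scoped TensorProduct
open TensorProduct Coalgebra

/-! Write `C` for `C_H(H_s)`. Over a field a tensor product of injective maps is injective, so
elements of `C ⊗_t C` and of its iterates may be compared inside tensor powers of `H`
(`incl₂_injective`, `map_incl₂_injective`). Each axiom thereby becomes an identity between Sweedler
sums in `H`, and the sums are handled by a small calculus (`sweedler`, `IsLin`).

Compared with a Hopf algebra, what is new is `Δ(1)`. Its legs may be taken in `H_s` and `H_t`, which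
commute (`sweedler_one_congr`), and elements of `H_s` and `H_t` pass between the legs of a coproduct
and of `R`. The operator `Ad_1` projects `H` onto `C`, and for `g` in `C` the second leg of `Δ(g)`
may be taken in `C` (`sweedler_comul_congr`). Two identities make the adjoint action work on `C`:
`S(h₁) Ad_{h₂}(g) = g S(h)` and, as a consequence, `Ad_{h₁}(a) Ad_{h₂}(b) = Ad_h(ab)`.

Equivariance of the comultiplication and of the antipode comes from `Δᵒᵖ(h) R = R Δ(h)` together
with anti-comultiplicativity of `S` (`comul_antipode`). At `h = 1` it also shows that their values
lie in `C ⊗_t C` and in `C`.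

The remaining axioms come from the two coproduct formulas for `R`. In `braidedComul_coassoc` both
sides reduce to one sum over three copies of `R`. In `braidedComul_mul` the copy of `R` in the
comultiplication of `g` merges with the braiding. The counit axioms use the values of `ε_s` and
`ε_t` on one leg of `R`. The antipode axiom with the antipode on the second factor collapses through
`S(y₁) y₂ = ε_s(y)`. The one with the antipode on the first factor is harder: there the antipode is
rewritten as `R⁽²⁾ u S(g) S(R⁽¹⁾)` with `u = R⁽²⁾ S²(R⁽¹⁾)`, and `u S²(x) = x u` removes the squared
antipode (`braidedAntipode_eq`, `drinfeldInv_mul`). -/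

/-- Linearity of unbundled functions, as a property that `fun_prop` can prove. -/
@[fun_prop] def IsLin (k : Type*) {M N : Type*} [Field k] [AddCommGroup M] [AddCommGroup N]
    [Module k M] [Module k N] (f : M → N) : Prop := IsLinearMap k f

/-- The sum `∑ F a b` over a representation `X = ∑ a ⊗ b`; it is independent of the representation
when `F` is bilinear. -/
noncomputable def sweedler {k M N V : Type*} [Field k] [AddCommGroup M] [AddCommGroup N]
    [AddCommGroup V] [Module k M] [Module k N] (X : M ⊗[k] N) (F : M → N → V) : V :=
  ∑ i ∈ (TensorProduct.exists_finset X).choose, F i.1 i.2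

/-! ### Sweedler notation as a calculus of finite sums -/

section Calculus
variable {k M N P Q V W : Type*} [Field k] [AddCommGroup M] [AddCommGroup N] [AddCommGroup P]
  [AddCommGroup Q] [AddCommGroup V] [AddCommGroup W] [Module k M] [Module k N] [Module k P]
  [Module k Q] [Module k V] [Module k W]

namespace IsLin

@[fun_prop] theorem id : IsLin k (fun x : M => x) := ⟨fun _ _ => rfl, fun _ _ => rfl⟩

@[fun_prop] theorem comp {g : N → P} {f : M → N} (hg : IsLin k g) (hf : IsLin k f) :
    IsLin k (fun x => g (f x)) :=
  ⟨fun x y => by rw [IsLinearMap.map_add hf, IsLinearMap.map_add hg],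
    fun c x => by rw [IsLinearMap.map_smul hf, IsLinearMap.map_smul hg]⟩

@[fun_prop] theorem map (φ : N →ₗ[k] P) : IsLin k (fun x => φ x) := φ.isLinear

@[fun_prop] theorem comul {H : Type*} [AddCommGroup H] [Module k H] [Coalgebra k H] :
    IsLin k (fun x : H => Coalgebra.comul (R := k) x) := (Coalgebra.comul (R := k)).isLinear

@[fun_prop] theorem counit {H : Type*} [AddCommGroup H] [Module k H] [Coalgebra k H] :
    IsLin k (fun x : H => Coalgebra.counit (R := k) x) := (Coalgebra.counit (R := k)).isLinear

@[fun_prop] theorem equiv (φ : N ≃ₗ[k] P) : IsLin k (fun x => φ x) := φ.toLinearMap.isLinear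

@[fun_prop] theorem map_apply (φ : M →ₗ[k] N →ₗ[k] P) {f : Q → M} (hf : IsLin k f) (b : N) :
    IsLin k (fun x => φ (f x) b) := comp (φ.flip b).isLinear hf

@[fun_prop] theorem mul_const {H : Type*} [Ring H] [Algebra k H] {f : M → H} (hf : IsLin k f)
    (c : H) : IsLin k (fun x => f x * c) := comp (LinearMap.mulRight k c).isLinear hf

@[fun_prop] theorem const_mul {H : Type*} [Ring H] [Algebra k H] {f : M → H} (hf : IsLin k f)
    (c : H) : IsLin k (fun x => c * f x) := comp (LinearMap.mulLeft k c).isLinear hf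

@[fun_prop] theorem tmul_const {f : M → N} (hf : IsLin k f) (c : P) :
    IsLin k (fun x => f x ⊗ₜ[k] c) :=
  comp (g := fun y : N => y ⊗ₜ[k] c) ((TensorProduct.mk k N P).flip c).isLinear hf

@[fun_prop] theorem const_tmul {f : M → N} (hf : IsLin k f) (c : P) :
    IsLin k (fun x => c ⊗ₜ[k] f x) :=
  comp (g := fun y : N => c ⊗ₜ[k] y) (TensorProduct.mk k P N c).isLinear hf

@[fun_prop] theorem smul_const {f : M → k} (hf : IsLin k f) (c : P) :
    IsLin k (fun x => f x • c) := comp (LinearMap.toSpanSingleton k P c).isLinear hf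

@[fun_prop] theorem const_smul {f : M → P} (hf : IsLin k f) (c : k) :
    IsLin k (fun x => c • f x) := comp (LinearMap.lsmul k P c).isLinear hf

-- The chosen representation of `X` stays fixed, so no bilinearity in the summation variables is
-- needed. A parameter inside the tensor itself is the business of `IsLin.sweedler_arg`, where
-- bilinearity is required.
@[fun_prop] theorem sweedler_fun (X : M ⊗[k] N) {F : P → M → N → V}
    (hF : ∀ a b, IsLin k (fun x => F x a b)) : IsLin k (fun x => sweedler X (F x)) :=
  ⟨fun x y => by
    simp only [sweedler, ← Finset.sum_add_distrib]
    exact Finset.sum_congr rfl fun i _ => IsLinearMap.map_add (hF _ _) x y,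
   fun c x => by
    simp only [sweedler, Finset.smul_sum]
    exact Finset.sum_congr rfl fun i _ => IsLinearMap.map_smul (hF _ _) c x⟩

end IsLin

/-- A function which is linear in both arguments, as a bilinear map. -/
def bilinOf (F : M → N → V) (h₁ : ∀ b, IsLin k (fun a => F a b)) (h₂ : ∀ a, IsLin k (fun b => F a b)) :
    M →ₗ[k] N →ₗ[k] V :=
  LinearMap.mk₂ k F (fun x y b => (h₁ b).map_add x y) (fun c x b => (h₁ b).map_smul c x)
    (fun a x y => (h₂ a).map_add x y) (fun c a x => (h₂ a).map_smul c x)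

theorem eq_sweedler (X : M ⊗[k] N) : X = sweedler X (fun a b => a ⊗ₜ b) :=
  (TensorProduct.exists_finset X).choose_spec

theorem map_sweedler {G : Type*} [FunLike G V W] [AddMonoidHomClass G V W] (φ : G) (X : M ⊗[k] N)
    (F : M → N → V) : φ (sweedler X F) = sweedler X (fun a b => φ (F a b)) :=
  map_sum φ _ _

theorem IsLin.sweedler_out {f : V → W} (hf : IsLin k f) (X : M ⊗[k] N) (F : M → N → V) :
    f (sweedler X F) = sweedler X (fun a b => f (F a b)) :=
  map_sweedler (IsLinearMap.mk' f hf) X F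

theorem lift_eq_sweedler (φ : M →ₗ[k] N →ₗ[k] V) (X : M ⊗[k] N) :
    TensorProduct.lift φ X = sweedler X (fun a b => φ a b) := by
  conv_lhs => rw [eq_sweedler X, map_sweedler]
  rfl

/-- Bilinearity removes the dependence on the chosen representation: the sum is the value of the map
given by the universal property. The rules that change the tensor under the sum rest on this,
whereas pushing maps through a sum or exchanging two sums needs no linearity of the summand. -/
theorem sweedler_eq_lift {F : M → N → V} (h₁ : ∀ b, IsLin k (fun a => F a b) := by fun_prop)
    (h₂ : ∀ a, IsLin k (fun b => F a b) := by fun_prop) (X : M ⊗[k] N) :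
    sweedler X F = TensorProduct.lift (bilinOf F h₁ h₂) X := by
  rw [lift_eq_sweedler]; rfl

theorem sweedler_tmul {F : M → N → V} (a : M) (b : N)
    (h₁ : ∀ b, IsLin k (fun a => F a b) := by fun_prop)
    (h₂ : ∀ a, IsLin k (fun b => F a b) := by fun_prop) :
    sweedler (a ⊗ₜ[k] b) F = F a b := by
  rw [sweedler_eq_lift h₁ h₂]; rfl

@[fun_prop] theorem IsLin.sweedler_arg {f : P → M ⊗[k] N} {F : M → N → V} (hf : IsLin k f)
    (h₁ : ∀ b, IsLin k (fun a => F a b)) (h₂ : ∀ a, IsLin k (fun b => F a b)) :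
    IsLin k (fun x => sweedler (f x) F) := by
  simp only [sweedler_eq_lift h₁ h₂]
  fun_prop

theorem sweedler_swap (X : M ⊗[k] N) (Y : P ⊗[k] Q) (F : M → N → P → Q → V) :
    sweedler X (fun a b => sweedler Y (fun c d => F a b c d)) =
      sweedler Y (fun c d => sweedler X (fun a b => F a b c d)) :=
  Finset.sum_comm

theorem mul_sweedler {A : Type*} [Ring A] (c : A) (X : M ⊗[k] N) (F : M → N → A) :
    c * sweedler X F = sweedler X (fun a b => c * F a b) := Finset.mul_sum _ _ _

theorem sweedler_mul {A : Type*} [Ring A] (c : A) (X : M ⊗[k] N) (F : M → N → A) :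
    sweedler X F * c = sweedler X (fun a b => F a b * c) := Finset.sum_mul _ _ _

theorem tmul_sweedler (c : P) (X : M ⊗[k] N) (F : M → N → V) :
    c ⊗ₜ[k] sweedler X F = sweedler X (fun a b => c ⊗ₜ F a b) := TensorProduct.tmul_sum _ _ _

theorem sweedler_tmul_const (c : P) (X : M ⊗[k] N) (F : M → N → V) :
    sweedler X F ⊗ₜ[k] c = sweedler X (fun a b => F a b ⊗ₜ c) := TensorProduct.sum_tmul _ _ _

theorem smul_sweedler (c : k) (X : M ⊗[k] N) (F : M → N → V) :
    c • sweedler X F = sweedler X (fun a b => c • F a b) := Finset.smul_sum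

theorem sweedler_mul_tensor {A B : Type*} [Ring A] [Ring B] [Algebra k A] [Algebra k B]
    (X Y : A ⊗[k] B) {F : A → B → V} (h₁ : ∀ b, IsLin k (fun a => F a b) := by fun_prop)
    (h₂ : ∀ a, IsLin k (fun b => F a b) := by fun_prop) :
    sweedler (X * Y) F = sweedler X (fun a b => sweedler Y (fun c d => F (a * c) (b * d))) := by
  conv_lhs => rw [eq_sweedler X, eq_sweedler Y]
  simp only [mul_sweedler, sweedler_mul, Algebra.TensorProduct.tmul_mul_tmul]
  rw [sweedler_swap, sweedler_eq_lift h₁ h₂]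
  simp only [map_sweedler]
  rfl

/-- Expanding a tensor that is itself given by a sum. -/
theorem sweedler_sweedler (X : P ⊗[k] Q) (G : P → Q → M ⊗[k] N) {F : M → N → V}
    (h₁ : ∀ b, IsLin k (fun a => F a b) := by fun_prop)
    (h₂ : ∀ a, IsLin k (fun b => F a b) := by fun_prop) :
    sweedler (sweedler X G) F = sweedler X (fun a b => sweedler (G a b) F) := by
  simp only [sweedler_eq_lift h₁ h₂, map_sweedler]

theorem sweedler_map (f : M →ₗ[k] P) (g : N →ₗ[k] Q) (X : M ⊗[k] N) {F : P → Q → V}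
    (h₁ : ∀ b, IsLin k (fun a => F a b) := by fun_prop)
    (h₂ : ∀ a, IsLin k (fun b => F a b) := by fun_prop) :
    sweedler (TensorProduct.map f g X) F = sweedler X (fun a b => F (f a) (g b)) := by
  conv_lhs => rw [eq_sweedler X, map_sweedler, sweedler_sweedler _ _ h₁ h₂]
  simp only [map_tmul, sweedler_tmul _ _ h₁ h₂]

theorem sweedler_tensorComm (X : M ⊗[k] N) {F : N → M → V}
    (h₁ : ∀ b, IsLin k (fun a => F a b) := by fun_prop)
    (h₂ : ∀ a, IsLin k (fun b => F a b) := by fun_prop) :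
    sweedler (TensorProduct.comm k M N X) F = sweedler X (fun a b => F b a) := by
  conv_lhs => rw [eq_sweedler X, map_sweedler, sweedler_sweedler _ _ h₁ h₂]
  simp only [comm_tmul, sweedler_tmul _ _ h₁ h₂]

theorem sweedler_assoc (X : (M ⊗[k] N) ⊗[k] P) {F : M → N → P → V}
    (h₁ : ∀ b c, IsLin k (fun a => F a b c) := by fun_prop)
    (h₂ : ∀ a c, IsLin k (fun b => F a b c) := by fun_prop)
    (h₃ : ∀ a b, IsLin k (fun c => F a b c) := by fun_prop) :
    sweedler (TensorProduct.assoc k M N P X) (fun a Y => sweedler Y (fun b c => F a b c)) =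
      sweedler X (fun Y c => sweedler Y (fun a b => F a b c)) := by
  conv_lhs => rw [eq_sweedler X, map_sweedler, sweedler_sweedler]
  congr 1; ext Y c
  conv_lhs => rw [eq_sweedler Y, sweedler_tmul_const, map_sweedler, sweedler_sweedler]
  congr 1; ext a b
  rw [assoc_tmul, sweedler_tmul, sweedler_tmul]

end Calculus

/-! ### Coassociativity and counit laws for Sweedler sums -/

section CoalgebraSums
variable {k H V : Type*} [Field k] [AddCommGroup H] [Module k H] [Coalgebra k H] [AddCommGroup V]
  [Module k V]

theorem sweedler_coassoc (h : H) {F : H → H → H → V}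
    (h₁ : ∀ b c, IsLin k (fun a => F a b c) := by fun_prop)
    (h₂ : ∀ a c, IsLin k (fun b => F a b c) := by fun_prop)
    (h₃ : ∀ a b, IsLin k (fun c => F a b c) := by fun_prop) :
    sweedler (comul (R := k) h) (fun a b => sweedler (comul (R := k) a) fun c d => F c d b) =
      sweedler (comul (R := k) h) (fun a b => sweedler (comul (R := k) b) fun c d => F a c d) := by
  have e₁ := sweedler_assoc (comul.rTensor H (comul (R := k) h)) h₁ h₂ h₃
  rw [coassoc_apply, LinearMap.lTensor, LinearMap.rTensor, sweedler_map, sweedler_map] at e₁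
  exact e₁.symm

theorem sweedler_counit_left (h : H) {f : H → V} (hf : IsLin k f := by fun_prop) :
    sweedler (comul (R := k) h) (fun a b => counit (R := k) a • f b) = f h := by
  have e := congrArg (fun X => sweedler X fun (a : k) (b : H) => a • f b)
    (rTensor_counit_comul (R := k) h)
  rwa [LinearMap.rTensor, sweedler_map, sweedler_tmul, one_smul] at e

theorem sweedler_counit_right (h : H) {f : H → V} (hf : IsLin k f := by fun_prop) :
    sweedler (comul (R := k) h) (fun a b => counit (R := k) b • f a) = f h := by
  have e := congrArg (fun X => sweedler X fun (a : H) (b : k) => b • f a)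
    (lTensor_counit_comul (R := k) h)
  rwa [LinearMap.lTensor, sweedler_map, sweedler_tmul, one_smul] at e

end CoalgebraSums

/-! ### Weak bialgebras: the legs of `Δ(1)`, source and target elements -/

section WeakSums
open WeakBialgebra
variable {k H V : Type*} [Field k] [Ring H] [Algebra k H] [AddCommGroup V] [Module k V]

theorem sweedler_tmul_mul (X : H ⊗[k] H) (c d : H) {F : H → H → V}
    (h₁ : ∀ b, IsLin k (fun a => F a b) := by fun_prop)
    (h₂ : ∀ a, IsLin k (fun b => F a b) := by fun_prop) :
    sweedler ((c ⊗ₜ d) * X) F = sweedler X fun a b => F (c * a) (d * b) := by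
  rw [sweedler_mul_tensor, sweedler_tmul]

theorem sweedler_mul_tmul (X : H ⊗[k] H) (c d : H) {F : H → H → V}
    (h₁ : ∀ b, IsLin k (fun a => F a b) := by fun_prop)
    (h₂ : ∀ a, IsLin k (fun b => F a b) := by fun_prop) :
    sweedler (X * (c ⊗ₜ d)) F = sweedler X fun a b => F (a * c) (b * d) := by
  rw [sweedler_mul_tensor]
  congr 1; ext a b
  rw [sweedler_tmul]

variable [WeakBialgebra k H]

theorem sweedler_comul_mul (g h : H) {F : H → H → V}
    (h₁ : ∀ b, IsLin k (fun a => F a b) := by fun_prop)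
    (h₂ : ∀ a, IsLin k (fun b => F a b) := by fun_prop) :
    sweedler (comul (R := k) (g * h)) F = sweedler (comul (R := k) g) fun a b =>
      sweedler (comul (R := k) h) fun c d => F (a * c) (b * d) := by
  rw [comul_mul, sweedler_mul_tensor]

theorem targetMap_eq_sweedler (h : H) : targetMap k h =
    sweedler (comul (R := k) (1 : H)) fun a b => counit (R := k) (a * h) • b := by
  have := congrArg (fun X => TensorProduct.lid k H ((counit (R := k) (A := H)).rTensor H
    (X * (h ⊗ₜ 1)))) (eq_sweedler (comul (R := k) (1 : H)))
  refine this.trans ?_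
  simp [sweedler_mul, map_sweedler]

theorem sourceMap_eq_sweedler (h : H) : sourceMap k h =
    sweedler (comul (R := k) (1 : H)) fun a b => counit (R := k) (h * b) • a := by
  have := congrArg (fun X => TensorProduct.rid k H ((counit (R := k) (A := H)).lTensor H
    ((1 ⊗ₜ h) * X))) (eq_sweedler (comul (R := k) (1 : H)))
  refine this.trans ?_
  simp [mul_sweedler, map_sweedler]

/-- `ε_s(h₁) ⊗ h₂ = 1₁ ⊗ h 1₂`. -/
theorem sweedler_source_left (h : H) {F : H → H → V}
    (h₁ : ∀ b, IsLin k (fun a => F a b) := by fun_prop)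
    (h₂ : ∀ a, IsLin k (fun b => F a b) := by fun_prop) :
    sweedler (comul (R := k) h) (fun a b => F (sourceMap k a) b) =
      sweedler (comul (R := k) (1 : H)) fun a b => F a (h * b) := by
  have e := congrArg (fun X => sweedler X F) (sourceMap_rTensor_comul (k := k) h)
  rw [LinearMap.rTensor, sweedler_map _ _ _ h₁ h₂, sweedler_tmul_mul _ _ _ h₁ h₂] at e
  simpa using e

/-- `h₁ ⊗ ε_t(h₂) = 1₁ h ⊗ 1₂`. -/
theorem sweedler_target_right (h : H) {F : H → H → V}
    (h₁ : ∀ b, IsLin k (fun a => F a b) := by fun_prop)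
    (h₂ : ∀ a, IsLin k (fun b => F a b) := by fun_prop) :
    sweedler (comul (R := k) h) (fun a b => F a (targetMap k b)) =
      sweedler (comul (R := k) (1 : H)) fun a b => F (a * h) b := by
  have e := congrArg (fun X => sweedler X F) (targetMap_lTensor_comul (k := k) h)
  rw [LinearMap.lTensor, sweedler_map _ _ _ h₁ h₂, sweedler_mul_tmul _ _ _ h₁ h₂] at e
  simpa using e

/-- `ε_t(h₁) h₂ = h`. -/
theorem sweedler_target_mul (h : H) :
    sweedler (comul (R := k) h) (fun a b => targetMap k a * b) = h := by
  -- Expand `h = ε(h₁) h₂` and insert `Δ(1)`: the result `ε(1₁ h₁) 1₂ h₂` contains the definition of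
  -- `ε_t(h₁)`.
  conv_rhs => rw [← sweedler_counit_left (k := k) (f := fun x => x) h, ← comul_one_mul_comul,
    sweedler_mul_tensor]
  rw [sweedler_swap]
  simp only [targetMap_eq_sweedler, sweedler_mul, smul_mul_assoc]

section elements
variable {z y : H}

/-- Since `ε_t` and `ε_s` are idempotent, membership in `H_t` or `H_s` is expressed as a fixed-point
equation; no preimage has to be carried along. -/
theorem comul_target (hz : targetMap k z = z) :
    comul (R := k) z = (z ⊗ₜ 1) * comul (R := k) (1 : H) := by
  simpa [hz] using comul_targetMap (k := k) z

theorem comul_target' (hz : targetMap k z = z) :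
    comul (R := k) z = comul (R := k) (1 : H) * (z ⊗ₜ 1) := by
  simpa [hz] using comul_targetMap' (k := k) z

theorem comul_source (hy : sourceMap k y = y) :
    comul (R := k) y = comul (R := k) (1 : H) * (1 ⊗ₜ y) := by
  simpa [hy] using comul_sourceMap (k := k) y

theorem comul_source' (hy : sourceMap k y = y) :
    comul (R := k) y = (1 ⊗ₜ y) * comul (R := k) (1 : H) := by
  simpa [hy] using comul_sourceMap' (k := k) y

theorem source_mul_target (hy : sourceMap k y = y) (hz : targetMap k z = z) : y * z = z * y := by
  simpa [hy, hz] using sourceMap_mul_targetMap (k := k) y z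

theorem sweedler_comul_target_mul (hz : targetMap k z = z) (h : H) {F : H → H → V}
    (h₁ : ∀ b, IsLin k (fun a => F a b) := by fun_prop)
    (h₂ : ∀ a, IsLin k (fun b => F a b) := by fun_prop) :
    sweedler (comul (R := k) (z * h)) F = sweedler (comul (R := k) h) fun a b => F (z * a) b := by
  rw [comul_mul, comul_target hz, mul_assoc, comul_one_mul_comul, sweedler_tmul_mul]
  simp

theorem sweedler_comul_mul_target (hz : targetMap k z = z) (h : H) {F : H → H → V}
    (h₁ : ∀ b, IsLin k (fun a => F a b) := by fun_prop)
    (h₂ : ∀ a, IsLin k (fun b => F a b) := by fun_prop) :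
    sweedler (comul (R := k) (h * z)) F = sweedler (comul (R := k) h) fun a b => F (a * z) b := by
  rw [comul_mul, comul_target' hz, ← mul_assoc, comul_mul_comul_one, sweedler_mul_tmul]
  simp

theorem sweedler_comul_source_mul (hy : sourceMap k y = y) (h : H) {F : H → H → V}
    (h₁ : ∀ b, IsLin k (fun a => F a b) := by fun_prop)
    (h₂ : ∀ a, IsLin k (fun b => F a b) := by fun_prop) :
    sweedler (comul (R := k) (y * h)) F = sweedler (comul (R := k) h) fun a b => F a (y * b) := by
  rw [comul_mul, comul_source' hy, mul_assoc, comul_one_mul_comul, sweedler_tmul_mul]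
  simp

theorem sweedler_comul_mul_source (hy : sourceMap k y = y) (h : H) {F : H → H → V}
    (h₁ : ∀ b, IsLin k (fun a => F a b) := by fun_prop)
    (h₂ : ∀ a, IsLin k (fun b => F a b) := by fun_prop) :
    sweedler (comul (R := k) (h * y)) F = sweedler (comul (R := k) h) fun a b => F a (b * y) := by
  rw [comul_mul, comul_source hy, ← mul_assoc, comul_mul_comul_one, sweedler_mul_tmul]
  simp

/-- `1₁ ⊗ 1₂ = ε_s(1₁) ⊗ ε_t(1₂)`. -/
theorem sweedler_one_source {F : H → H → V}
    (h₁ : ∀ b, IsLin k (fun a => F a b) := by fun_prop)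
    (h₂ : ∀ a, IsLin k (fun b => F a b) := by fun_prop) :
    sweedler (comul (R := k) (1 : H)) F =
      sweedler (comul (R := k) (1 : H)) fun a b => F (sourceMap k a) b := by
  rw [sweedler_source_left 1 h₁ h₂]; simp

theorem sweedler_one_target {F : H → H → V}
    (h₁ : ∀ b, IsLin k (fun a => F a b) := by fun_prop)
    (h₂ : ∀ a, IsLin k (fun b => F a b) := by fun_prop) :
    sweedler (comul (R := k) (1 : H)) F =
      sweedler (comul (R := k) (1 : H)) fun a b => F a (targetMap k b) := by
  rw [sweedler_target_right 1 h₁ h₂]; simp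

/-- To compare sums over `Δ(1)`, one may assume that the legs lie in the source and target space. -/
theorem sweedler_one_congr {F G : H → H → V}
    (hFG : ∀ a b, sourceMap k a = a → targetMap k b = b → F a b = G a b)
    (h₁ : ∀ b, IsLin k (fun a => F a b) := by fun_prop)
    (h₂ : ∀ a, IsLin k (fun b => F a b) := by fun_prop)
    (h₃ : ∀ b, IsLin k (fun a => G a b) := by fun_prop)
    (h₄ : ∀ a, IsLin k (fun b => G a b) := by fun_prop) :
    sweedler (comul (R := k) (1 : H)) F = sweedler (comul (R := k) (1 : H)) G := by
  -- Both sides are rewritten with `ε_s` on the first leg and `ε_t` on the second; idempotence then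
  -- makes the hypothesis applicable termwise.
  refine (sweedler_one_source h₁ h₂).trans ((sweedler_one_target).trans ?_)
  refine Eq.trans ?_ ((sweedler_one_source h₃ h₄).trans (sweedler_one_target)).symm
  congr 1; ext a b
  exact hFG _ _ (sourceMap_sourceMap a) (targetMap_targetMap b)

end elements
end WeakSums

/-! ### The antipode on source and target elements; anti-comultiplicativity -/

namespace QuantumGroupoid
open WeakBialgebra
variable {k H V : Type*} [Field k] [Ring H] [Algebra k H] [QuantumGroupoid k H]
  [AddCommGroup V] [Module k V]

local notation "S" => antipode (k := k)
local notation "S⁻¹" => LinearEquiv.symm (antipodeEquiv (k := k))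

@[simp] theorem antipode_symm (x : H) : S (S⁻¹ x) = x := antipodeEquiv.apply_symm_apply x
@[simp] theorem symm_antipode (x : H) : S⁻¹ (S x) = x := antipodeEquiv.symm_apply_apply x

theorem symm_mul (x y : H) : S⁻¹ (x * y) = S⁻¹ y * S⁻¹ x := by
  rw [LinearEquiv.symm_apply_eq, antipodeEquiv_apply, antipode_mul]; simp

theorem sweedler_antipode_mul (h : H) :
    sweedler (comul (R := k) h) (fun a b => S a * b) = sourceMap k h := by
  conv_rhs => rw [sourceMap_apply, eq_sweedler (comul (R := k) h)]
  simp [map_sweedler]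

theorem sweedler_mul_antipode (h : H) :
    sweedler (comul (R := k) h) (fun a b => a * S b) = targetMap k h := by
  conv_rhs => rw [targetMap_apply, eq_sweedler (comul (R := k) h)]
  simp [map_sweedler]

theorem sweedler_source_antipode (h : H) :
    sweedler (comul (R := k) h) (fun a b => sourceMap k a * S b) = S h := by
  conv_rhs => rw [← convolution_source_antipode]
  conv_rhs => simp only [convolution, LinearMap.comp_apply]; rw [eq_sweedler (comul (R := k) h)]
  simp [map_sweedler]

theorem sweedler_antipode_target (h : H) :
    sweedler (comul (R := k) h) (fun a b => S a * targetMap k b) = S h := by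
  conv_rhs => rw [← convolution_antipode_target]
  conv_rhs => simp only [convolution, LinearMap.comp_apply]; rw [eq_sweedler (comul (R := k) h)]
  simp [map_sweedler]

/-- `h₁ ε_s(h₂) = h`. -/
theorem sweedler_mul_source (h : H) :
    sweedler (comul (R := k) h) (fun a b => a * sourceMap k b) = h := by
  -- The two sides are the two bracketings of `h₁ S(h₂) h₃`.
  conv_rhs => rw [← sweedler_target_mul (k := k) h]
  simp only [← sweedler_antipode_mul, ← sweedler_mul_antipode, mul_sweedler, sweedler_mul,
    ← mul_assoc]
  rw [sweedler_coassoc h]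

section elements
variable {y z : H}

theorem antipode_target (hz : targetMap k z = z) : S z = sourceMap k z := by
  simpa [hz] using antipode_targetMap (k := k) z

theorem antipode_source (hy : sourceMap k y = y) : S y = targetMap k y := by
  simpa [hy] using antipode_sourceMap (k := k) y

theorem sourceMap_antipode_target (hz : targetMap k z = z) : sourceMap k (S z) = S z := by
  rw [antipode_target hz, sourceMap_sourceMap]

theorem targetMap_antipode_source (hy : sourceMap k y = y) : targetMap k (S y) = S y := by
  rw [antipode_source hy, targetMap_targetMap]

/-- Surjectivity of `S` exhibits every target element as `S` of a source element, so `S⁻¹` maps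
`H_t` into `H_s`. -/
theorem sourceMap_symm (hz : targetMap k z = z) : sourceMap k (S⁻¹ z) = S⁻¹ z := by
  obtain ⟨w, hw⟩ := exists_source_of_target (k := k) z
  rw [hz] at hw
  rw [hw, symm_antipode, sourceMap_sourceMap]

theorem targetMap_symm (hy : sourceMap k y = y) : targetMap k (S⁻¹ y) = S⁻¹ y := by
  obtain ⟨w, hw⟩ := exists_target_of_source (k := k) y
  rw [hy] at hw
  rw [hw, symm_antipode, targetMap_targetMap]

/-- `1₁ ⊗ 1₂ z = 1₁ S⁻¹(z) ⊗ 1₂`. -/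
theorem comul_one_mul_target (hz : targetMap k z = z) :
    comul (R := k) (1 : H) * (1 ⊗ₜ z) = comul (R := k) (1 : H) * (S⁻¹ z ⊗ₜ 1) := by
  have := comul_one_mul_source (k := k) (S⁻¹ z)
  rw [sourceMap_symm hz, antipode_symm] at this
  exact this.symm

theorem comul_mul_target (hz : targetMap k z = z) (h : H) :
    comul (R := k) h * (1 ⊗ₜ z) = comul (R := k) h * (S⁻¹ z ⊗ₜ 1) := by
  rw [← comul_mul_comul_one, mul_assoc, comul_one_mul_target hz, mul_assoc]

/-- `h₁ ⊗ h₂ z = h₁ S⁻¹(z) ⊗ h₂`. -/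
theorem sweedler_mul_target (hz : targetMap k z = z) (h : H) {F : H → H → V}
    (h₁ : ∀ b, IsLin k (fun a => F a b) := by fun_prop)
    (h₂ : ∀ a, IsLin k (fun b => F a b) := by fun_prop) :
    sweedler (comul (R := k) h) (fun a b => F a (b * z)) =
      sweedler (comul (R := k) h) fun a b => F (a * S⁻¹ z) b := by
  have e := congrArg (fun X => sweedler X F) (comul_mul_target (k := k) hz h)
  simpa [sweedler_mul_tmul _ _ _ h₁ h₂] using e

/-- `h₁ y ⊗ h₂ = h₁ ⊗ h₂ S(y)`. -/
theorem sweedler_mul_source_left (hy : sourceMap k y = y) (h : H) {F : H → H → V}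
    (h₁ : ∀ b, IsLin k (fun a => F a b) := by fun_prop)
    (h₂ : ∀ a, IsLin k (fun b => F a b) := by fun_prop) :
    sweedler (comul (R := k) h) (fun a b => F (a * y) b) =
      sweedler (comul (R := k) h) fun a b => F a (b * S y) := by
  rw [sweedler_mul_target (targetMap_antipode_source hy) h h₁ h₂]
  simp only [symm_antipode]

/-- Here `S⁻¹(y)` is a target element, on which `S` agrees with `ε_s`; hence `y = ε_s(S⁻¹(y))`, and
the counit does not see `ε_s` on a left factor. -/
theorem counit_source_mul (hy : sourceMap k y = y) (h : H) :
    counit (R := k) (y * h) = counit (R := k) (S⁻¹ y * h) := by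
  rw [← counit_sourceMap_mul (S⁻¹ y), ← antipode_target (targetMap_symm hy), antipode_symm]

theorem counit_mul_antipode_source (hy : sourceMap k y = y) (h : H) :
    counit (R := k) (h * S y) = counit (R := k) (h * y) := by
  rw [antipode_source hy, counit_mul_targetMap]

/-- `ε(y h₁) h₂ = S⁻¹(y) h`. -/
theorem sweedler_counit_source_mul (hy : sourceMap k y = y) (h : H) :
    sweedler (comul (R := k) h) (fun a b => counit (R := k) (y * a) • b) = S⁻¹ y * h := by
  simp only [counit_source_mul hy]
  rw [← sweedler_comul_target_mul (F := fun a b => counit (R := k) a • b) (targetMap_symm hy),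
    sweedler_counit_left (f := fun x => x)]

end elements

theorem sweedler_source_mul_antipode (g h : H) :
    sweedler (comul (R := k) h) (fun a b => sourceMap k (g * a) * S b) = S h * sourceMap k g := by
  conv_rhs => rw [← source_conv_antipode_aux, eq_sweedler (comul (R := k) h)]
  simp [map_sweedler]

theorem sweedler_antipode_mul_target {z : H} (hz : targetMap k z = z) (h : H) :
    sweedler (comul (R := k) h) (fun a b => S a * targetMap k (b * z)) = z * S h := by
  conv_rhs => rw [← hz, ← antipode_conv_target_aux, eq_sweedler (comul (R := k) h), hz]
  simp [map_sweedler]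

/-- `h₁ S(h₄) ⊗ h₂ S(h₃) = Δ(ε_t(h))`. -/
theorem comul_mul_comul_antipode (h : H) :
    sweedler (comul (R := k) h) (fun a b => comul (R := k) a *
      sweedler (comul (R := k) b) fun c d => S d ⊗ₜ S c) = comul (R := k) (targetMap k h) := by
  have e : ∀ a b : H, comul (R := k) a * sweedler (comul (R := k) b) (fun c d => S d ⊗ₜ S c) =
      sweedler (comul (R := k) a) fun p q => sweedler (comul (R := k) b) fun c d =>
        (p * S d) ⊗ₜ (q * S c) := by
    intro a b
    conv_lhs => rw [eq_sweedler (comul (R := k) a)]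
    simp only [sweedler_mul, mul_sweedler, Algebra.TensorProduct.tmul_mul_tmul]
    rw [sweedler_swap]
  simp only [e]
  rw [sweedler_coassoc h (F := fun p q b => sweedler (comul (R := k) b) fun c d =>
        (p * S d) ⊗ₜ[k] (q * S c))]
  -- The inner pair `h₂ S(h₃)` collapses to `ε_t`, leaving `h₁ S(h₃) ⊗ ε_t(h₂)`.
  have e₁ : ∀ p b : H, sweedler (comul (R := k) b) (fun q b' => sweedler (comul (R := k) b')
      fun c d => (p * S d) ⊗ₜ[k] (q * S c)) =
      sweedler (comul (R := k) b) fun q d => (p * S d) ⊗ₜ[k] targetMap k q := by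
    intro p b
    rw [← sweedler_coassoc b (F := fun q c d => (p * S d) ⊗ₜ[k] (q * S c))]
    simp only [← tmul_sweedler, sweedler_mul_antipode]
  simp only [e₁]
  rw [← sweedler_coassoc h (F := fun p q d => (p * S d) ⊗ₜ[k] targetMap k q)]
  -- Now `h₁ ⊗ ε_t(h₂) = 1₁ h ⊗ 1₂`, so that `h₁ S(h₂)` appears in the first leg and becomes
  -- `ε_t(h)`.
  have e₂ : ∀ a d : H, sweedler (comul (R := k) a) (fun p q => (p * S d) ⊗ₜ[k] targetMap k q) =
      sweedler (comul (R := k) (1 : H)) fun p q => (p * (a * S d)) ⊗ₜ[k] q := by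
    intro a d
    simp only [← mul_assoc]
    exact sweedler_target_right a (F := fun p q => (p * S d) ⊗ₜ[k] q)
  simp only [e₂]
  rw [sweedler_swap]
  simp only [← sweedler_tmul_const, ← mul_sweedler, sweedler_mul_antipode]
  rw [comul_targetMap', eq_sweedler (comul (R := k) (1 : H)), sweedler_mul]
  simp only [Algebra.TensorProduct.tmul_mul_tmul, mul_one, ← eq_sweedler]

/-- `S(h₂) ⊗ ε_t(h₁) = S(h) 1₁ ⊗ 1₂`. -/
theorem sweedler_antipode_tmul_target (h : H) :
    sweedler (comul (R := k) h) (fun a b => S b ⊗ₜ targetMap k a) =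
      sweedler (comul (R := k) (1 : H)) fun p q => (S h * p) ⊗ₜ[k] q := by
  simp only [targetMap_eq_sweedler, tmul_sweedler]
  rw [sweedler_swap]
  have e : ∀ p q : H, sweedler (comul (R := k) h) (fun a b => S b ⊗ₜ[k]
      (counit (R := k) (p * a) • q)) =
      S (sweedler (comul (R := k) h) fun a b => counit (R := k) (p * a) • b) ⊗ₜ q := by
    intro p q
    simp only [map_sweedler, sweedler_tmul_const, TensorProduct.tmul_smul, map_smul,
      TensorProduct.smul_tmul']
  simp only [e]
  rw [sweedler_one_source]
  conv_rhs => rw [sweedler_one_source]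
  congr 1; ext p q
  -- For `p` in `H_s`, `ε(p h₁) h₂ = S⁻¹(p) h`, and `S` sends this to `S(h) p`.
  rw [sweedler_counit_source_mul (sourceMap_sourceMap p), antipode_mul, antipode_symm]

/-- `1₁ S(h₂) ⊗ ε_t(h₁ 1₂) = S(h) 1₁ ⊗ 1₂`. -/
theorem sweedler_one_mul_antipode (h : H) :
    sweedler (comul (R := k) (1 : H)) (fun p q => sweedler (comul (R := k) h) fun a b =>
      (p * S b) ⊗ₜ targetMap k (a * q)) =
      sweedler (comul (R := k) (1 : H)) fun p q => (S h * p) ⊗ₜ[k] q := by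
  simp only [targetMap_eq_sweedler, tmul_sweedler]
  -- With `ε_t(a q) = ε(r a q) s` expanded, summing over `p ⊗ q` first yields `ε_s(r a)`, to which
  -- `ε_s(r h₁) S(h₂) = S(h) ε_s(r)` applies.
  have e : ∀ r s : H, sweedler (comul (R := k) (1 : H)) (fun p q =>
      sweedler (comul (R := k) h) fun a b =>
        (p * S b) ⊗ₜ[k] (counit (R := k) (r * (a * q)) • s)) = (S h * sourceMap k r) ⊗ₜ s := by
    intro r s
    rw [sweedler_swap, ← sweedler_source_mul_antipode]
    simp only [sourceMap_eq_sweedler, sweedler_mul, sweedler_tmul_const, TensorProduct.tmul_smul,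
      TensorProduct.smul_tmul', mul_assoc, smul_mul_assoc]
  rw [sweedler_one_source (F := fun p q => (S h * p) ⊗ₜ[k] q)]
  simp only [← e]
  conv_rhs => rw [sweedler_swap]
  congr 1; ext p q
  rw [sweedler_swap]

/-- `Δ(1)` acts trivially on `S(h₂) ⊗ S(h₁)`. -/
theorem comul_one_mul_antipode (h : H) :
    comul (R := k) (1 : H) * sweedler (comul (R := k) h) (fun a b => S b ⊗ₜ S a) =
      sweedler (comul (R := k) h) fun a b => S b ⊗ₜ S a := by
  conv_lhs => rw [eq_sweedler (comul (R := k) (1 : H))]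
  simp only [sweedler_mul, mul_sweedler, Algebra.TensorProduct.tmul_mul_tmul]
  rw [sweedler_swap, sweedler_one_target]
  -- A target element to the left of `S(a)` is moved inside: `z S(a) = S(a₁) ε_t(a₂ z)`. The sum
  -- becomes `1₁ S(h₃) ⊗ S(h₁) ε_t(h₂ 1₂)`, and the two preceding lemmas, which have the same
  -- right-hand side, delete `1₁` and `1₂` (`e₁`).
  have e : ∀ q a : H, targetMap k q * S a =
      sweedler (comul (R := k) a) fun c d => S c * targetMap k (d * targetMap k q) := by
    intro q a
    rw [sweedler_antipode_mul_target (targetMap_targetMap q)]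
  simp only [e, tmul_sweedler, targetMap_mul_targetMap]
  rw [sweedler_swap]
  have e₁ : ∀ b c : H, sweedler (comul (R := k) (1 : H)) (fun p q =>
      sweedler (comul (R := k) b) fun d b' => (p * S b') ⊗ₜ[k] (S c * targetMap k (d * q))) =
      sweedler (comul (R := k) b) fun d b' => S b' ⊗ₜ (S c * targetMap k d) := by
    intro b c
    have := congrArg ((LinearMap.mulLeft k (S c)).lTensor H)
      ((sweedler_one_mul_antipode (k := k) b).trans (sweedler_antipode_tmul_target b).symm)
    simpa only [map_sweedler, LinearMap.lTensor_tmul, LinearMap.mulLeft_apply] using this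
  calc sweedler (comul (R := k) h) (fun a b => sweedler (comul (R := k) (1 : H)) fun p q =>
        sweedler (comul (R := k) a) fun c d => (p * S b) ⊗ₜ[k] (S c * targetMap k (d * q)))
      = sweedler (comul (R := k) h) (fun a b => sweedler (comul (R := k) a) fun c d =>
        sweedler (comul (R := k) (1 : H)) fun p q =>
        (p * S b) ⊗ₜ[k] (S c * targetMap k (d * q))) := by
        congr 1; ext a b; rw [sweedler_swap]
    _ = sweedler (comul (R := k) h) (fun c b => sweedler (comul (R := k) b) fun d b' =>
        sweedler (comul (R := k) (1 : H)) fun p q =>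
        (p * S b') ⊗ₜ[k] (S c * targetMap k (d * q))) := by
        rw [sweedler_coassoc h (F := fun c d b => sweedler (comul (R := k) (1 : H)) fun p q =>
          (p * S b) ⊗ₜ[k] (S c * targetMap k (d * q)))]
    _ = sweedler (comul (R := k) h) (fun c b => sweedler (comul (R := k) b) fun d b' =>
          S b' ⊗ₜ (S c * targetMap k d)) := by
        congr 1; ext c b; rw [sweedler_swap, e₁]
    _ = _ := by
        rw [← sweedler_coassoc h (F := fun c d b' => S b' ⊗ₜ[k] (S c * targetMap k d))]
        simp only [← tmul_sweedler, sweedler_antipode_target]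

/-- The antipode is anti-comultiplicative: `Δ(S(h)) = S(h₂) ⊗ S(h₁)`. -/
theorem comul_antipode (h : H) : comul (R := k) (S h) =
    sweedler (comul (R := k) h) fun a b => S b ⊗ₜ S a := by
  -- This is uniqueness of convolution inverses with the unit replaced by `Δ ∘ ε_t` on one side and
  -- `Δ ∘ ε_s` on the other: `Δ(S(h₁)) Δ(h₂) (S(h₄) ⊗ S(h₃))` is evaluated in both bracketings. A
  -- factor `Δ(1)` survives, and the previous lemma absorbs it.
  calc comul (R := k) (S h)
      = sweedler (comul (R := k) h) (fun a b => sweedler (comul (R := k) b) fun c d =>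
        comul (R := k) (S a) * (comul (R := k) c *
          sweedler (comul (R := k) d) fun p q => S q ⊗ₜ S p)) := by
        conv_lhs => rw [← sweedler_antipode_target (k := k) h]
        simp only [map_sweedler, comul_mul, ← comul_mul_comul_antipode, mul_sweedler]
    _ = sweedler (comul (R := k) h) (fun a b => sweedler (comul (R := k) a) fun c d =>
        comul (R := k) (S c) * (comul (R := k) d *
          sweedler (comul (R := k) b) fun p q => S q ⊗ₜ S p)) := by
        rw [sweedler_coassoc h (F := fun a c d => comul (R := k) (S a) * (comul (R := k) c *
          sweedler (comul (R := k) d) fun p q => S q ⊗ₜ S p))]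
    _ = sweedler (comul (R := k) h) (fun a b => comul (R := k) (sourceMap k a) *
          sweedler (comul (R := k) b) fun p q => S q ⊗ₜ S p) := by
        simp only [← mul_assoc, ← comul_mul, ← sweedler_mul, ← map_sweedler, sweedler_antipode_mul]
    _ = sweedler (comul (R := k) h) (fun a b => sweedler (comul (R := k) b) fun p q =>
          comul (R := k) (1 : H) * (S q ⊗ₜ (sourceMap k a * S p))) := by
        simp only [comul_sourceMap, mul_sweedler, mul_assoc, Algebra.TensorProduct.tmul_mul_tmul,
          one_mul]
    _ = comul (R := k) (1 : H) * sweedler (comul (R := k) h) (fun a b => S b ⊗ₜ S a) := by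
        rw [← sweedler_coassoc h (F := fun a p q => comul (R := k) (1 : H) *
          (S q ⊗ₜ (sourceMap k a * S p)))]
        simp only [← mul_sweedler, ← tmul_sweedler, sweedler_source_antipode]
    _ = _ := comul_one_mul_antipode h

theorem sweedler_comul_antipode (h : H) {F : H → H → V}
    (h₁ : ∀ b, IsLin k (fun a => F a b) := by fun_prop)
    (h₂ : ∀ a, IsLin k (fun b => F a b) := by fun_prop) :
    sweedler (comul (R := k) (S h)) F = sweedler (comul (R := k) h) fun a b => F (S b) (S a) := by
  rw [comul_antipode, sweedler_sweedler _ _ h₁ h₂]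
  simp only [sweedler_tmul _ _ h₁ h₂]

/-- `1₁ ⊗ 1₂ = S(1₂) ⊗ S(1₁)`. -/
theorem sweedler_one_antipode {F : H → H → V}
    (h₁ : ∀ b, IsLin k (fun a => F a b) := by fun_prop)
    (h₂ : ∀ a, IsLin k (fun b => F a b) := by fun_prop) :
    sweedler (comul (R := k) (1 : H)) (fun a b => F (S b) (S a)) =
      sweedler (comul (R := k) (1 : H)) F := by
  rw [← sweedler_comul_antipode 1 h₁ h₂, antipode_one]

end QuantumGroupoid

/-! ### The adjoint action and the centralizer of the source space -/

namespace QuantumGroupoid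
open WeakBialgebra

section adjoint
variable {k : Type v} {H : Type u} {V : Type*} [Field k] [Ring H] [Algebra k H] [QuantumGroupoid k H]
  [AddCommGroup V] [Module k V]

local notation "S" => antipode (k := k)
local notation "S⁻¹" => LinearEquiv.symm (antipodeEquiv (k := k))
local notation "Ad" => adjoint k H

/-- `h₁ ⊗ ε_s(h₂) = h 1₁ ⊗ S(1₂)`. -/
theorem sweedler_source_right (h : H) {F : H → H → V}
    (h₁ : ∀ b, IsLin k (fun a => F a b) := by fun_prop)
    (h₂ : ∀ a, IsLin k (fun b => F a b) := by fun_prop) :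
    sweedler (comul (R := k) h) (fun a b => F a (sourceMap k b)) =
      sweedler (comul (R := k) (1 : H)) fun p q => F (h * p) (S q) := by
  have e : ∀ a b, F a (sourceMap k b) = sweedler (comul (R := k) (1 : H)) fun p q =>
      counit (R := k) (b * q) • F a p := by
    intro a b
    rw [sourceMap_eq_sweedler, (h₂ a).sweedler_out]
    congr 1; ext p q
    exact (h₂ a).map_smul _ _
  simp only [e]
  -- Writing `Δ(1)` as `S(1₂) ⊗ S(1₁)` produces `ε(h₂ S(p))` with `p` in `H_s`; then `S(p)` crosses
  -- to the first leg as `p`.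
  rw [sweedler_swap, ← sweedler_one_antipode]
  refine sweedler_one_congr fun p q hp hq => ?_
  rw [sweedler_mul_target (targetMap_antipode_source hp) h
    (F := fun a b => counit (R := k) b • F a (S q)), symm_antipode,
    sweedler_counit_right h (f := fun a => F (a * p) (S q))]

variable (k H) in
/-- The centralizer `C_H(H_s)` as a subalgebra. -/
abbrev sourceCentralizer : Subalgebra k H :=
  Subalgebra.centralizer k (Set.range (sourceMap k (H := H)))

theorem source_mul_comm {y g : H} (hg : g ∈ sourceCentralizer k H) (hy : sourceMap k y = y) :
    y * g = g * y :=
  (Subalgebra.mem_centralizer_iff k).1 hg _ ⟨y, hy⟩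

theorem target_mem {z : H} (hz : targetMap k z = z) : z ∈ sourceCentralizer k H := by
  rw [Subalgebra.mem_centralizer_iff]
  rintro _ ⟨y, rfl⟩
  exact source_mul_target (sourceMap_sourceMap y) hz

theorem adjoint_eq_sweedler (h g : H) :
    Ad h g = sweedler (comul (R := k) h) fun a b => a * g * S b := by
  rw [adjoint_apply]
  conv_lhs => rw [eq_sweedler (comul (R := k) h), map_sweedler,
    ← LinearMap.applyₗ_apply_apply (R := k), map_sweedler]
  simp [sandwich_tmul, mul_assoc]

theorem adjoint_one_mem {g : H} (hg : g ∈ sourceCentralizer k H) : Ad 1 g = g :=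
  SourceCentralizer.adjoint_one ⟨g, hg⟩

theorem adjoint_mem (h g : H) : Ad h g ∈ sourceCentralizer k H :=
  SourceCentralizer.adjoint_mem h g

/-- A target element multiplies the first leg of a coproduct. A source element multiplies the
second, where `S` turns it into a factor on the right. On the centralizer, where `Ad_1` is the
identity, `H_t` thus acts by left multiplication and `y` in `H_s` by right multiplication with
`S(y)`. -/
theorem adjoint_target_mul {z : H} (hz : targetMap k z = z) (h g : H) :
    Ad (z * h) g = z * Ad h g := by
  simp only [adjoint_eq_sweedler]
  rw [sweedler_comul_target_mul hz]
  simp only [mul_sweedler, mul_assoc]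

theorem adjoint_source_mul {y : H} (hy : sourceMap k y = y) (h g : H) :
    Ad (y * h) g = Ad h g * S y := by
  simp only [adjoint_eq_sweedler]
  rw [sweedler_comul_source_mul hy]
  simp only [sweedler_mul, antipode_mul, mul_assoc]

theorem adjoint_target_left {z g : H} (hz : targetMap k z = z) (hg : g ∈ sourceCentralizer k H) :
    Ad z g = z * g := by
  rw [← mul_one z, adjoint_target_mul hz, adjoint_one_mem hg, mul_one]

theorem adjoint_source_left {y g : H} (hy : sourceMap k y = y) (hg : g ∈ sourceCentralizer k H) :
    Ad y g = g * S y := by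
  rw [← mul_one y, adjoint_source_mul hy, adjoint_one_mem hg, mul_one]

/-- `S(h₁) Ad_{h₂}(g) = g S(h)`. -/
theorem sweedler_antipode_mul_adjoint (h : H) {g : H} (hg : g ∈ sourceCentralizer k H) :
    sweedler (comul (R := k) h) (fun a b => S a * Ad b g) = g * S h := by
  simp only [adjoint_eq_sweedler, mul_sweedler]
  rw [← sweedler_coassoc h (F := fun a c d => S a * (c * g * S d))]
  simp only [← mul_assoc, ← sweedler_mul, sweedler_antipode_mul]
  -- After `S(h₁) h₂ = ε_s(h₁)` the sum is `ε_s(h₁) g S(h₂) = 1₁ g S(1₂) S(h) = Ad_1(g) S(h)`.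
  rw [sweedler_source_left h (F := fun a b => a * g * S b)]
  simp only [antipode_mul, ← mul_assoc, ← sweedler_mul]
  rw [← adjoint_eq_sweedler, adjoint_one_mem hg]

/-- `Ad_{h₁}(g) h₂ = h g`. -/
theorem sweedler_adjoint_mul (h : H) {g : H} (hg : g ∈ sourceCentralizer k H) :
    sweedler (comul (R := k) h) (fun a b => Ad a g * b) = h * g := by
  simp only [adjoint_eq_sweedler, sweedler_mul]
  rw [sweedler_coassoc h (F := fun a c d => a * g * S c * d)]
  simp only [mul_assoc, ← mul_sweedler, sweedler_antipode_mul]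
  conv_rhs => rw [← sweedler_mul_source (k := k) h]
  -- Centrality is used here: `h₁ g ε_s(h₂) = h₁ ε_s(h₂) g`.
  simp only [← source_mul_comm hg (sourceMap_sourceMap _), sweedler_mul, mul_assoc]

/-- `Ad_{h₁}(a) Ad_{h₂}(b) = Ad_h(a b)`. -/
theorem sweedler_adjoint_mul_adjoint (h a : H) {b : H} (hb : b ∈ sourceCentralizer k H) :
    sweedler (comul (R := k) h) (fun c d => Ad c a * Ad d b) = Ad h (a * b) := by
  simp only [adjoint_eq_sweedler _ a, sweedler_mul]
  rw [sweedler_coassoc h (F := fun p q d => p * a * S q * Ad d b)]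
  simp only [mul_assoc, ← mul_sweedler, sweedler_antipode_mul_adjoint _ hb]
  simp only [adjoint_eq_sweedler, mul_assoc]

/-- On `H_t` the adjoint action is the action of the unit object, because `Δ(hz) = h₁ z ⊗ h₂`. This
is what makes the unit `H_t → C_H(H_s)` a morphism. -/
theorem adjoint_target (h : H) {z : H} (hz : targetMap k z = z) : Ad h z = targetMap k (h * z) := by
  rw [← sweedler_mul_antipode, sweedler_comul_mul_target hz, adjoint_eq_sweedler]

theorem targetMap_mul_antipode (a b : H) :
    targetMap k (a * S b) = targetMap k (a * sourceMap k b) := by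
  rw [← targetMap_mul_targetMap, targetMap_antipode, targetMap_mul_targetMap]

/-- Under `ε_t` the last factor `S(h₂)` may be replaced by `ε_s(h₂)`, which commutes past `g` and is
absorbed by `h₁ ε_s(h₂) = h`. Linearity of the counit follows. -/
theorem targetMap_adjoint (h : H) {g : H} (hg : g ∈ sourceCentralizer k H) :
    targetMap k (Ad h g) = targetMap k (h * g) := by
  simp only [adjoint_eq_sweedler, map_sweedler, targetMap_mul_antipode]
  conv_rhs => rw [← sweedler_mul_source (k := k) h]
  simp only [sweedler_mul, mul_assoc, source_mul_comm hg (sourceMap_sourceMap _), map_sweedler]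

theorem targetMap_source_mul {y : H} (hy : sourceMap k y = y) (g : H) :
    targetMap k (y * g) = targetMap k g * S y := by
  simp only [targetMap_eq_sweedler, ← mul_assoc]
  rw [sweedler_mul_source_left hy 1 (F := fun a b => counit (R := k) (a * g) • b)]
  simp only [sweedler_mul, smul_mul_assoc]

/-- With `y = S⁻¹(z)` in `H_s`, the factor `z = S(y)` may be replaced by `y` under `ε_t`; then `y`
commutes past `g` and leaves `ε_t` on the right as `S(y)`. Multiplicativity of `ε_t` on the
centralizer follows, hence that of the counit. -/
theorem targetMap_mul_target_of_mem {g z : H} (hg : g ∈ sourceCentralizer k H)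
    (hz : targetMap k z = z) : targetMap k (g * z) = targetMap k g * z := by
  have hy := sourceMap_symm hz
  conv_lhs => rw [← antipode_symm (k := k) z, targetMap_mul_antipode, hy, ← source_mul_comm hg hy,
    targetMap_source_mul hy, antipode_symm]

theorem targetMap_mul_of_mem {g : H} (hg : g ∈ sourceCentralizer k H) (l : H) :
    targetMap k (g * l) = targetMap k g * targetMap k l := by
  rw [← targetMap_mul_targetMap, targetMap_mul_target_of_mem hg (targetMap_targetMap l)]

/-- In the form `S(1₂) ⊗ S(1₁)` of `Δ(1)`, `ε_s(g)` is `ε(g 1₁) S(1₂)`, whereas `S(ε_t(g))` is `ε(1₁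
g) S(1₂)`; the leg `1₁` lies in `H_s` and commutes with `g`. -/
theorem antipode_targetMap_of_mem {g : H} (hg : g ∈ sourceCentralizer k H) :
    S (targetMap k g) = sourceMap k g := by
  rw [targetMap_eq_sweedler, sourceMap_eq_sweedler, map_sweedler,
    ← sweedler_one_antipode (F := fun p q => counit (R := k) (g * q) • p)]
  refine sweedler_one_congr fun p q hp hq => ?_
  rw [counit_mul_antipode_source hp, map_smul, source_mul_comm hg hp]

/-- For `g` in the centralizer, `g₂` may be replaced by `Ad_1(g₂)`. -/
theorem sweedler_comul_mem {g : H} (hg : g ∈ sourceCentralizer k H) {F : H → H → V}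
    (h₁ : ∀ b, IsLin k (fun a => F a b) := by fun_prop)
    (h₂ : ∀ a, IsLin k (fun b => F a b) := by fun_prop) :
    sweedler (comul (R := k) g) (fun a b => F a (Ad 1 b)) = sweedler (comul (R := k) g) F := by
  have e : ∀ a b, F a (Ad 1 b) = sweedler (comul (R := k) (1 : H)) fun p q => F a (p * b * S q) := by
    intro a b
    rw [adjoint_eq_sweedler, (h₂ a).sweedler_out]
  simp only [e]
  rw [sweedler_swap]
  -- For `p` in `H_s`, `g p = p g` gives `g₁ ⊗ p g₂ = g₁ ⊗ g₂ p`. The conjugation by `Δ(1)` thus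
  -- becomes right multiplication by `1₁ S(1₂) = 1`.
  have e₁ : sweedler (comul (R := k) (1 : H)) (fun p q => sweedler (comul (R := k) g) fun a b =>
      F a (p * b * S q)) = sweedler (comul (R := k) (1 : H)) (fun p q =>
        sweedler (comul (R := k) g) fun a b => F a (b * (p * S q))) := by
    refine sweedler_one_congr fun p q hp hq => ?_
    rw [← sweedler_comul_source_mul hp g (F := fun a b => F a (b * S q)), source_mul_comm hg hp,
      sweedler_comul_mul_source hp]
    simp only [mul_assoc]
  rw [e₁, sweedler_swap]
  congr 1; ext a b
  rw [← ((h₂ a).comp (IsLin.const_mul .id b)).sweedler_out, sweedler_mul_antipode, targetMap_one,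
    mul_one]

/-- `Ad_1` takes values in the centralizer, so in a sum over `Δ(g)` the second leg may be assumed to
lie there. Nothing similar is claimed for the first leg. -/
theorem sweedler_comul_congr {g : H} (hg : g ∈ sourceCentralizer k H) {F G : H → H → V}
    (hFG : ∀ a b, b ∈ sourceCentralizer k H → F a b = G a b)
    (h₁ : ∀ b, IsLin k (fun a => F a b) := by fun_prop)
    (h₂ : ∀ a, IsLin k (fun b => F a b) := by fun_prop)
    (h₃ : ∀ b, IsLin k (fun a => G a b) := by fun_prop)
    (h₄ : ∀ a, IsLin k (fun b => G a b) := by fun_prop) :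
    sweedler (comul (R := k) g) F = sweedler (comul (R := k) g) G := by
  rw [← sweedler_comul_mem hg h₁ h₂, ← sweedler_comul_mem hg h₃ h₄]
  congr 1; ext a b
  exact hFG _ _ (adjoint_mem 1 b)

end adjoint
end QuantumGroupoid

/-! ### Identities for the universal R-matrix -/

namespace QuasitriangularQuantumGroupoid
open WeakBialgebra QuantumGroupoid

variable {k : Type v} {H : Type u} {V : Type*} [Field k] [Ring H] [Algebra k H]
  [QuasitriangularQuantumGroupoid k H] [AddCommGroup V] [Module k V]

local notation "S" => antipode (k := k)
local notation "S⁻¹" => LinearEquiv.symm (antipodeEquiv (k := k))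
local notation "Ad" => adjoint k H
local notation "𝖱" => R (k := k) (H := H)

/-- `R⁽¹⁾ ⊗ Δ(R⁽²⁾) = R₁₃ R₁₂`. -/
theorem sweedler_R_comul_right {F : H → H → H → V}
    (h₁ : ∀ b c, IsLin k (fun a => F a b c) := by fun_prop)
    (h₂ : ∀ a c, IsLin k (fun b => F a b c) := by fun_prop)
    (h₃ : ∀ a b, IsLin k (fun c => F a b c) := by fun_prop) :
    sweedler 𝖱 (fun a b => sweedler (comul (R := k) b) fun c d => F a c d) =
      sweedler 𝖱 fun a b => sweedler 𝖱 fun a' b' => F (a * a') b' b := by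
  have e := congrArg (fun X => sweedler X fun a Y => sweedler Y fun c d => F a c d)
    (comul_lTensor_R (k := k) (H := H))
  rw [sweedler_mul_tensor] at e
  simp only [LinearMap.lTensor] at e
  rw [sweedler_map, sweedler_map] at e
  refine e.trans ?_
  congr 1; ext a b
  rw [sweedler_map]
  congr 1; ext a' b'
  simp only [LinearMap.id_apply, mk_apply, LinearMap.flip_apply,
    Algebra.TensorProduct.tmul_mul_tmul, one_mul, mul_one]
  rw [sweedler_tmul]

/-- `Δ(R⁽¹⁾) ⊗ R⁽²⁾ = R₁₃ R₂₃`. -/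
theorem sweedler_R_comul_left {F : H → H → H → V}
    (h₁ : ∀ b c, IsLin k (fun a => F a b c) := by fun_prop)
    (h₂ : ∀ a c, IsLin k (fun b => F a b c) := by fun_prop)
    (h₃ : ∀ a b, IsLin k (fun c => F a b c) := by fun_prop) :
    sweedler 𝖱 (fun a b => sweedler (comul (R := k) a) fun c d => F c d b) =
      sweedler 𝖱 fun a b => sweedler 𝖱 fun a' b' => F a a' (b * b') := by
  have e := congrArg (fun X => sweedler X fun a Y => sweedler Y fun c d => F a c d)
    (comul_rTensor_R (k := k) (H := H))
  rw [sweedler_mul_tensor, sweedler_assoc _ h₁ h₂ h₃] at e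
  simp only [LinearMap.lTensor, LinearMap.rTensor] at e
  rw [sweedler_map, sweedler_map] at e
  refine e.trans ?_
  congr 1; ext a b
  rw [sweedler_tmul]
  simp only [LinearMap.id_apply, mk_apply, mul_one]
  rw [sweedler_tmul_mul]
  simp only [one_mul]

theorem sweedler_comulOp_R (h : H) {F : H → H → V}
    (h₁ : ∀ b, IsLin k (fun a => F a b) := by fun_prop)
    (h₂ : ∀ a, IsLin k (fun b => F a b) := by fun_prop) :
    sweedler 𝖱 (fun c d => sweedler (comul (R := k) h) fun a b => F (c * a) (d * b)) =
      sweedler 𝖱 fun c d => sweedler (comul (R := k) h) fun a b => F (b * c) (a * d) := by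
  rw [← sweedler_mul_tensor _ _ h₁ h₂, ← comulOp_mul_R, sweedler_mul_tensor _ _ h₁ h₂,
    sweedler_tensorComm]
  exact sweedler_swap _ _ _

theorem R_mul_comul_one : 𝖱 * comul 1 = 𝖱 := by
  obtain ⟨X, hX⟩ := R_mem (k := k) (H := H)
  rw [hX, mul_assoc, comul_mul_comul_one]

theorem comulOp_one_mul_R : TensorProduct.comm k H H (comul 1) * 𝖱 = 𝖱 := by
  rw [comulOp_mul_R, R_mul_comul_one]

section elements
variable {y z : H}

/-- For a source or target element the coproduct is `Δ(1)` times that element in one leg. Since `R`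
absorbs `Δ(1)` on the right and `Δᵒᵖ(1)` on the left, the intertwining relation carries the element
across `R` into the opposite leg. -/
theorem R_mul_source (hy : sourceMap k y = y) : 𝖱 * (1 ⊗ₜ y) = (y ⊗ₜ 1) * 𝖱 := by
  calc 𝖱 * (1 ⊗ₜ y) = 𝖱 * comul y := by
        rw [comul_source hy, ← mul_assoc, R_mul_comul_one]
    _ = TensorProduct.comm k H H ((1 ⊗ₜ y) * comul 1) * 𝖱 := by
        rw [← comulOp_mul_R, comul_source' hy]
    _ = _ := by
        rw [TensorT.comm_mul, mul_assoc, comulOp_one_mul_R, comm_tmul]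

theorem R_mul_target (hz : targetMap k z = z) : 𝖱 * (z ⊗ₜ 1) = (1 ⊗ₜ z) * 𝖱 := by
  calc 𝖱 * (z ⊗ₜ 1) = 𝖱 * comul z := by
        rw [comul_target' hz, ← mul_assoc, R_mul_comul_one]
    _ = TensorProduct.comm k H H ((z ⊗ₜ 1) * comul 1) * 𝖱 := by
        rw [← comulOp_mul_R, comul_target hz]
    _ = _ := by
        rw [TensorT.comm_mul, mul_assoc, comulOp_one_mul_R, comm_tmul]

theorem R_mul_target_right (hz : targetMap k z = z) : 𝖱 * (1 ⊗ₜ z) = 𝖱 * (S⁻¹ z ⊗ₜ 1) := by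
  rw [← R_mul_comul_one, mul_assoc, comul_one_mul_target hz, mul_assoc]

/-- `R⁽¹⁾ ⊗ R⁽²⁾ z = R⁽¹⁾ S⁻¹(z) ⊗ R⁽²⁾`. -/
theorem sweedler_R_mul_target_right (hz : targetMap k z = z) {F : H → H → V}
    (h₁ : ∀ b, IsLin k (fun a => F a b) := by fun_prop)
    (h₂ : ∀ a, IsLin k (fun b => F a b) := by fun_prop) :
    sweedler 𝖱 (fun a b => F a (b * z)) = sweedler 𝖱 fun a b => F (a * S⁻¹ z) b := by
  have e := congrArg (fun X => sweedler X F) (R_mul_target_right (k := k) hz)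
  simpa [sweedler_mul_tmul _ _ _ h₁ h₂] using e

/-- `R⁽¹⁾ z ⊗ R⁽²⁾ = R⁽¹⁾ ⊗ z R⁽²⁾`. -/
theorem sweedler_R_mul_target_left (hz : targetMap k z = z) {F : H → H → V}
    (h₁ : ∀ b, IsLin k (fun a => F a b) := by fun_prop)
    (h₂ : ∀ a, IsLin k (fun b => F a b) := by fun_prop) :
    sweedler 𝖱 (fun a b => F (a * z) b) = sweedler 𝖱 fun a b => F a (z * b) := by
  have e := congrArg (fun X => sweedler X F) (R_mul_target (k := k) hz)
  simpa [sweedler_mul_tmul _ _ _ h₁ h₂, sweedler_tmul_mul _ _ _ h₁ h₂] using e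

/-- `R⁽¹⁾ ⊗ R⁽²⁾ y = y R⁽¹⁾ ⊗ R⁽²⁾`. -/
theorem sweedler_R_mul_source_right (hy : sourceMap k y = y) {F : H → H → V}
    (h₁ : ∀ b, IsLin k (fun a => F a b) := by fun_prop)
    (h₂ : ∀ a, IsLin k (fun b => F a b) := by fun_prop) :
    sweedler 𝖱 (fun a b => F a (b * y)) = sweedler 𝖱 fun a b => F (y * a) b := by
  have e := congrArg (fun X => sweedler X F) (R_mul_source (k := k) hy)
  simpa [sweedler_mul_tmul _ _ _ h₁ h₂, sweedler_tmul_mul _ _ _ h₁ h₂] using e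

end elements

/-- `ε(R⁽²⁾) R⁽¹⁾ = 1`. -/
theorem sweedler_counit_R_right : sweedler 𝖱 (fun a b => counit (R := k) b • a) = 1 := by
  -- Applying `ε` to the middle leg of `(id ⊗ Δ)R = R₁₃R₁₂` shows that `R` absorbs `u ⊗ 1` on the
  -- right, where `u = ε(R⁽²⁾) R⁽¹⁾`.
  have e : 𝖱 * ((sweedler 𝖱 fun a b => counit (R := k) b • a) ⊗ₜ 1) = 𝖱 := by
    have e₁ := sweedler_R_comul_right (k := k) (H := H)
      (F := fun a c d => counit (R := k) c • (a ⊗ₜ[k] d))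
    have e₂ : ∀ a b : H, sweedler (comul (R := k) b) (fun c d => counit (R := k) c • (a ⊗ₜ[k] d)) =
        a ⊗ₜ b := fun a b => sweedler_counit_left b (f := fun d => a ⊗ₜ[k] d)
    simp only [e₂, ← eq_sweedler] at e₁
    conv_lhs => lhs; rw [eq_sweedler 𝖱]
    refine Eq.trans ?_ e₁.symm
    simp only [sweedler_tmul_const, mul_sweedler, sweedler_mul, TensorProduct.smul_tmul',
      Algebra.TensorProduct.tmul_mul_tmul, mul_one, mul_smul_comm]
    rw [sweedler_swap]
  -- Multiplication by `R⁻¹` gives `Δ(1)(u ⊗ 1) = Δ(1)`; the counit on the second leg then leaves `u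
  -- = 1`.
  have e₂ : comul (R := k) (1 : H) * ((sweedler 𝖱 fun a b => counit (R := k) b • a) ⊗ₜ 1) =
      comul 1 := by
    rw [← Rinv_mul_R, mul_assoc, e]
  have e₃ := congrArg (fun X => sweedler X fun a b => counit (R := k) b • a) e₂
  rw [sweedler_mul_tmul] at e₃
  simp only [mul_one] at e₃
  rwa [sweedler_counit_right (f := fun a => a * _), sweedler_counit_right (f := fun a => a),
    one_mul] at e₃

/-- `ε(R⁽¹⁾) R⁽²⁾ = 1`. -/
theorem sweedler_counit_R_left : sweedler 𝖱 (fun a b => counit (R := k) a • b) = 1 := by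
  have e : 𝖱 * (1 ⊗ₜ (sweedler 𝖱 fun a b => counit (R := k) a • b)) = 𝖱 := by
    have e₁ := sweedler_R_comul_left (k := k) (H := H)
      (F := fun c d b => counit (R := k) d • (c ⊗ₜ[k] b))
    have e₂ : ∀ a b : H, sweedler (comul (R := k) a) (fun c d => counit (R := k) d • (c ⊗ₜ[k] b)) =
        a ⊗ₜ b := fun a b => sweedler_counit_right a (f := fun c => c ⊗ₜ[k] b)
    simp only [e₂, ← eq_sweedler] at e₁
    conv_lhs => lhs; rw [eq_sweedler 𝖱]
    refine Eq.trans ?_ e₁.symm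
    simp only [tmul_sweedler, mul_sweedler, sweedler_mul, TensorProduct.tmul_smul,
      Algebra.TensorProduct.tmul_mul_tmul, mul_one, mul_smul_comm]
    rw [sweedler_swap]
    simp only [smul_sweedler]
  have e₂ : comul (R := k) (1 : H) * (1 ⊗ₜ (sweedler 𝖱 fun a b => counit (R := k) a • b)) =
      comul 1 := by
    rw [← Rinv_mul_R, mul_assoc, e]
  have e₃ := congrArg (fun X => sweedler X fun a b => counit (R := k) a • b) e₂
  rw [sweedler_mul_tmul] at e₃
  simp only [mul_one] at e₃
  rwa [sweedler_counit_left (f := fun a => a * _), sweedler_counit_left (f := fun a => a),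
    one_mul] at e₃

/-- `R⁽¹⁾ ⊗ ε_s(R⁽²⁾) = 1₁ ⊗ S(1₂)`. -/
theorem sweedler_R_source_right {F : H → H → V}
    (h₁ : ∀ b, IsLin k (fun a => F a b) := by fun_prop)
    (h₂ : ∀ a, IsLin k (fun b => F a b) := by fun_prop) :
    sweedler 𝖱 (fun a b => F a (sourceMap k b)) =
      sweedler (comul (R := k) (1 : H)) fun p q => F p (S q) := by
  have e : ∀ a b, F a (sourceMap k b) = sweedler (comul (R := k) (1 : H)) fun p q =>
      counit (R := k) (b * q) • F a p := by
    intro a b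
    rw [sourceMap_eq_sweedler, (h₂ a).sweedler_out]
    congr 1; ext p q
    exact (h₂ a).map_smul _ _
  simp only [e]
  -- In the form `S(1₂) ⊗ S(1₁)`, the target element `S(p)` to the right of `R⁽²⁾` becomes `p` to
  -- the right of `R⁽¹⁾`, and `ε(R⁽²⁾) R⁽¹⁾ = 1` finishes.
  rw [sweedler_swap, ← sweedler_one_antipode]
  refine sweedler_one_congr fun p q hp hq => ?_
  rw [sweedler_R_mul_target_right (targetMap_antipode_source hp)
    (F := fun a b => counit (R := k) b • F a (S q)), symm_antipode]
  have := congrArg (fun x => F (x * p) (S q)) (sweedler_counit_R_right (k := k) (H := H))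
  rw [((h₁ (S q)).comp (IsLin.mul_const .id p)).sweedler_out, one_mul] at this
  rw [← this]
  congr 1; ext a b
  rw [smul_mul_assoc]
  exact ((h₁ _).map_smul _ _).symm

/-- `ε_s(R⁽¹⁾) ⊗ R⁽²⁾ = 1₁ ⊗ 1₂`. -/
theorem sweedler_R_source_left {F : H → H → V}
    (h₁ : ∀ b, IsLin k (fun a => F a b) := by fun_prop)
    (h₂ : ∀ a, IsLin k (fun b => F a b) := by fun_prop) :
    sweedler 𝖱 (fun a b => F (sourceMap k a) b) = sweedler (comul (R := k) (1 : H)) F := by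
  have e : ∀ a b, F (sourceMap k a) b = sweedler (comul (R := k) (1 : H)) fun p q =>
      counit (R := k) (a * q) • F p b := by
    intro a b
    rw [sourceMap_eq_sweedler, (h₁ b).sweedler_out]
    congr 1; ext p q
    exact (h₁ b).map_smul _ _
  simp only [e]
  rw [sweedler_swap]
  refine sweedler_one_congr fun p q hp hq => ?_
  rw [sweedler_R_mul_target_left hq (F := fun a b => counit (R := k) a • F p b)]
  have := congrArg (fun x => F p (q * x)) (sweedler_counit_R_left (k := k) (H := H))
  rw [((h₂ p).comp (IsLin.const_mul .id q)).sweedler_out, mul_one] at this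
  rw [← this]
  congr 1; ext a b
  rw [mul_smul_comm]
  exact ((h₂ _).map_smul _ _).symm

/-- `ε_t(R⁽¹⁾) ⊗ R⁽²⁾ = 1₂ ⊗ 1₁`. -/
theorem sweedler_R_target_left {F : H → H → V}
    (h₁ : ∀ b, IsLin k (fun a => F a b) := by fun_prop)
    (h₂ : ∀ a, IsLin k (fun b => F a b) := by fun_prop) :
    sweedler 𝖱 (fun a b => F (targetMap k a) b) =
      sweedler (comul (R := k) (1 : H)) fun p q => F q p := by
  have e : ∀ a b, F (targetMap k a) b = sweedler (comul (R := k) (1 : H)) fun p q =>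
      counit (R := k) (p * a) • F q b := by
    intro a b
    rw [targetMap_eq_sweedler, (h₁ b).sweedler_out]
    congr 1; ext p q
    exact (h₁ b).map_smul _ _
  simp only [e]
  rw [sweedler_swap]
  refine sweedler_one_congr fun p q hp hq => ?_
  rw [← sweedler_R_mul_source_right hp (F := fun a b => counit (R := k) a • F q b)]
  have := congrArg (fun x => F q (x * p)) (sweedler_counit_R_left (k := k) (H := H))
  rw [((h₂ q).comp (IsLin.mul_const .id p)).sweedler_out, one_mul] at this
  rw [← this]
  congr 1; ext a b
  rw [smul_mul_assoc]
  exact ((h₂ _).map_smul _ _).symm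

/-- `R⁽¹⁾ h ⊗ R⁽²⁾ = h₂ R⁽¹⁾ ⊗ h₁ R⁽²⁾ S(h₃)`. -/
theorem sweedler_R_mul_left (h : H) {F : H → H → V}
    (h₁ : ∀ b, IsLin k (fun a => F a b) := by fun_prop)
    (h₂ : ∀ a, IsLin k (fun b => F a b) := by fun_prop) :
    sweedler 𝖱 (fun a b => F (a * h) b) = sweedler (comul (R := k) h) fun x w =>
      sweedler (comul (R := k) x) fun u v => sweedler 𝖱 fun a b => F (v * a) (u * b * S w) := by
  -- The factor `Δ(1)` absorbed by `R` turns `h ⊗ 1` into `1₁ h ⊗ 1₂ = h₁ ⊗ ε_t(h₂) = h₁ ⊗ h₂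
  -- S(h₃)`; the legs `h₁` and `h₂` then cross `R` by the intertwining relation.
  calc sweedler 𝖱 (fun a b => F (a * h) b)
      = sweedler 𝖱 (fun a b => sweedler (comul (R := k) (1 : H)) fun p q =>
          F (a * (p * h)) (b * q)) := by
        conv_lhs => rw [← R_mul_comul_one, sweedler_mul_tensor]
        simp only [mul_assoc]
    _ = sweedler 𝖱 (fun a b => sweedler (comul (R := k) h) fun u w =>
          sweedler (comul (R := k) w) fun v w => F (a * u) (b * (v * S w))) := by
        congr 1; ext a b
        rw [← sweedler_target_right h (F := fun x y => F (a * x) (b * y))]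
        congr 1; ext u w
        rw [← ((h₂ _).comp (IsLin.const_mul .id b)).sweedler_out, sweedler_mul_antipode]
    _ = sweedler 𝖱 (fun a b => sweedler (comul (R := k) h) fun x w =>
          sweedler (comul (R := k) x) fun u v => F (a * u) (b * (v * S w))) := by
        congr 1; ext a b
        rw [sweedler_coassoc h (F := fun u v w => F (a * u) (b * (v * S w)))]
    _ = _ := by
        rw [sweedler_swap]
        congr 1; ext x w
        simp only [← mul_assoc]
        rw [sweedler_comulOp_R x (F := fun a b => F a (b * S w))]
        exact sweedler_swap _ _ _

end QuasitriangularQuantumGroupoid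

/-! ### The braided structure maps as formulas in `H` -/

namespace QuasitriangularQuantumGroupoid
open WeakBialgebra QuantumGroupoid

variable {k : Type v} {H : Type u} {V : Type*} [Field k] [Ring H] [Algebra k H]
  [QuasitriangularQuantumGroupoid k H] [AddCommGroup V] [Module k V]

local notation "S" => antipode (k := k)
local notation "S⁻¹" => LinearEquiv.symm (antipodeEquiv (k := k))
local notation "Ad" => adjoint k H
local notation "𝖱" => R (k := k) (H := H)

theorem braidedComul_eq_sweedler (g : H) : braidedComul k H g =
    sweedler (comul (R := k) g) fun a b => sweedler 𝖱 fun c d => (a * S d) ⊗ₜ Ad c b := by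
  rw [braidedComul]
  conv_lhs => rw [eq_sweedler (comul (R := k) g), map_sweedler,
    ← LinearMap.applyₗ_apply_apply (R := k), map_sweedler]
  congr 1; ext a b
  rw [LinearMap.applyₗ_apply_apply]
  conv_lhs => rw [eq_sweedler 𝖱, map_sweedler, map_sweedler]
  rfl

theorem sweedler_braidedComul (g : H) {F : H → H → V}
    (h₁ : ∀ b, IsLin k (fun a => F a b) := by fun_prop)
    (h₂ : ∀ a, IsLin k (fun b => F a b) := by fun_prop) :
    sweedler (braidedComul k H g) F =
      sweedler (comul (R := k) g) fun a b => sweedler 𝖱 fun c d => F (a * S d) (Ad c b) := by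
  rw [braidedComul_eq_sweedler, sweedler_sweedler _ _ h₁ h₂]
  congr 1; ext a b
  rw [sweedler_sweedler _ _ h₁ h₂]
  congr 1; ext c d
  rw [sweedler_tmul _ _ h₁ h₂]

@[fun_prop] theorem isLin_braidedComul : IsLin k (fun g : H => braidedComul k H g) := by
  simp only [braidedComul_eq_sweedler]
  fun_prop

theorem braidedAntipode_eq_sweedler (g : H) : braidedAntipode k H g =
    sweedler 𝖱 fun a b => b * S (Ad a g) := by
  rw [braidedAntipode]
  conv_lhs => rw [eq_sweedler 𝖱, map_sweedler, map_sweedler, map_sweedler]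
  rfl

@[fun_prop] theorem isLin_braidedAntipode : IsLin k (fun g : H => braidedAntipode k H g) := by
  simp only [braidedAntipode_eq_sweedler]
  fun_prop

/-- Anti-comultiplicativity of `S` nests the factors: `h₁ g₁ S(h₄) ⊗ h₂ g₂ S(h₃)`, so that an
adjoint action of the inner pair is visible in the second leg. -/
theorem sweedler_comul_adjoint (h g : H) {F : H → H → V}
    (h₁ : ∀ b, IsLin k (fun a => F a b) := by fun_prop)
    (h₂ : ∀ a, IsLin k (fun b => F a b) := by fun_prop) :
    sweedler (comul (R := k) (Ad h g)) F =
      sweedler (comul (R := k) g) fun a b => sweedler (comul (R := k) h) fun p q =>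
        sweedler (comul (R := k) p) fun p₁ p₂ => sweedler (comul (R := k) q) fun q₁ q₂ =>
          F (p₁ * a * S q₂) (p₂ * b * S q₁) := by
  rw [adjoint_eq_sweedler, map_sweedler, sweedler_sweedler _ _ h₁ h₂]
  rw [sweedler_swap]
  congr 1; ext p q
  rw [sweedler_comul_mul _ _ h₁ h₂, sweedler_comul_mul, sweedler_swap]
  congr 1; ext a b
  congr 1; ext p₁ p₂
  rw [sweedler_comul_antipode]

/-- `Δ̂(Ad_h(g)) = Ad_{h₁} ⊗ Ad_{h₂} (Δ̂(g))`. -/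
theorem braidedComul_adjoint (h g : H) : braidedComul k H (Ad h g) =
    sweedler (comul (R := k) h) fun p q => sweedler (braidedComul k H g) fun m n =>
      Ad p m ⊗ₜ Ad q n := by
  have e : ∀ p q, (sweedler (braidedComul k H g) fun m n => Ad p m ⊗ₜ[k] Ad q n) =
      sweedler (comul (R := k) g) fun a b => sweedler 𝖱 fun c d =>
        Ad p (a * S d) ⊗ₜ[k] Ad q (Ad c b) := fun p q => sweedler_braidedComul g
  simp only [e]
  rw [braidedComul_eq_sweedler, sweedler_comul_adjoint, sweedler_swap]
  conv_rhs => rw [sweedler_swap]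
  rw [sweedler_swap]
  congr 1; ext a b
  -- The inner pair acts as `Ad_{h₂}` on `b` and fuses with `Ad_{R⁽¹⁾}`, while `S(h₃)` fuses with
  -- `S(R⁽²⁾)`. The intertwining relation then replaces `R⁽¹⁾h₂ ⊗ R⁽²⁾h₃` by `h₃R⁽¹⁾ ⊗ h₂R⁽²⁾`,
  -- which brings the legs of `h` into the order required on the right.
  calc _ = sweedler (comul (R := k) h) (fun p₁ x => sweedler (comul (R := k) x) fun p₂ q =>
          sweedler (comul (R := k) q) fun q₁ q₂ => sweedler 𝖱 fun c d =>
          (p₁ * a * S q₂ * S d) ⊗ₜ[k] Ad c (p₂ * b * S q₁)) := by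
        rw [sweedler_coassoc h (F := fun p₁ p₂ q =>
          sweedler (comul (R := k) q) fun q₁ q₂ => sweedler 𝖱 fun c d =>
          (p₁ * a * S q₂ * S d) ⊗ₜ[k] Ad c (p₂ * b * S q₁))]
    _ = sweedler (comul (R := k) h) (fun p₁ x => sweedler (comul (R := k) x) fun y q₂ =>
          sweedler (comul (R := k) y) fun p₂ q₁ => sweedler 𝖱 fun c d =>
          (p₁ * a * S q₂ * S d) ⊗ₜ[k] Ad c (p₂ * b * S q₁)) := by
        congr 1; ext p₁ x
        rw [sweedler_coassoc x (F := fun p₂ q₁ q₂ => sweedler 𝖱 fun c d =>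
          (p₁ * a * S q₂ * S d) ⊗ₜ[k] Ad c (p₂ * b * S q₁))]
    _ = sweedler (comul (R := k) h) (fun p₁ x => sweedler 𝖱 fun c d =>
          sweedler (comul (R := k) x) fun y q => (p₁ * a * S (d * q)) ⊗ₜ[k] Ad (c * y) b) := by
        congr 1; ext p₁ x
        rw [sweedler_swap]
        congr 1; ext y q
        rw [sweedler_swap]
        simp only [← tmul_sweedler, ← map_sweedler, ← adjoint_eq_sweedler]
        simp only [adjoint_mul, antipode_mul, mul_assoc]
    _ = sweedler (comul (R := k) h) (fun p₁ x => sweedler (comul (R := k) x) fun y q =>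
          sweedler 𝖱 fun c d => (p₁ * (a * S d) * S y) ⊗ₜ[k] Ad q (Ad c b)) := by
        congr 1; ext p₁ x
        rw [sweedler_comulOp_R x (F := fun u v => (p₁ * a * S v) ⊗ₜ[k] Ad u b)]
        simp only [adjoint_mul, antipode_mul, mul_assoc]
        exact sweedler_swap _ _ _
    _ = _ := by
        rw [← sweedler_coassoc h (F := fun p₁ y q =>
          sweedler 𝖱 fun c d => (p₁ * (a * S d) * S y) ⊗ₜ[k] Ad q (Ad c b))]
        congr 1; ext p q
        rw [sweedler_swap]
        simp only [← sweedler_tmul_const, ← adjoint_eq_sweedler]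

/-- `Δ̂` is coassociative. -/
theorem braidedComul_coassoc (g : H) :
    sweedler (braidedComul k H g) (fun m n => m ⊗ₜ[k] braidedComul k H n) =
      sweedler (braidedComul k H g) fun m n =>
        TensorProduct.assoc k H H H (braidedComul k H m ⊗ₜ n) := by
  rw [sweedler_braidedComul, sweedler_braidedComul]
  -- Both sides become one sum over three copies of `R`. On the left, equivariance of `braidedComul`
  -- produces `Δ(R⁽¹⁾)`, hence `R₁₃R₂₃`. On the right, `Δ(S(R⁽²⁾))` leads to `R₁₃R₁₂`.
  calc _ = sweedler (comul (R := k) g) (fun a b => sweedler (comul (R := k) b) fun b₁ b₂ =>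
        sweedler 𝖱 fun x y => sweedler 𝖱 fun x' y' => sweedler 𝖱 fun p d =>
          (a * S y * S d) ⊗ₜ[k] (Ad p (b₁ * S y') ⊗ₜ[k] Ad x (Ad x' b₂))) := by
        congr 1; ext a b
        simp only [braidedComul_adjoint]
        have e : ∀ p q, (sweedler (braidedComul k H b) fun m n => Ad p m ⊗ₜ[k] Ad q n) =
            sweedler (comul (R := k) b) fun a b => sweedler 𝖱 fun c d =>
              Ad p (a * S d) ⊗ₜ[k] Ad q (Ad c b) := fun p q => sweedler_braidedComul b
        simp only [e, tmul_sweedler]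
        rw [sweedler_R_comul_left (F := fun p q d => sweedler (comul (R := k) b) fun b₁ b₂ =>
          sweedler 𝖱 fun x' y' => (a * S d) ⊗ₜ[k] (Ad p (b₁ * S y') ⊗ₜ[k] Ad q (Ad x' b₂)))]
        rw [sweedler_swap]
        conv_rhs => rw [sweedler_swap]
        congr 1; ext x y
        rw [sweedler_swap]
        congr 1; ext b₁ b₂
        rw [sweedler_swap]
        simp only [antipode_mul, mul_assoc]
    _ = sweedler (comul (R := k) g) (fun z b => sweedler (comul (R := k) z) fun a b₁ =>
        sweedler 𝖱 fun x y => sweedler 𝖱 fun x' y' => sweedler 𝖱 fun p d =>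
          (a * S y * S d) ⊗ₜ[k] (Ad p (b₁ * S y') ⊗ₜ[k] Ad x (Ad x' b))) := by
        rw [sweedler_coassoc g (F := fun a b₁ b => sweedler 𝖱 fun x y => sweedler 𝖱 fun x' y' =>
          sweedler 𝖱 fun p d =>
          (a * S y * S d) ⊗ₜ[k] (Ad p (b₁ * S y') ⊗ₜ[k] Ad x (Ad x' b)))]
    _ = _ := by
        congr 1; ext z b
        have e : ∀ c d, TensorProduct.assoc k H H H (braidedComul k H (z * S d) ⊗ₜ[k] Ad c b) =
            sweedler (comul (R := k) z) fun a b₁ => sweedler (comul (R := k) d) fun d₁ d₂ =>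
              sweedler 𝖱 fun p q => (a * S d₂ * S q) ⊗ₜ[k] (Ad p (b₁ * S d₁) ⊗ₜ[k] Ad c b) := by
          intro c d
          rw [braidedComul_eq_sweedler, sweedler_comul_mul, sweedler_tmul_const, map_sweedler]
          congr 1; ext a b₁
          rw [sweedler_comul_antipode, sweedler_tmul_const, map_sweedler]
          congr 1; ext d₁ d₂
          rw [sweedler_tmul_const, map_sweedler]
          rfl
        simp only [e]
        conv_rhs => rw [sweedler_swap]
        congr 1; ext a b₁
        rw [sweedler_R_comul_right (F := fun c d₁ d₂ => sweedler 𝖱 fun p q =>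
          (a * S d₂ * S q) ⊗ₜ[k] (Ad p (b₁ * S d₁) ⊗ₜ[k] Ad c b))]
        simp only [adjoint_mul]

theorem incl_mem (c : SourceCentralizer k H) :
    SourceCentralizer.incl k H c ∈ sourceCentralizer k H := c.2

/-- `Δ̂` is multiplicative for the braided product on `C_H(H_s) ⊗ C_H(H_s)`. -/
theorem braidedComul_mul (g l : SourceCentralizer k H)
    {Y : SourceCentralizer k H ⊗[k] SourceCentralizer k H}
    (hY : TensorProduct.map (SourceCentralizer.incl k H) (SourceCentralizer.incl k H) Y =
      braidedComul k H (SourceCentralizer.incl k H l)) :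
    sweedler (braidedComul k H (SourceCentralizer.incl k H g)) (fun a b => sweedler Y fun m n =>
      sweedler 𝖱 fun c d => (a * Ad d (SourceCentralizer.incl k H m)) ⊗ₜ[k]
        (Ad c b * SourceCentralizer.incl k H n)) =
      braidedComul k H (SourceCentralizer.incl k H g * SourceCentralizer.incl k H l) := by
  rw [sweedler_braidedComul, braidedComul_eq_sweedler (_ * _), sweedler_comul_mul]
  congr 1; ext a b
  -- `R₁₃R₁₂` merges the copy of `R` in the comultiplication of `g` with the braiding, so that `S(s)
  -- Ad_t(m)` appears with `s ⊗ t = Δ(R⁽²⁾)`. This equals `m S(R⁽²⁾)` only because `m` lies in the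
  -- centralizer, which is why the comultiplication of `l` is represented by `Y` in `C ⊗ C`.
  calc _ = sweedler Y (fun m n => sweedler 𝖱 fun x y =>
          (a * (SourceCentralizer.incl k H m * S y)) ⊗ₜ[k]
            (Ad x b * SourceCentralizer.incl k H n)) := by
        rw [sweedler_swap]
        congr 1; ext m n
        have e : ∀ x y, sweedler (comul (R := k) y) (fun s t =>
            (a * S s * Ad t (SourceCentralizer.incl k H m)) ⊗ₜ[k]
              (Ad x b * SourceCentralizer.incl k H n)) =
            (a * (SourceCentralizer.incl k H m * S y)) ⊗ₜ[k]
              (Ad x b * SourceCentralizer.incl k H n) := by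
          intro x y
          rw [← sweedler_antipode_mul_adjoint y (incl_mem m)]
          simp only [mul_sweedler, sweedler_tmul_const, mul_assoc]
        simp only [← e]
        rw [sweedler_R_comul_right (F := fun x s t =>
          (a * S s * Ad t (SourceCentralizer.incl k H m)) ⊗ₜ[k]
              (Ad x b * SourceCentralizer.incl k H n)), sweedler_swap]
        simp only [adjoint_mul]
    _ = sweedler (comul (R := k) (SourceCentralizer.incl k H l)) (fun a' b' =>
          sweedler 𝖱 fun c' d' => sweedler 𝖱 fun x y =>
          (a * (a' * S d' * S y)) ⊗ₜ[k] (Ad x b * Ad c' b')) := by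
        rw [← sweedler_braidedComul _ (F := fun m n => sweedler 𝖱 fun x y =>
          (a * (m * S y)) ⊗ₜ[k] (Ad x b * n)), ← hY, sweedler_map]
    _ = _ := by
        -- What remains is `Ad_h(b b') = Ad_{h₁}(b) Ad_{h₂}(b')` for `h = R⁽¹⁾`, combined with
        -- `R₁₃R₂₃`; the product rule needs `b'` in the centralizer.
        refine sweedler_comul_congr (incl_mem l) fun a' b' hb' => ?_
        rw [sweedler_swap]
        simp only [← sweedler_adjoint_mul_adjoint _ b hb', tmul_sweedler]
        rw [sweedler_R_comul_left (F := fun x c' d => (a * a' * S d) ⊗ₜ[k] (Ad x b * Ad c' b'))]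
        simp only [antipode_mul, mul_assoc]

/-- `ε_t(m) n = g` for `Δ̂(g) = m ⊗ n`. -/
theorem sweedler_braidedComul_targetMap_mul {g : H} (hg : g ∈ sourceCentralizer k H) :
    sweedler (braidedComul k H g) (fun m n => targetMap k m * n) = g := by
  rw [sweedler_braidedComul]
  calc _ = sweedler (comul (R := k) g) (fun a b => sweedler (comul (R := k) (1 : H)) fun p q =>
          targetMap k (a * p) * (b * q)) := by
        refine sweedler_comul_congr hg fun a b hb => ?_
        -- Under `ε_t`, `S(R⁽²⁾)` becomes `ε_s(R⁽²⁾)`, so the copy of `R` degenerates to `1₁ ⊗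
        -- S(1₂)`. Since `Ad_p(b) = b S(p)` for `p` in `H_s`, the outcome is `g₁ ⊗ g₂` multiplied by
        -- `Δ(1)` on the right.
        simp only [targetMap_mul_antipode]
        rw [sweedler_R_source_right (F := fun c d => targetMap k (a * d) * Ad c b),
          ← sweedler_one_antipode (F := fun p q => targetMap k (a * p) * (b * q))]
        refine sweedler_one_congr fun p q hp hq => ?_
        rw [adjoint_source_left hp hb]
    _ = sweedler (comul (R := k) g) (fun a b => targetMap k a * b) := by
        conv_rhs => rw [← comul_mul_comul_one, sweedler_mul_tensor]
    _ = g := sweedler_target_mul g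

/-- `m ε_t(n) = g` for `Δ̂(g) = m ⊗ n`. -/
theorem sweedler_braidedComul_mul_targetMap {g : H} (hg : g ∈ sourceCentralizer k H) :
    sweedler (braidedComul k H g) (fun m n => m * targetMap k n) = g := by
  rw [sweedler_braidedComul]
  calc _ = sweedler (comul (R := k) g) (fun a b => sweedler 𝖱 fun c d =>
          a * S d * targetMap k (c * targetMap k b)) := by
        refine sweedler_comul_congr hg fun a b hb => ?_
        simp only [targetMap_adjoint _ hb, targetMap_mul_targetMap]
    _ = sweedler (comul (R := k) (1 : H)) (fun p q => p * g * S q) := by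
        -- Replacing `g₁ ⊗ ε_t(g₂)` by `1₁ g ⊗ 1₂` leaves a target element next to `R⁽¹⁾`. It moves
        -- to `R⁽²⁾`, after which `ε_t(R⁽¹⁾) ⊗ R⁽²⁾ = 1₂ ⊗ 1₁` eliminates `R`.
        rw [sweedler_target_right g (F := fun a b => sweedler 𝖱 fun c d =>
          a * S d * targetMap k (c * b))]
        refine sweedler_one_congr fun p q hp hq => ?_
        rw [sweedler_R_mul_target_left hq (F := fun c d => p * g * S d * targetMap k c),
          sweedler_R_target_left (F := fun c d => p * g * S (q * d) * c)]
        have e : sweedler (comul (R := k) (1 : H)) (fun r s => S r * s) = 1 := by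
          rw [sweedler_antipode_mul, sourceMap_one]
        conv_rhs => rw [← mul_one (p * g), ← e]
        simp only [mul_sweedler, sweedler_mul]
        refine sweedler_one_congr fun r s hr hs => ?_
        -- `S(q)` lies in `H_s` and `s` in `H_t`, so they commute; the pair `S(r) s` sums to `1`,
        -- and `p g S(q)` sums to `Ad_1(g)`.
        rw [antipode_mul, mul_assoc, mul_assoc (S r),
          source_mul_target (sourceMap_antipode_target hq) hs]
        simp only [mul_assoc]
    _ = g := by rw [← adjoint_eq_sweedler, adjoint_one_mem hg]

/-- `Δ̂(z) = S(1₁) ⊗ 1₂ z` for `z` in the target space. -/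
theorem braidedComul_target {z : H} (hz : targetMap k z = z) : braidedComul k H z =
    sweedler (comul (R := k) (1 : H)) fun p q => S p ⊗ₜ (q * z) := by
  rw [braidedComul_eq_sweedler]
  conv_lhs => rw [← mul_one z, sweedler_comul_target_mul hz]
  have e : sweedler (comul (R := k) (1 : H)) (fun p q => p * S q) = 1 := by
    rw [sweedler_mul_antipode, targetMap_one]
  calc _ = sweedler (comul (R := k) (1 : H)) (fun a b => sweedler (comul (R := k) (1 : H))
          fun p q => (z * (a * S b) * S p) ⊗ₜ[k] q) := by
        refine sweedler_one_congr fun a b ha hb => ?_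
        -- The second leg `b` of `Δ(1)` is a target element, so `Ad` is `ε_t` of a product and `R`
        -- degenerates as in the preceding proof.
        simp only [adjoint_target _ hb]
        rw [sweedler_R_mul_target_left hb (F := fun c d => (z * a * S d) ⊗ₜ[k] targetMap k c),
          sweedler_R_target_left (F := fun c d => (z * a * S (b * d)) ⊗ₜ[k] c)]
        refine sweedler_one_congr fun p q hp hq => ?_
        rw [antipode_mul, ← source_mul_target (sourceMap_antipode_target hb)
          (targetMap_antipode_source hp)]
        simp only [mul_assoc]
    _ = sweedler (comul (R := k) (1 : H)) (fun p q => (z * S p) ⊗ₜ[k] q) := by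
        rw [sweedler_swap]
        simp only [← sweedler_tmul_const, ← sweedler_mul, ← mul_sweedler, e, mul_one]
    _ = _ := by
        rw [sweedler_mul_target hz 1 (F := fun p q => S p ⊗ₜ[k] q)]
        simp only [antipode_mul, antipode_symm]

/-- The antipode `Ŝ` is equivariant. -/
theorem braidedAntipode_adjoint (h g : H) :
    braidedAntipode k H (Ad h g) = Ad h (braidedAntipode k H g) := by
  simp only [braidedAntipode_eq_sweedler, ← adjoint_mul]
  -- Moving `h` from the right of `R⁽¹⁾` creates `S(h₃)`, which joins `Ad_{h₂}` under one antipode;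
  -- `Ad_{h₂}(x) h₃ = h₂ x` for `x = Ad_{R⁽¹⁾}(g)`, which lies in the centralizer for every `g`.
  calc _ = sweedler (comul (R := k) h) (fun x w => sweedler (comul (R := k) x) fun u v =>
          sweedler 𝖱 fun a b => u * b * S (Ad v (Ad a g) * w)) := by
        rw [sweedler_R_mul_left h (F := fun a b => b * S (Ad a g))]
        simp only [adjoint_mul, antipode_mul, mul_assoc]
    _ = sweedler (comul (R := k) h) (fun u x => sweedler (comul (R := k) x) fun v w =>
          sweedler 𝖱 fun a b => u * b * S (Ad v (Ad a g) * w)) := by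
        rw [sweedler_coassoc h (F := fun u v w => sweedler 𝖱 fun a b =>
          u * b * S (Ad v (Ad a g) * w))]
    _ = sweedler (comul (R := k) h) (fun u x => sweedler 𝖱 fun a b => u * b * S (x * Ad a g)) := by
        congr 1; ext u x
        rw [sweedler_swap]
        simp only [← mul_sweedler, ← map_sweedler, sweedler_adjoint_mul _ (adjoint_mem _ g)]
    _ = _ := by
        simp only [adjoint_eq_sweedler h, antipode_mul, mul_sweedler, sweedler_mul, mul_assoc]

variable (k H) in
/-- The element `R⁽²⁾ S²(R⁽¹⁾)`, inverse to the Drinfeld element. -/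
noncomputable def drinfeldInv : H := sweedler 𝖱 fun a b => b * S (S a)

/-- After `x` crosses `R`, a pair `S(x₂) x₃ = ε_s(x₂)` forms inside an antipode. Via `x₁ ⊗ ε_s(x₂) =
x 1₁ ⊗ S(1₂)` it contributes `Δᵒᵖ(1)`, which `R` absorbs. The relation serves to eliminate `S²` in
the antipode axiom. -/
theorem drinfeldInv_mul (x : H) : drinfeldInv k H * S (S x) = x * drinfeldInv k H := by
  have e : sweedler (comul (R := k) (1 : H)) (fun p q => sweedler 𝖱 fun a b =>
      (p * b) * S (S (q * a))) = drinfeldInv k H := by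
    rw [drinfeldInv]
    conv_rhs => rw [← comulOp_one_mul_R, sweedler_mul_tensor, sweedler_tensorComm]
  calc drinfeldInv k H * S (S x) = sweedler 𝖱 fun a b => b * S (S (a * x)) := by
        simp only [drinfeldInv, sweedler_mul, antipode_mul, mul_assoc]
    _ = sweedler (comul (R := k) x) (fun z w => sweedler (comul (R := k) z) fun u v =>
          sweedler 𝖱 fun a b => u * b * S (S a * (S v * w))) := by
        rw [sweedler_R_mul_left x (F := fun a b => b * S (S a))]
        simp only [antipode_mul, mul_assoc]
    _ = sweedler (comul (R := k) x) (fun u z => sweedler 𝖱 fun a b =>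
          u * b * S (S a * sourceMap k z)) := by
        rw [sweedler_coassoc x (F := fun u v w => sweedler 𝖱 fun a b =>
          u * b * S (S a * (S v * w)))]
        congr 1; ext u z
        rw [sweedler_swap]
        simp only [← mul_sweedler, ← map_sweedler, sweedler_antipode_mul]
    _ = x * drinfeldInv k H := by
        rw [sweedler_source_right x (F := fun u z => sweedler 𝖱 fun a b => u * b * S (S a * z)),
          ← e]
        simp only [mul_sweedler, antipode_mul, mul_assoc]

/-- `Δ(R⁽¹⁾)` splits `R` into two copies; the one attached to the right factor of `Ad` assembles
into `R⁽²⁾ S²(R⁽¹⁾)`. The adjoint action disappears from the formula. -/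
theorem braidedAntipode_eq (g : H) : braidedAntipode k H g =
    sweedler 𝖱 fun a b => b * drinfeldInv k H * S g * S a := by
  simp only [braidedAntipode_eq_sweedler, adjoint_eq_sweedler, map_sweedler, mul_sweedler]
  rw [sweedler_R_comul_left (F := fun c d b => b * S (c * g * S d))]
  simp only [drinfeldInv, mul_sweedler, sweedler_mul, antipode_mul, mul_assoc]

/-- For target `z` the adjoint action is `ε_t(R⁽¹⁾ z)`, and `R` degenerates to `1₂ ⊗ 1₁`, leaving `z
1₁ S(1₂)`. This evaluates the last expression in the antipode axiom. -/
theorem braidedAntipode_target {z : H} (hz : targetMap k z = z) : braidedAntipode k H z = z := by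
  have e : sweedler (comul (R := k) (1 : H)) (fun p q => p * S q) = 1 := by
    rw [sweedler_mul_antipode, targetMap_one]
  simp only [braidedAntipode_eq_sweedler, adjoint_target _ hz]
  rw [sweedler_R_mul_target_left hz (F := fun a b => b * S (targetMap k a)),
    sweedler_R_target_left (F := fun a b => z * b * S a)]
  simp only [mul_assoc, ← mul_sweedler, e, mul_one]

/-- `m Ŝ(n) = ε_t(g)` for `Δ̂(g) = m ⊗ n`. -/
theorem sweedler_braidedComul_mul_antipode {g : H} (hg : g ∈ sourceCentralizer k H) :
    sweedler (braidedComul k H g) (fun m n => m * braidedAntipode k H n) = targetMap k g := by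
  rw [sweedler_braidedComul, ← sweedler_mul_antipode]
  refine sweedler_comul_congr hg fun a b hb => ?_
  simp only [braidedAntipode_eq_sweedler, ← adjoint_mul, mul_sweedler]
  -- The two copies of `R`, one from the comultiplication and one from the antipode, recombine into
  -- `R⁽¹⁾ ⊗ Δ(R⁽²⁾)`, and `S(s) t` sums to `ε_s(R⁽²⁾)`.
  rw [sweedler_swap, ← sweedler_R_comul_right (F := fun x s t => a * S s * (t * S (Ad x b)))]
  have e : ∀ x y, sweedler (comul (R := k) y) (fun s t => a * S s * (t * S (Ad x b))) =
      a * sourceMap k y * S (Ad x b) := by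
    intro x y
    simp only [← sweedler_antipode_mul, mul_sweedler, sweedler_mul, mul_assoc]
  simp only [e]
  rw [sweedler_R_source_right (F := fun x y => a * y * S (Ad x b))]
  have e₁ : sweedler (comul (R := k) (1 : H)) (fun p q => S p * q) = 1 := by
    rw [sweedler_antipode_mul, sourceMap_one]
  calc _ = sweedler (comul (R := k) (1 : H)) fun p q => a * S (S p * q) * S b := by
        refine sweedler_one_congr fun p q hp hq => ?_
        rw [adjoint_source_left hp hb]
        simp only [antipode_mul, mul_assoc]
    _ = _ := by
        simp only [← sweedler_mul, ← mul_sweedler, ← map_sweedler, e₁, antipode_one, mul_one]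

/-- `Ŝ(m) n = ε_t(g)` for `Δ̂(g) = m ⊗ n`. -/
theorem sweedler_braidedComul_antipode_mul {g : H} (hg : g ∈ sourceCentralizer k H) :
    sweedler (braidedComul k H g) (fun m n => braidedAntipode k H m * n) = targetMap k g := by
  rw [sweedler_braidedComul]
  calc _ = sweedler (comul (R := k) g) (fun a b => sweedler (comul (R := k) (1 : H)) fun p q =>
          sweedler 𝖱 fun c d => q * d * drinfeldInv k H * (S a * b) * p * S c) := by
        refine sweedler_comul_congr hg fun a b hb => ?_
        calc _ = sweedler 𝖱 (fun c d => sweedler (comul (R := k) c) fun c₁ c₂ =>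
                sweedler 𝖱 fun e f =>
                  f * d * drinfeldInv k H * S a * (S e * c₁) * b * S c₂) := by
              -- The first leg is `a S(d)`, so `S²(d)` stands to the right of `u = R⁽²⁾ S²(R⁽¹⁾)`
              -- and passes to its left as `d`.
              have e : ∀ d, braidedAntipode k H (a * S d) = sweedler 𝖱 fun e f =>
                  f * d * drinfeldInv k H * S a * S e := by
                intro d
                simp only [braidedAntipode_eq, antipode_mul, mul_assoc]
                simp only [← mul_assoc (drinfeldInv k H) (S (S d)), drinfeldInv_mul, mul_assoc]
              simp only [e, adjoint_eq_sweedler, mul_sweedler, sweedler_mul, mul_assoc]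
          -- `R₁₃R₂₃` is read twice: it first splits off the copy `c' ⊗ d'` and then fuses the two
          -- others, so that `S(e) c` becomes `ε_s(R⁽¹⁾)` and that copy degenerates to `Δ(1)`.
          _ = sweedler 𝖱 (fun c' d' => sweedler 𝖱 fun x y => sweedler (comul (R := k) x) fun e c =>
                y * d' * drinfeldInv k H * S a * (S e * c) * b * S c') := by
              rw [sweedler_R_comul_left (F := fun c c' d => sweedler 𝖱 fun e f =>
                  f * d * drinfeldInv k H * S a * (S e * c) * b * S c'), sweedler_swap]
              congr 1; ext c' d'
              rw [sweedler_R_comul_left (F := fun e c y =>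
                y * d' * drinfeldInv k H * S a * (S e * c) * b * S c'), sweedler_swap]
              simp only [mul_assoc]
          _ = sweedler 𝖱 (fun c' d' => sweedler (comul (R := k) (1 : H)) fun p q =>
                q * d' * drinfeldInv k H * S a * p * b * S c') := by
              congr 1; ext c' d'
              simp only [← mul_sweedler, ← sweedler_mul, sweedler_antipode_mul]
              rw [sweedler_R_source_left (F := fun p q => q * d' * drinfeldInv k H * S a * p)]
          _ = _ := by
              -- The leg `p` in `H_s` commutes past `b`, which brings `S(a)` and `b` together; they
              -- will sum to `ε_s(g)`.
              rw [sweedler_swap]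
              refine sweedler_one_congr fun p q hp hq => ?_
              simp only [mul_assoc]
              simp only [← mul_assoc p, source_mul_comm hb hp]
              simp only [mul_assoc]
    _ = sweedler (comul (R := k) (1 : H)) (fun p q =>
          q * braidedAntipode k H (S⁻¹ p * S⁻¹ (sourceMap k g))) := by
        -- With `S(g₁) g₂ = ε_s(g)`, the remaining sum over `R` is the formula of
        -- `braidedAntipode_eq` at the element whose antipode is `ε_s(g) p`. That element lies in
        -- `H_t`, so the braided antipode fixes it.
        rw [sweedler_swap]
        congr 1; ext p q
        rw [sweedler_swap]
        simp only [braidedAntipode_eq, ← sweedler_mul, ← mul_sweedler, sweedler_antipode_mul]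
        simp only [mul_sweedler, antipode_mul, antipode_symm, mul_assoc]
    _ = sweedler (comul (R := k) (1 : H)) (fun p q =>
          S⁻¹ (p * S q) * S⁻¹ (sourceMap k g)) := by
        refine sweedler_one_congr fun p q hp hq => ?_
        rw [braidedAntipode_target, symm_mul, symm_antipode, mul_assoc]
        rw [← targetMap_symm hp, targetMap_target_mul, targetMap_symm (sourceMap_sourceMap g)]
    _ = _ := by
        rw [← sweedler_mul, ← map_sweedler, sweedler_mul_antipode, targetMap_one,
          ← antipode_targetMap_of_mem hg, symm_antipode, ← antipode_one (k := k), symm_antipode,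
          one_mul]

end QuasitriangularQuantumGroupoid

/-! ### Morphisms and associator of `⊗_t` as restrictions of the ordinary ones -/

section tensorAct
variable {k H V W : Type*} [Field k] [Ring H] [Algebra k H]
  [AddCommGroup V] [Module k V] [Module H V] [IsScalarTower k H V]
  [AddCommGroup W] [Module k W] [Module H W] [IsScalarTower k H W]

theorem tensorAct_eq_sweedler (X : H ⊗[k] H) (x : V ⊗[k] W) :
    tensorAct k H V W X x = sweedler X fun p q => tensorAct k H V W (p ⊗ₜ q) x := by
  conv_lhs => rw [eq_sweedler X, map_sweedler]
  rw [sweedler, LinearMap.sum_apply]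
  rfl

theorem tensorAct_tmul_eq_sweedler (p q : H) (x : V ⊗[k] W) :
    tensorAct k H V W (p ⊗ₜ q) x = sweedler x fun m n => (p • m) ⊗ₜ[k] (q • n) := by
  conv_lhs => rw [eq_sweedler x, map_sweedler]
  rfl

end tensorAct

namespace TensorT
variable {k H : Type*} {U V W V' W' : Type*} [Field k] [Ring H] [Algebra k H] [WeakBialgebra k H]
  [AddCommGroup U] [Module k U] [Module H U] [IsScalarTower k H U]
  [AddCommGroup V] [Module k V] [Module H V] [IsScalarTower k H V]
  [AddCommGroup W] [Module k W] [Module H W] [IsScalarTower k H W]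
  [AddCommGroup V'] [Module k V'] [Module H V'] [IsScalarTower k H V']
  [AddCommGroup W'] [Module k W'] [Module H W'] [IsScalarTower k H W']

/-- `H`-linear maps commute with the action of `Δ(1)`, so the projection in the definition of
`TensorT.map` has no effect on elements of `V ⊗_t W`. -/
theorem incl_map (f : V →ₗ[H] V') (g : W →ₗ[H] W') (x : TensorT k H V W) :
    incl k H V' W' (map f g x) =
      TensorProduct.map (f.restrictScalars k) (g.restrictScalars k) (incl k H V W x) := by
  change incl k H V' W' (proj k H V' W' _) = _
  rw [incl_proj]
  change tensorAct k H V' W' (comul 1) (TensorProduct.map (f.restrictScalars k)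
    (g.restrictScalars k) (incl k H V W x)) = _
  rw [← tensorAct_map, tensorAct_incl]

/-- The projections in the definition of the associator act as `Δ²(1)(1 ⊗ Δ(1)) = Δ²(1)`, which
fixes the elements in question. Coassociativity can therefore be checked with the usual associator.
-/
theorem incl_assocHom (x : TensorT k H (TensorT k H U V) W) :
    (incl k H V W).lTensor U (incl k H U (TensorT k H V W) (assocHom x)) =
      TensorProduct.assoc k U V W ((incl k H U V).rTensor W (incl k H (TensorT k H U V) W x)) := by
  set y := TensorProduct.assoc k U V W ((incl k H U V).rTensor W (incl k H (TensorT k H U V) W x))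
    with hy
  have e₁ : incl k H U (TensorT k H V W) (assocHom x) =
      tensorAct k H U (TensorT k H V W) (comul 1) ((proj k H V W).lTensor U y) := rfl
  have e₂ : ∀ w : U ⊗[k] (V ⊗[k] W), (incl k H V W).lTensor U ((proj k H V W).lTensor U w) =
      tensorActR k H U V W (1 ⊗ₜ comul 1) w := by
    intro w
    induction w using tensor_induction with
    | tmul u w => simp [incl_proj]
    | add w w' h h' => simp only [map_add, h, h']
  have e₃ : comul.lTensor H (comul (R := k) (1 : H)) * ((1 : H) ⊗ₜ[k] comul (R := k) (1 : H)) =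
      comul.lTensor H (comul (R := k) (1 : H)) := by
    rw [WeakBialgebra.comul_comul_one', mul_assoc, Algebra.TensorProduct.tmul_mul_tmul,
      WeakBialgebra.comul_mul_comul_one, one_mul]
  have e₄ : tensorActR k H U V W (comul.lTensor H (comul (R := k) (1 : H))) y = y := by
    rw [hy, ← coassoc_apply, ← assoc_tensorActL, ← rTensor_incl_tensorAct, tensorAct_incl]
  rw [e₁, lTensor_incl_tensorAct, e₂, ← Module.End.mul_apply, ← map_mul, e₃, e₄]

end TensorT

/-! ### Multiplication, unit and counit as `H`-linear maps -/

namespace SourceCentralizer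
open QuantumGroupoid

section quantumGroupoid
variable {k : Type v} {H : Type u} {V : Type*} [Field k] [Ring H] [Algebra k H]
  [QuantumGroupoid k H] [AddCommGroup V] [Module k V]

local notation "S" => antipode (k := k)
local notation "S⁻¹" => LinearEquiv.symm (antipodeEquiv (k := k))
local notation "Ad" => adjoint k H
local notation "C" => SourceCentralizer k H
local notation "ι" => incl k H

variable (k H) in
/-- The map `Ad_1 : H → C_H(H_s)`. -/
noncomputable def ofAdjoint : H →ₗ[k] C :=
  LinearMap.codRestrict (Subalgebra.toSubmodule (sourceCentralizer k H)) (Ad 1) (adjoint_mem 1)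

theorem incl_ofAdjoint (h : H) : ι (ofAdjoint k H h) = Ad 1 h := rfl

theorem incl_mem_centralizer (c : C) : ι c ∈ sourceCentralizer k H := c.2

variable (k H) in
/-- The inclusion `C_H(H_s) ⊗_t C_H(H_s) → H ⊗ H`. -/
noncomputable def incl₂ : TensorT k H C C →ₗ[k] H ⊗[k] H :=
  TensorProduct.map ι ι ∘ₗ TensorT.incl k H C C

variable (k H) in
-- All modules over a field are flat. This is the passage from identities in the category to
-- identities in `H ⊗ H`.
theorem map_incl_injective : Function.Injective (TensorProduct.map ι ι) :=
  TensorProduct.map_injective_of_flat_flat _ _ incl_injective incl_injective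

variable (k H) in
theorem incl₂_injective : Function.Injective (incl₂ k H) :=
  (map_incl_injective k H).comp TensorT.incl_injective

variable (k H) in
theorem map_incl₂_injective : Function.Injective (TensorProduct.map ι (incl₂ k H)) :=
  TensorProduct.map_injective_of_flat_flat _ _ incl_injective (incl₂_injective k H)

theorem sweedler_incl₂ (x : TensorT k H C C) {F : H → H → V}
    (h₁ : ∀ b, IsLin k (fun a => F a b) := by fun_prop)
    (h₂ : ∀ a, IsLin k (fun b => F a b) := by fun_prop) :
    sweedler (incl₂ k H x) F = sweedler (TensorT.incl k H C C x) fun m n => F (ι m) (ι n) := by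
  rw [incl₂, LinearMap.comp_apply, sweedler_map _ _ _ h₁ h₂]

theorem map_incl_tensorAct (X : H ⊗[k] H) (x : C ⊗[k] C) :
    TensorProduct.map ι ι (tensorAct k H C C X x) = sweedler X fun p q =>
      sweedler (TensorProduct.map ι ι x) fun m n => Ad p m ⊗ₜ Ad q n := by
  rw [tensorAct_eq_sweedler, map_sweedler]
  congr 1; ext p q
  rw [sweedler_map, tensorAct_tmul_eq_sweedler, map_sweedler]
  rfl

theorem incl₂_smul (h : H) (x : TensorT k H C C) : incl₂ k H (h • x) =
    sweedler (comul (R := k) h) fun p q => sweedler (incl₂ k H x) fun m n => Ad p m ⊗ₜ Ad q n := by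
  rw [incl₂, LinearMap.comp_apply, TensorT.incl_smul, map_incl_tensorAct]
  rfl

theorem incl₂_proj (x : C ⊗[k] C) : incl₂ k H (TensorT.proj k H C C x) =
    sweedler (comul (R := k) (1 : H)) fun p q =>
      sweedler (TensorProduct.map ι ι x) fun m n => Ad p m ⊗ₜ Ad q n := by
  rw [incl₂, LinearMap.comp_apply, TensorT.incl_proj, map_incl_tensorAct]

variable (k H) in
/-- The product of `C_H(H_s)`. -/
noncomputable def mulₗ : C →ₗ[k] C →ₗ[k] C :=
  LinearMap.mk₂ k (fun a b => ⟨ι a * ι b, mul_mem (incl_mem_centralizer a)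
    (incl_mem_centralizer b)⟩)
    (fun a b c => incl_injective (by
      change (ι (a + b)) * ι c = ι (_ + _); rw [map_add, add_mul]; rfl))
    (fun r a b => incl_injective (by
      change (ι (r • a)) * ι b = ι (r • _); rw [map_smul, smul_mul_assoc]; rfl))
    (fun a b c => incl_injective (by
      change ι a * (ι (b + c)) = ι (_ + _); rw [map_add, mul_add]; rfl))
    (fun r a b => incl_injective (by
      change ι a * (ι (r • b)) = ι (r • _); rw [map_smul, mul_smul_comm]; rfl))

theorem incl_mulₗ (a b : C) : ι (mulₗ k H a b) = ι a * ι b := rfl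

variable (k H) in
/-- The multiplication of the Hopf monoid `C_H(H_s)`. -/
noncomputable def mulHom : TensorT k H C C →ₗ[H] C :=
  TensorT.lift (TensorProduct.lift (mulₗ k H)) fun h x => incl_injective (by
    conv_lhs => rw [eq_sweedler (tensorAct k H C C (comul h) x)]
    simp only [map_sweedler, lift.tmul, incl_mulₗ, incl_smul]
    rw [← sweedler_map ι ι _ (F := fun a b => a * b), map_incl_tensorAct, sweedler_sweedler]
    have e : ∀ p q : H, sweedler (sweedler (TensorProduct.map ι ι x) fun m n =>
        Ad p m ⊗ₜ[k] Ad q n) (fun a b => a * b) =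
        sweedler (TensorProduct.map ι ι x) fun m n => Ad p m * Ad q n := by
      intro p q
      rw [sweedler_sweedler]
      congr 1; ext m n
      rw [sweedler_tmul]
    simp only [e]
    rw [sweedler_swap, sweedler_map]
    conv_rhs => rw [eq_sweedler x]
    simp only [map_sweedler, lift.tmul, incl_mulₗ,
      sweedler_adjoint_mul_adjoint _ _ (incl_mem_centralizer _)])

theorem mulHom_tmk (a b : C) : ι (mulHom k H (TensorT.tmk a b)) = ι a * ι b := by
  rw [mulHom, TensorT.lift_tmk]; rfl

theorem incl_mulHom (x : TensorT k H C C) :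
    ι (mulHom k H x) = sweedler (TensorT.incl k H C C x) fun a b => ι a * ι b := by
  change ι (TensorProduct.lift (mulₗ k H) (TensorT.incl k H C C x)) = _
  rw [lift_eq_sweedler, map_sweedler]
  rfl

variable (k H) in
/-- The unit of the Hopf monoid `C_H(H_s)`. -/
noncomputable def unitHom : TargetSpace k H →ₗ[H] C where
  toFun z := ⟨TargetSpace.incl k H z, target_mem (TargetSpace.targetMap_incl z)⟩
  map_add' _ _ := rfl
  map_smul' h z := incl_injective (by
    change TargetSpace.incl k H (h • z) = Ad h (TargetSpace.incl k H z)
    rw [TargetSpace.incl_smul, adjoint_target _ (TargetSpace.targetMap_incl z)])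

theorem incl_unitHom (z : TargetSpace k H) : ι (unitHom k H z) = TargetSpace.incl k H z := rfl

variable (k H) in
/-- The counit of the Hopf monoid `C_H(H_s)`. -/
noncomputable def counitHom : C →ₗ[H] TargetSpace k H where
  toFun c := TargetSpace.ofTarget k H (ι c)
  map_add' _ _ := by simp only [map_add]
  map_smul' h c := TargetSpace.incl_injective (by
    change targetMap k (Ad h (ι c)) = targetMap k (h * targetMap k (ι c))
    rw [targetMap_adjoint _ (incl_mem_centralizer c), WeakBialgebra.targetMap_mul_targetMap])

theorem incl_counitHom (c : C) :
    TargetSpace.incl k H (counitHom k H c) = targetMap k (ι c) := rfl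

theorem target_smul (z : TargetSpace k H) (c : C) :
    ι (TargetSpace.incl k H z • c) = TargetSpace.incl k H z * ι c :=
  adjoint_target_left (TargetSpace.targetMap_incl z) (incl_mem_centralizer c)

/-- The right unit constraint acts by `S⁻¹(z)`; under `Ad` this is right multiplication by `z`, so
the right unit and counit axioms take their expected form. -/
theorem symm_target_smul (z : TargetSpace k H) (c : C) :
    ι (S⁻¹ (TargetSpace.incl k H z) • c) = ι c * TargetSpace.incl k H z := by
  rw [incl_smul, adjoint_source_left (sourceMap_symm (TargetSpace.targetMap_incl z))
    (incl_mem_centralizer c), antipode_symm]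

theorem mulHom_assoc : mulHom k H ∘ₗ TensorT.map (mulHom k H) LinearMap.id =
    mulHom k H ∘ₗ TensorT.map LinearMap.id (mulHom k H) ∘ₗ TensorT.assocHom :=
  TensorT.hom_ext₃ fun a b c => incl_injective (by
    simp only [LinearMap.comp_apply, TensorT.map_tmk, TensorT.assocHom_tmk, mulHom_tmk,
      LinearMap.id_apply, mul_assoc])

theorem mulHom_unit_left :
    mulHom k H ∘ₗ TensorT.map (unitHom k H) LinearMap.id = TensorT.leftUnit :=
  TensorT.hom_ext fun z c => incl_injective (by
    simp only [LinearMap.comp_apply, TensorT.map_tmk, mulHom_tmk, TensorT.leftUnit_tmk,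
      LinearMap.id_apply, target_smul, incl_unitHom])

theorem mulHom_unit_right :
    mulHom k H ∘ₗ TensorT.map LinearMap.id (unitHom k H) = TensorT.rightUnit :=
  TensorT.hom_ext fun c z => incl_injective (by
    simp only [LinearMap.comp_apply, TensorT.map_tmk, mulHom_tmk, TensorT.rightUnit_tmk,
      LinearMap.id_apply, symm_target_smul, incl_unitHom])

theorem counitHom_mulHom : counitHom k H ∘ₗ mulHom k H =
    TensorT.leftUnit ∘ₗ TensorT.map (counitHom k H) (counitHom k H) :=
  TensorT.hom_ext fun a b => TargetSpace.incl_injective (by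
    simp only [LinearMap.comp_apply, TensorT.map_tmk, TensorT.leftUnit_tmk, incl_counitHom,
      mulHom_tmk, TargetSpace.incl_smul, targetMap_mul_of_mem (incl_mem_centralizer a),
      targetMap_target_mul, WeakBialgebra.targetMap_targetMap])

theorem counitHom_unitHom : counitHom k H ∘ₗ unitHom k H = LinearMap.id := by
  ext z
  apply TargetSpace.incl_injective
  simp only [LinearMap.comp_apply, incl_counitHom, incl_unitHom, TargetSpace.targetMap_incl,
    LinearMap.id_apply]

end quantumGroupoid

/-! ### Comultiplication and antipode as `H`-linear maps; the Hopf axioms -/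

section quasitriangular
open QuasitriangularQuantumGroupoid
variable {k : Type v} {H : Type u} {V : Type*} [Field k] [Ring H] [Algebra k H]
  [QuasitriangularQuantumGroupoid k H] [AddCommGroup V] [Module k V]

local notation "S" => antipode (k := k)
local notation "S⁻¹" => LinearEquiv.symm (antipodeEquiv (k := k))
local notation "Ad" => adjoint k H
local notation "C" => SourceCentralizer k H
local notation "ι" => incl k H
local notation "𝖱" => R (k := k) (H := H)

/-- The comultiplication of `C_H(H_s)`, as a function. -/
noncomputable def comulFun (c : C) : TensorT k H C C :=
  TensorT.proj k H C C (TensorProduct.map (ofAdjoint k H) (ofAdjoint k H)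
    (braidedComul k H (ι c)))

/-- Equivariance at `h = 1`, with `Ad_1(c) = c`, shows that the action of `Δ(1)` fixes
`braidedComul`. Neither the retraction `Ad_1` on the legs nor the projection onto `C ⊗_t C` changes
it, so it lies in `C ⊗_t C`. -/
theorem incl₂_comulFun (c : C) : incl₂ k H (comulFun c) = braidedComul k H (ι c) := by
  rw [comulFun, incl₂_proj]
  conv_rhs => rw [← adjoint_one_mem (incl_mem_centralizer c), braidedComul_adjoint]
  congr 1; ext p q
  rw [sweedler_map, sweedler_map]
  simp only [incl_ofAdjoint, ← adjoint_mul, mul_one]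

variable (k H) in
/-- The comultiplication of the Hopf monoid `C_H(H_s)`. -/
noncomputable def comulHom : C →ₗ[H] TensorT k H C C where
  toFun := comulFun
  map_add' x y := incl₂_injective k H (by
    simp only [map_add, incl₂_comulFun]
    exact isLin_braidedComul.map_add _ _)
  map_smul' h x := incl₂_injective k H (by
    simp only [RingHom.id_apply, incl₂_comulFun, incl_smul, braidedComul_adjoint, incl₂_smul])

theorem incl₂_comulHom (c : C) : incl₂ k H (comulHom k H c) = braidedComul k H (ι c) :=
  incl₂_comulFun c

theorem sweedler_comulHom (c : C) {F : H → H → V}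
    (h₁ : ∀ b, IsLin k (fun a => F a b) := by fun_prop)
    (h₂ : ∀ a, IsLin k (fun b => F a b) := by fun_prop) :
    sweedler (TensorT.incl k H C C (comulHom k H c)) (fun m n => F (ι m) (ι n)) =
      sweedler (braidedComul k H (ι c)) F := by
  rw [← incl₂_comulHom, sweedler_incl₂ _ h₁ h₂]

/-- By equivariance at `h = 1` the value is in the image of `Ad_1`, which is contained in the
centralizer. -/
theorem braidedAntipode_mem (c : C) : braidedAntipode k H (ι c) ∈ sourceCentralizer k H := by
  rw [← adjoint_one_mem (incl_mem_centralizer c), braidedAntipode_adjoint]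
  exact adjoint_mem _ _

variable (k H) in
/-- The antipode of the Hopf monoid `C_H(H_s)`. -/
noncomputable def antipodeHom : C →ₗ[H] C where
  toFun c := ⟨braidedAntipode k H (ι c), braidedAntipode_mem c⟩
  map_add' x y := incl_injective (by
    change braidedAntipode k H (ι (x + y)) = _
    rw [map_add]
    exact isLin_braidedAntipode.map_add _ _)
  map_smul' h x := incl_injective (by
    change braidedAntipode k H (ι (h • x)) = Ad h (braidedAntipode k H (ι x))
    rw [incl_smul, braidedAntipode_adjoint])

theorem incl_antipodeHom (c : C) : ι (antipodeHom k H c) = braidedAntipode k H (ι c) := rfl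

theorem counit_left : TensorT.leftUnit ∘ₗ TensorT.map (counitHom k H) LinearMap.id ∘ₗ
    comulHom k H = LinearMap.id := by
  ext c
  apply incl_injective
  have e : ∀ x : TensorT k H C C,
      ι (TensorT.leftUnit (TensorT.map (counitHom k H) LinearMap.id x)) =
      sweedler (TensorT.incl k H C C x) fun m n => targetMap k (ι m) * ι n := by
    intro x
    change ι (TensorProduct.lift _ (TensorT.incl k H (TargetSpace k H) C
      (TensorT.map (counitHom k H) LinearMap.id x))) = _
    rw [TensorT.incl_map, lift_eq_sweedler, sweedler_map, map_sweedler]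
    congr 1; ext m n
    exact target_smul (counitHom k H m) n
  simp only [LinearMap.comp_apply, e, LinearMap.id_apply]
  rw [sweedler_comulHom c (F := fun m n => targetMap k m * n),
    sweedler_braidedComul_targetMap_mul (incl_mem_centralizer c)]

theorem counit_right : TensorT.rightUnit ∘ₗ TensorT.map LinearMap.id (counitHom k H) ∘ₗ
    comulHom k H = LinearMap.id := by
  ext c
  apply incl_injective
  have e : ∀ x : TensorT k H C C,
      ι (TensorT.rightUnit (TensorT.map LinearMap.id (counitHom k H) x)) =
      sweedler (TensorT.incl k H C C x) fun m n => ι m * targetMap k (ι n) := by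
    intro x
    change ι (TensorProduct.lift _ (TensorProduct.comm k _ _ (TensorT.incl k H C (TargetSpace k H)
      (TensorT.map LinearMap.id (counitHom k H) x)))) = _
    rw [TensorT.incl_map, lift_eq_sweedler, sweedler_tensorComm, sweedler_map, map_sweedler]
    congr 1; ext m n
    exact symm_target_smul (counitHom k H n) m
  simp only [LinearMap.comp_apply, e, LinearMap.id_apply]
  rw [sweedler_comulHom c (F := fun m n => m * targetMap k n),
    sweedler_braidedComul_mul_targetMap (incl_mem_centralizer c)]

/-- `1 ⊗_t z` is `Ad_{1₁}(1) ⊗ Ad_{1₂}(z) = S(1₁) ⊗ 1₂ z`, the value found in `braidedComul_target`.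
-/
theorem comulHom_unitHom (z : TargetSpace k H) : comulHom k H (unitHom k H z) =
    TensorT.tmk (unitHom k H (TargetSpace.ofTarget k H 1)) (unitHom k H z) := by
  apply incl₂_injective k H
  have hz := TargetSpace.targetMap_incl z
  rw [incl₂_comulHom, incl_unitHom, braidedComul_target hz, TensorT.tmk, incl₂_proj]
  refine sweedler_one_congr fun p q hp hq => ?_
  rw [map_tmul, sweedler_tmul, incl_unitHom, incl_unitHom, TargetSpace.incl_ofTarget,
    targetMap_one, adjoint_source_left hp (one_mem _), one_mul,
    adjoint_target_left hq (target_mem hz)]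

theorem comulHom_assoc : TensorT.map LinearMap.id (comulHom k H) ∘ₗ comulHom k H =
    TensorT.assocHom ∘ₗ TensorT.map (comulHom k H) LinearMap.id ∘ₗ comulHom k H := by
  ext c
  apply TensorT.incl_injective
  apply map_incl₂_injective k H
  simp only [LinearMap.comp_apply]
  have e₁ : ∀ X, TensorProduct.map ι (incl₂ k H) X =
      TensorProduct.map ι (TensorProduct.map ι ι) ((TensorT.incl k H C C).lTensor C X) := by
    intro X
    rw [LinearMap.lTensor, ← LinearMap.comp_apply, ← TensorProduct.map_comp]
    rfl
  have e₂ : ∀ X : (C ⊗[k] C) ⊗[k] C,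
      TensorProduct.map ι (TensorProduct.map ι ι) (TensorProduct.assoc k C C C X) =
      TensorProduct.assoc k H H H (TensorProduct.map (TensorProduct.map ι ι) ι X) := by
    intro X
    rw [← LinearEquiv.coe_coe, ← LinearMap.comp_apply, TensorProduct.map_map_comp_assoc_eq]
    rfl
  -- Inside `H ⊗ (H ⊗ H)` the associator of the category is the ordinary one, and
  -- `braidedComul_coassoc` applies.
  conv_rhs => rw [e₁, TensorT.incl_assocHom, e₂]
  rw [TensorT.incl_map, TensorT.incl_map, eq_sweedler (TensorT.incl k H C C (comulHom k H c))]
  simp only [map_sweedler, map_tmul, LinearMap.rTensor_tmul]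
  have h := braidedComul_coassoc (k := k) (ι c)
  rw [← sweedler_comulHom, ← sweedler_comulHom] at h
  simp only [← incl₂_comulHom] at h
  exact h

theorem antipode_left : mulHom k H ∘ₗ TensorT.map (antipodeHom k H) LinearMap.id ∘ₗ comulHom k H =
    unitHom k H ∘ₗ counitHom k H := by
  ext c
  apply incl_injective
  simp only [LinearMap.comp_apply, incl_mulHom]
  rw [TensorT.incl_map]
  rw [← sweedler_map ι ι _ (F := fun a b => a * b), ← LinearMap.comp_apply (TensorProduct.map ι ι),
    ← TensorProduct.map_comp, sweedler_map]
  exact (sweedler_comulHom c (F := fun m n => braidedAntipode k H m * n)).trans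
    (sweedler_braidedComul_antipode_mul (incl_mem_centralizer c))

theorem antipode_right : mulHom k H ∘ₗ TensorT.map LinearMap.id (antipodeHom k H) ∘ₗ comulHom k H =
    unitHom k H ∘ₗ counitHom k H := by
  ext c
  apply incl_injective
  simp only [LinearMap.comp_apply, incl_mulHom]
  rw [TensorT.incl_map]
  rw [← sweedler_map ι ι _ (F := fun a b => a * b), ← LinearMap.comp_apply (TensorProduct.map ι ι),
    ← TensorProduct.map_comp, sweedler_map]
  exact (sweedler_comulHom c (F := fun m n => m * braidedAntipode k H n)).trans
    (sweedler_braidedComul_mul_antipode (incl_mem_centralizer c))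

variable (k H) in
/-- The interchange of the two middle factors by the braiding. -/
noncomputable def interchange : TensorT k H (TensorT k H C C) (TensorT k H C C) →ₗ[H]
    TensorT k H (TensorT k H C C) (TensorT k H C C) :=
  TensorT.assocInv ∘ₗ TensorT.map LinearMap.id TensorT.assocHom ∘ₗ
    TensorT.map LinearMap.id (TensorT.map TensorT.braid LinearMap.id) ∘ₗ
      TensorT.map LinearMap.id TensorT.assocInv ∘ₗ TensorT.assocHom

/-- Reassociation only moves brackets on elements `u ⊗_t v ⊗_t w`, so the braiding of the middle
factors is all that contributes. Arbitrary `x` and `y` in `C ⊗ C` are allowed because the statement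
is read after projection. -/
theorem map_mulHom_interchange (x y : C ⊗[k] C) :
    TensorT.map (mulHom k H) (mulHom k H) (interchange k H
      (TensorT.tmk (TensorT.proj k H C C x) (TensorT.proj k H C C y))) =
    TensorT.proj k H C C (sweedler x fun a b => sweedler y fun m n => sweedler 𝖱 fun c d =>
      mulHom k H (TensorT.tmk a (d • m)) ⊗ₜ mulHom k H (TensorT.tmk (c • b) n)) := by
  have tmk_sweedler : ∀ {U W M N : Type u} [AddCommGroup U] [Module k U] [Module H U]
      [IsScalarTower k H U] [AddCommGroup W] [Module k W] [Module H W] [IsScalarTower k H W]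
      [AddCommGroup M] [Module k M] [AddCommGroup N] [Module k N] (u : U) (X : M ⊗[k] N)
      (F : M → N → W), TensorT.tmk (k := k) (H := H) u (sweedler X F) =
        sweedler X fun a b => TensorT.tmk u (F a b) := by
    intros
    simp only [TensorT.tmk, tmul_sweedler, map_sweedler]
  have sweedler_tmk : ∀ {U W M N : Type u} [AddCommGroup U] [Module k U] [Module H U]
      [IsScalarTower k H U] [AddCommGroup W] [Module k W] [Module H W] [IsScalarTower k H W]
      [AddCommGroup M] [Module k M] [AddCommGroup N] [Module k N] (u : U) (X : M ⊗[k] N)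
      (F : M → N → W), TensorT.tmk (k := k) (H := H) (sweedler X F) u =
        sweedler X fun a b => TensorT.tmk (F a b) u := by
    intros
    simp only [TensorT.tmk, sweedler_tmul_const, map_sweedler]
  have hb : ∀ b m : C, TensorT.braid (TensorT.tmk (k := k) (H := H) b m) =
      sweedler 𝖱 fun c d => TensorT.tmk (d • m) (c • b) := by
    intro b m
    rw [TensorT.braid_tmk]
    rw [tensorAct_eq_sweedler, map_sweedler, map_sweedler]
    rfl
  conv_lhs => rw [eq_sweedler x, eq_sweedler y]
  simp only [map_sweedler, tmk_sweedler, sweedler_tmk]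
  rw [sweedler_swap]
  congr 1; ext a b
  congr 1; ext m n
  change TensorT.map _ _ (interchange k H (TensorT.tmk (TensorT.tmk a b) (TensorT.tmk m n))) = _
  simp only [interchange, LinearMap.comp_apply, TensorT.assocHom_tmk, TensorT.map_tmk,
    TensorT.assocInv_tmk, hb, LinearMap.id_apply, sweedler_tmk, tmk_sweedler, map_sweedler]
  rfl

theorem comulHom_mulHom : comulHom k H ∘ₗ mulHom k H =
    TensorT.map (mulHom k H) (mulHom k H) ∘ₗ interchange k H ∘ₗ
      TensorT.map (comulHom k H) (comulHom k H) := by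
  refine TensorT.hom_ext fun g l => ?_
  simp only [LinearMap.comp_apply, TensorT.map_tmk]
  -- Each comultiplication is written as the projection of its own inclusion, which supplies
  -- representatives in `C ⊗ C`. The equality already holds before the outer projection is applied.
  rw [← TensorT.proj_incl (comulHom k H g), ← TensorT.proj_incl (comulHom k H l),
    map_mulHom_interchange, ← TensorT.proj_incl (comulHom k H (mulHom k H _))]
  congr 1
  apply map_incl_injective k H
  refine (incl₂_comulHom _).trans ?_
  rw [mulHom_tmk, ← braidedComul_mul g l (incl₂_comulHom l), ← sweedler_comulHom]
  simp only [map_sweedler, map_tmul, mulHom_tmk, incl_smul]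

end quasitriangular
end SourceCentralizer

/-! ### Assembly of the Hopf monoid -/

namespace SourceCentralizer
open CategoryTheory MonoidalCategory

variable (k : Type v) (H : Type u) [Field k] [Ring H] [Algebra k H]
  [QuasitriangularQuantumGroupoid k H]

/-- The monoid `C_H(H_s)` in the category of left `H`-modules. -/
noncomputable instance : MonObj (obj k H) where
  one := (⟨unitHom k H⟩ : LeftMod.Hom (𝟙_ (LeftMod k H)) (obj k H))
  mul := (⟨mulHom k H⟩ : LeftMod.Hom (obj k H ⊗ obj k H) (obj k H))
  one_mul := LeftMod.hom_ext mulHom_unit_left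
  mul_one := LeftMod.hom_ext mulHom_unit_right
  mul_assoc := LeftMod.hom_ext mulHom_assoc

/-- The comonoid `C_H(H_s)` in the category of left `H`-modules. -/
noncomputable instance : ComonObj (obj k H) where
  counit := (⟨counitHom k H⟩ : LeftMod.Hom (obj k H) (𝟙_ (LeftMod k H)))
  comul := (⟨comulHom k H⟩ : LeftMod.Hom (obj k H) (obj k H ⊗ obj k H))
  -- The axiom is phrased with the inverse unit constraint; composing with the constraint gives the
  -- form proved above.
  counit_comul := (Iso.comp_hom_eq_id (λ_ (obj k H))).1 (LeftMod.hom_ext counit_left)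
  comul_counit := (Iso.comp_hom_eq_id (ρ_ (obj k H))).1 (LeftMod.hom_ext counit_right)
  comul_assoc := LeftMod.hom_ext comulHom_assoc

/-- The bimonoid `C_H(H_s)` in the category of left `H`-modules. -/
noncomputable instance : BimonObj (obj k H) where
  -- `interchange` composes associators and braiding in the same order as the categorical exchange
  -- of middle factors, so both sides agree by unfolding.
  mul_comul := LeftMod.hom_ext comulHom_mulHom
  -- The inverse left unit constraint sends `z` to `1 ⊗_t z`.
  one_comul := LeftMod.hom_ext (LinearMap.ext fun z => (comulHom_unitHom z).trans
    (TensorT.map_tmk _ _ _ _).symm)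
  mul_counit := LeftMod.hom_ext counitHom_mulHom
  one_counit := LeftMod.hom_ext counitHom_unitHom

/-- The Hopf monoid `C_H(H_s)` in the category of left `H`-modules. -/
noncomputable instance : HopfObj (obj k H) where
  antipode := (⟨antipodeHom k H⟩ : LeftMod.Hom (obj k H) (obj k H))
  antipode_left := LeftMod.hom_ext antipode_left
  antipode_right := LeftMod.hom_ext antipode_right

end SourceCentralizer

end QuasitriangularQuantumGroupoid

theorem corollary2p5 {k : Type v} {H : Type u} [Field k] [Ring H] [Algebra k H]
    [QuasitriangularQuantumGroupoid k H] :
    (∀ (h : H) (g : SourceCentralizer k H), SourceCentralizer.incl k H (h • g) =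
        adjoint k H h (SourceCentralizer.incl k H g)) ∧
    ∃ 𝓗 : CategoryTheory.HopfObj (SourceCentralizer.obj k H),
      (∀ g l : SourceCentralizer k H,
        SourceCentralizer.incl k H (𝓗.mul.lin (TensorT.tmk (k := k) (H := H) g l)) =
          SourceCentralizer.incl k H g * SourceCentralizer.incl k H l) ∧
      (∀ x : TargetSpace k H,
        SourceCentralizer.incl k H (𝓗.one.lin x) = TargetSpace.incl k H x) ∧
      (∀ g : SourceCentralizer k H,
        TensorProduct.map (SourceCentralizer.incl k H) (SourceCentralizer.incl k H)
          (TensorT.incl k H (SourceCentralizer k H) (SourceCentralizer k H) (𝓗.comul.lin g)) =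
          braidedComul k H (SourceCentralizer.incl k H g)) ∧
      (∀ g : SourceCentralizer k H,
        TargetSpace.incl k H (𝓗.counit.lin g) = targetMap k (SourceCentralizer.incl k H g)) ∧
      (∀ g : SourceCentralizer k H,
        SourceCentralizer.incl k H (𝓗.antipode.lin g) =
          braidedAntipode k H (SourceCentralizer.incl k H g)) :=
  -- The comultiplication formula is stated through the inclusion of `C ⊗_t C` into `H ⊗ H`, so it
  -- also records where the right-hand side lies.
  ⟨SourceCentralizer.incl_smul, inferInstance, SourceCentralizer.mulHom_tmk, SourceCentralizer.incl_unitHom,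
    SourceCentralizer.incl₂_comulHom, SourceCentralizer.incl_counitHom,
    SourceCentralizer.incl_antipodeHom⟩
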